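/- **Proposition 3.1.** All manifolds, maps and forms are $C^\infty$. A CR manifold of dimension $2n+1$ is a manifold $M$ of that dimension with an involutive complex subbundle $\mathcal V\subset\mathbb CTM$ of rank $n$ such that $\mathcal V\cap\bar{\mathcal V}=0$; put $T^{1,0}M=\bar{\mathcal V}$ and let $T'M$ be the bundle of complex covectors annihilating $\mathcal V$. A contact form is a nowhere vanishing real section $\theta$ of $T'M$; its Levi form is $(Z,W)\mapsto -i\,d\theta(Z,\bar W)$ on $T^{1,0}M$, and its characteristic vector field $T$ is given by $\langle\theta,T\rangle=1$, $T\lrcorner d\theta=0$. $M$ is Levi-nondegenerate if the Levi forms are nondegenerate, and has signature $l$ if $l$ is the minimum of the numbers of negative and positive eigenvalues of the Levi form at every point. An admissible coframe on an open set is a frame $(\theta,\theta^1,\dots,\theta^n)$ of $T'M$ there, with $\theta$ a contact form and $\langle\theta^\alpha,T\rangle=0$; its Levi matrix is the matrix of the Levi form of $\theta$ in the frame $(L_\alpha)$ of $T^{1,0}M$ for which $(T,L_\alpha,\bar L_\alpha)$ is dual to $(\theta,\theta^\alpha,\overline{\theta^\alpha})$. A CR map $f:M\to\hat M$ is a map with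 $f_*\mathcal V\subset\hat{\mathcal V}$; it is CR transversal at $p$ if $(f^*\hat\theta)_p\neq0$ for the contact forms $\hat\theta$ of $\hat M$ near $f(p)$. $U(m,j)$ denotes the group of complex $m\times m$ matrices preserving the Hermitian form $\mathrm{diag}(-1,\dots,-1,1,\dots,1)$ with $j$ entries $-1$ and $m-j$ entries $1$. Let $M$ and $\hat M$ be Levi-nondegenerate CR manifolds of dimensions $2n+1$ and $2\hat n+1$ and signatures $l\le n/2$ and $\hat l\le\hat n/2$. Let $f:M\to\hat M$ be a CR map that is CR transversal at every point of $M$, let $(\theta,\theta^\alpha)$ be an admissible coframe on an open set $U\subset M$, and let $p_0\in U$. Then $n\le\hat n$, and the following hold. 1. There are an open neighborhood $W\subset U$ of $p_0$, an open set $\hat W\supset f(W)$ in $\hat M$ and an admissible coframe $(\hat\theta,\hat\theta^A)_{A=1}^{\hat n}=(\hat\theta,\hat\theta^\alpha,\hat\theta^a)$ on $\hat W$, where $\alpha\le n<a\le\hat n$, such that $f^*(\hat\theta,\hat\theta^\alpha,\hat\theta^a)=(\theta,\theta^\alpha,0)$ on $W$. 2. For every such coframe the characteristic vector field $\hat T$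 of $\hat\theta$ is tangent to $f(W)$; in fact $\hat T_{f(p)}=df_p(T_p)$ for $p\in W$. 3. Suppose that the Levi matrix of $(\theta,\theta^\alpha)$ is constant on $U$ and diagonal with diagonal elements $-1$ ($l$ times), $1$ ($n-l$ times). Let $k$ be the number of negative eigenvalues of the Levi form at $f(p_0)$ of a contact form $\hat\theta$ of $\hat M$ with $(f^*\hat\theta)_{p_0}=\theta_{p_0}$. Then $k=\hat l$ or $k=\hat n-\hat l$ (that is, $k=\hat l$ whenever $\hat M$ is co-oriented by $\theta$ so that the signature counts the negative eigenvalues), $l\le k$, $n-l\le\hat n-k$, and the coframe in 1 can be chosen such that its Levi matrix is constant on $\hat W$ and diagonal with diagonal elements $-1$ ($l$ times), $1$ ($n-l$ times), $-1$ ($k-l$ times), $1$ ($\hat n-n-k+l$ times). 4. In the situation of 3, the coframe with this additional property is uniquely determined along $M$ up to $U(n,l)\times U(\hat n-n,k-l)$. Precisely: let two coframes $(\hat\theta,\hat\theta^\alpha,\hat\theta^a)$ and $(\tilde\theta,\tilde\theta^\alpha,\tilde\theta^a)$ as in 3 pull back on an open $W\subset U$ to $(\theta,\theta_1^\alpha,0)$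 and $(\theta,\theta_2^\alpha,0)$, where $(\theta,\theta_1^\alpha)$ and $(\theta,\theta_2^\alpha)$ are admissible (for instance both equal to $(\theta,\theta^\alpha)$). Then at $f(p)$, for every $p\in W$, $\tilde\theta=\hat\theta$, $\tilde\theta^\alpha=u^\alpha{}_\beta\hat\theta^\beta$ and $\tilde\theta^a=v^a{}_b\hat\theta^b$ for some $u\in U(n,l)$ and $v\in U(\hat n-n,k-l)$. Conversely, if $u:\hat W\to U(n,l)$ and $v:\hat W\to U(\hat n-n,k-l)$ are smooth and $(\hat\theta,\hat\theta^\alpha,\hat\theta^a)$ is a coframe as in 3 on $\hat W$, then $(\hat\theta,u^\alpha{}_\beta\hat\theta^\beta,v^a{}_b\hat\theta^b)$ is an admissible coframe with the same Levi matrix, and it pulls back to $(\theta,(u^\alpha{}_\beta\circ f)\,\theta^\beta,0)$. -/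

import Mathlib

open scoped Manifold ContDiff TensorProduct Matrix

noncomputable section

namespace CRGeom

/-! ### One-forms, exterior derivative, complexified tangent vectors

Manifolds are smooth, without boundary, modelled on a finite-dimensional real vector space `E`. -/

section Forms

variable (E : Type*) [NormedAddCommGroup E] [NormedSpace ℝ E]
  (M : Type*) [TopologicalSpace M] [ChartedSpace E M]

/-- One-forms on `M` with values in `F` (`F = ℝ` or `F = ℂ`); smoothness is a separate condition. -/
abbrev OneForm (F : Type*) [NormedAddCommGroup F] [NormedSpace ℝ F] : Type _ :=
  ∀ p : M, TangentSpace 𝓘(ℝ, E) p →L[ℝ] F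

variable {E M}

/-- The complexified tangent space `ℂ T_p M`. -/
abbrev CTangent (p : M) : Type _ := ℂ ⊗[ℝ] TangentSpace 𝓘(ℝ, E) p

/-- The complexified tangent vector `v + i w`. -/
def cvec (p : M) (v w : TangentSpace 𝓘(ℝ, E) p) : CTangent (E := E) p :=
  (1 : ℂ) ⊗ₜ[ℝ] v + Complex.I ⊗ₜ[ℝ] w

/-- Complex conjugation `v + i w ↦ v - i w` on `ℂ T_p M`. -/
def conjT (p : M) : CTangent (E := E) p →ₗ[ℝ] CTangent (E := E) p :=
  LinearMap.rTensor (TangentSpace 𝓘(ℝ, E) p) Complex.conjAe.toLinearMap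

/-- The `ℂ`-linear extension to `ℂ T_p M` of a complex-valued covector. -/
def evalC (p : M) (η : TangentSpace 𝓘(ℝ, E) p →L[ℝ] ℂ) : CTangent (E := E) p →ₗ[ℂ] ℂ :=
  LinearMap.liftBaseChange ℂ η.toLinearMap

/-- A real covector regarded as a complex-valued one. -/
def toComplex (p : M) (η : TangentSpace 𝓘(ℝ, E) p →L[ℝ] ℝ) : TangentSpace 𝓘(ℝ, E) p →L[ℝ] ℂ :=
  Complex.ofRealCLM.comp η

section

variable {F : Type*} [NormedAddCommGroup F] [NormedSpace ℝ F]

/-- Smoothness on `U` of a one-form, as a section of the bundle of linear maps `TM → F`. -/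
def SmoothForm [IsManifold 𝓘(ℝ, E) ∞ M] (U : Set M) (η : OneForm E M F) : Prop :=
  ContMDiffOn 𝓘(ℝ, E) (𝓘(ℝ, E).prod 𝓘(ℝ, E →L[ℝ] F)) ∞
    (fun p ↦ Bundle.TotalSpace.mk' (E →L[ℝ] F)
      (E := fun q : M ↦ TangentSpace 𝓘(ℝ, E) q →L[ℝ] F) p (η p)) U

/-- The form `η` in the preferred chart at `p`: its pullback under the inverse of the chart. -/
def chartRep (η : OneForm E M F) (p : M) : E → E →L[ℝ] F := fun y ↦
  (η ((extChartAt 𝓘(ℝ, E) p).symm y)).comp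
    (mfderiv 𝓘(ℝ, E) 𝓘(ℝ, E) (extChartAt 𝓘(ℝ, E) p).symm y)

/-- The exterior derivative `dη` at `p`, computed in the preferred chart at `p` (the chart through
which Mathlib identifies `T_p M` with `E`):
`dη(v, w) = (D_v η)(w) - (D_w η)(v)`. -/
def extD (η : OneForm E M F) (p : M) :
    TangentSpace 𝓘(ℝ, E) p →L[ℝ] TangentSpace 𝓘(ℝ, E) p →L[ℝ] F :=
  let D : E →L[ℝ] E →L[ℝ] F := fderiv ℝ (chartRep η p) (extChartAt 𝓘(ℝ, E) p p)
  D - D.flip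

end

/-- The `ℂ`-bilinear extension of `dθ` to `ℂ T_p M`, for a real one-form `θ`. -/
def extDC (θ : OneForm E M ℝ) (p : M) : LinearMap.BilinForm ℂ (CTangent (E := E) p) :=
  LinearMap.BilinForm.baseChange ℂ (extD θ p).toBilinForm

/-- The Levi form of `θ`: `(Z, W) ↦ -i dθ(Z, W̄)`. It is used for `Z, W` of type `(1,0)`. -/
def leviForm (θ : OneForm E M ℝ) (p : M) (Z W : CTangent (E := E) p) : ℂ :=
  -Complex.I * extDC θ p Z (conjT p W)

/-- `T` is the value at `p` of the characteristic (Reeb) vector field of `θ`: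
`⟨θ, T⟩ = 1` and `T ⌟ dθ = 0`. -/
def IsReebAt (θ : OneForm E M ℝ) (p : M) (T : TangentSpace 𝓘(ℝ, E) p) : Prop :=
  θ p T = 1 ∧ ∀ v, extD θ p T v = 0

/-- Smoothness on `U` of a real vector field. -/
def SmoothField (U : Set M) [IsManifold 𝓘(ℝ, E) ∞ M] (X : ∀ p : M, TangentSpace 𝓘(ℝ, E) p) :
    Prop :=
  ContMDiffOn 𝓘(ℝ, E) 𝓘(ℝ, E).tangent ∞
    (fun p ↦ (Bundle.TotalSpace.mk' E p (X p) : TangentBundle 𝓘(ℝ, E) M)) U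

end Forms

/-! ### CR manifolds of hypersurface type -/

/-- A CR structure on a manifold `M` of dimension `2n+1`: a smooth complex subbundle `V ⊆ ℂ TM`
of rank `n` with `V ∩ V̄ = 0` that is closed under Lie brackets. Here `V̄ = T^{1,0} M`. -/
structure CRStructure (E : Type*) [NormedAddCommGroup E] [NormedSpace ℝ E]
    (M : Type*) [TopologicalSpace M] [ChartedSpace E M] [IsManifold 𝓘(ℝ, E) ∞ M] (n : ℕ) where
  dim_eq : Module.finrank ℝ E = 2 * n + 1
  V : ∀ p : M, Submodule ℂ (CTangent (E := E) p)
  rank_eq : ∀ p, Module.finrank ℂ (V p) = n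
  smooth : ∀ p : M, ∃ U : Set M, IsOpen U ∧ p ∈ U ∧
    ∃ X Y : Fin n → ∀ q : M, TangentSpace 𝓘(ℝ, E) q,
      (∀ j, SmoothField U (X j)) ∧ (∀ j, SmoothField U (Y j)) ∧
      ∀ q ∈ U, V q = Submodule.span ℂ (Set.range fun j ↦ cvec q (X j q) (Y j q))
  inf_conj : ∀ (p : M), ∀ Z ∈ V p, conjT p Z ∈ V p → Z = 0
  /-- `[X + iY, X' + iY'] = ([X, X'] - [Y, Y']) + i ([X, Y'] + [Y, X'])` is a section of `V`
  whenever `X + iY` and `X' + iY'` are. -/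
  involutive : ∀ U : Set M, IsOpen U → ∀ X Y X' Y' : (∀ q : M, TangentSpace 𝓘(ℝ, E) q),
    SmoothField U X → SmoothField U Y → SmoothField U X' → SmoothField U Y' →
    (∀ q ∈ U, cvec q (X q) (Y q) ∈ V q) → (∀ q ∈ U, cvec q (X' q) (Y' q) ∈ V q) →
    ∀ q ∈ U,
      cvec q
        (VectorField.mlieBracket 𝓘(ℝ, E) X X' q - VectorField.mlieBracket 𝓘(ℝ, E) Y Y' q)
        (VectorField.mlieBracket 𝓘(ℝ, E) X Y' q + VectorField.mlieBracket 𝓘(ℝ, E) Y X' q) ∈ V q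

section CR

variable {E : Type*} [NormedAddCommGroup E] [NormedSpace ℝ E]
  {M : Type*} [TopologicalSpace M] [ChartedSpace E M] [IsManifold 𝓘(ℝ, E) ∞ M] {n : ℕ}

/-- `Z ∈ T^{1,0}_p M = V̄_p`. -/
def CRStructure.IsHol (S : CRStructure E M n) (p : M) (Z : CTangent (E := E) p) : Prop :=
  conjT p Z ∈ S.V p

/-- The space `T'_p M` of `(1,0)`-covectors: the complex-valued covectors that annihilate `V_p`. -/
def CRStructure.holCotangent (S : CRStructure E M n) (p : M) :
    Submodule ℂ (TangentSpace 𝓘(ℝ, E) p →L[ℝ] ℂ) where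
  carrier := {η | ∀ Z ∈ S.V p, evalC p η Z = 0}
  add_mem' := by
    intro a b ha hb Z hZ
    have h : evalC p (a + b) = evalC p a + evalC p b := by
      ext v; simp [evalC]
    rw [h, LinearMap.add_apply, ha Z hZ, hb Z hZ, add_zero]
  zero_mem' := by
    intro Z _
    have h : evalC p (0 : TangentSpace 𝓘(ℝ, E) p →L[ℝ] ℂ) = 0 := by
      ext v; simp [evalC]
    rw [h, LinearMap.zero_apply]
  smul_mem' := by
    intro c a ha Z hZ
    have h : evalC p (c • a) = c • evalC p a := by
      ext v; simp [evalC]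
    rw [h, LinearMap.smul_apply, ha Z hZ, smul_zero]

/-- A contact form on `U` for the CR structure: a smooth nowhere vanishing real one-form that
annihilates `V` (and hence, being real, also `V̄`). -/
structure IsContactForm (S : CRStructure E M n) (U : Set M) (θ : OneForm E M ℝ) : Prop where
  smooth : SmoothForm U θ
  ne_zero : ∀ p ∈ U, θ p ≠ 0
  annihilates : ∀ p ∈ U, toComplex p (θ p) ∈ S.holCotangent p

/-- Levi nondegeneracy at every point (the Levi form is independent, up to a nonzero real factor,
of the local contact form). -/
def CRStructure.LeviNondegenerate (S : CRStructure E M n) : Prop :=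
  ∀ (p : M) (U : Set M) (θ : OneForm E M ℝ), IsOpen U → p ∈ U → IsContactForm S U θ →
    ∀ Z, S.IsHol p Z → (∀ W, S.IsHol p W → leviForm θ p Z W = 0) → Z = 0

/-- The number `e₋` of negative eigenvalues of the Levi form of `θ` at `p`: the largest dimension
of a subspace of `T^{1,0}_p M` on which it is negative definite. -/
def CRStructure.negIndex (S : CRStructure E M n) (θ : OneForm E M ℝ) (p : M) : ℕ :=
  sSup {d | ∃ W : Submodule ℂ (CTangent (E := E) p), Module.finrank ℂ W = d ∧
    ∀ Z ∈ W, S.IsHol p Z ∧ (Z ≠ 0 → (leviForm θ p Z Z).re < 0)}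

/-- The number `e₊` of positive eigenvalues of the Levi form of `θ` at `p`. -/
def CRStructure.posIndex (S : CRStructure E M n) (θ : OneForm E M ℝ) (p : M) : ℕ :=
  sSup {d | ∃ W : Submodule ℂ (CTangent (E := E) p), Module.finrank ℂ W = d ∧
    ∀ Z ∈ W, S.IsHol p Z ∧ (Z ≠ 0 → 0 < (leviForm θ p Z Z).re)}

/-- The CR manifold has signature `l` at every point: `min(e₋, e₊) = l`. -/
def CRStructure.HasSignature (S : CRStructure E M n) (l : ℕ) : Prop :=
  ∀ (p : M) (U : Set M) (θ : OneForm E M ℝ), IsOpen U → p ∈ U → IsContactForm S U θ →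
    min (S.negIndex θ p) (S.posIndex θ p) = l

variable {ι : Type*}

/-- The covectors `(θ, θ^α)` at `p`; the index `none` stands for `θ`. -/
def coframeAt (θ : OneForm E M ℝ) (θα : ι → OneForm E M ℂ) (p : M) :
    Option ι → (TangentSpace 𝓘(ℝ, E) p →L[ℝ] ℂ)
  | none => toComplex p (θ p)
  | some α => θα α p

/-- `(θ, θ^α)` is an admissible coframe on `U`: `θ` is a contact form, the `θ^α` are smooth,
`(θ, θ^α)` is a basis of `T'_p M` at every `p ∈ U`, and `⟨θ^α, T⟩ = 0` for the characteristic
vector field `T` of `θ`. -/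
structure IsAdmissibleCoframe (S : CRStructure E M n) (U : Set M)
    (θ : OneForm E M ℝ) (θα : ι → OneForm E M ℂ) : Prop where
  contact : IsContactForm S U θ
  smooth : ∀ α, SmoothForm U (θα α)
  linearIndependent : ∀ p ∈ U, LinearIndependent ℂ (coframeAt θ θα p)
  span_eq : ∀ p ∈ U, Submodule.span ℂ (Set.range (coframeAt θ θα p)) = S.holCotangent p
  reeb : ∀ p ∈ U, ∀ T, IsReebAt θ p T → ∀ α, θα α p T = 0

/-- `(g_{αβ̄})` is the matrix of the Levi form of `θ` at `p` relative to the coframe `(θ, θ^α)`,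
that is, relative to the frame `(L_α)` of `T^{1,0}_p M` such that `(T, L_α, L_ᾱ)` is dual to
`(θ, θ^α, θ^ᾱ)`. -/
def HasLeviMatrixAt [DecidableEq ι] (θ : OneForm E M ℝ) (θα : ι → OneForm E M ℂ) (p : M)
    (g : Matrix ι ι ℂ) : Prop :=
  ∃ L : ι → CTangent (E := E) p,
    (∀ α, evalC p (toComplex p (θ p)) (L α) = 0) ∧
    (∀ α β, evalC p (θα β p) (L α) = if α = β then 1 else 0) ∧
    (∀ α β, evalC p (θα β p) (conjT p (L α)) = 0) ∧
    ∀ α β, leviForm θ p (L α) (L β) = g α β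

end CR

/-! ### Normal forms and indefinite unitary groups -/

/-- The diagonal `(-1, …, -1, 1, …, 1)` with `l` entries `-1` and `m - l` entries `1`. -/
def signs (m l : ℕ) : Fin m → ℂ := fun j ↦ if (j : ℕ) < l then -1 else 1

/-- `U(m, l)`: the complex `m × m` matrices that preserve the Hermitian form with matrix
`diag(-1, …, -1, 1, …, 1)` (`l` times `-1` and `m - l` times `1`). -/
def indefUnitary (m l : ℕ) : Set (Matrix (Fin m) (Fin m) ℂ) :=
  {u | uᴴ * Matrix.diagonal (signs m l) * u = Matrix.diagonal (signs m l)}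

/-! ### CR maps -/

section Maps

variable {E : Type*} [NormedAddCommGroup E] [NormedSpace ℝ E]
  {M : Type*} [TopologicalSpace M] [ChartedSpace E M] [IsManifold 𝓘(ℝ, E) ∞ M] {n : ℕ}
  {E' : Type*} [NormedAddCommGroup E'] [NormedSpace ℝ E']
  {M' : Type*} [TopologicalSpace M'] [ChartedSpace E' M'] [IsManifold 𝓘(ℝ, E') ∞ M'] {n' : ℕ}

/-- A smooth CR map: the differential maps the CR bundle into the CR bundle. -/
structure IsCRMap (S : CRStructure E M n) (S' : CRStructure E' M' n') (f : M → M') : Prop where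
  smooth : ContMDiff 𝓘(ℝ, E) 𝓘(ℝ, E') ∞ f
  map_mem : ∀ p, ∀ Z ∈ S.V p,
    (mfderiv 𝓘(ℝ, E) 𝓘(ℝ, E') f p).toLinearMap.baseChange ℂ Z ∈ S'.V (f p)

/-- The value at `p` of the pullback `f^* η`. -/
def pullAt {F : Type*} [NormedAddCommGroup F] [NormedSpace ℝ F] (f : M → M')
    (η : OneForm E' M' F) (p : M) : TangentSpace 𝓘(ℝ, E) p →L[ℝ] F :=
  (η (f p)).comp (mfderiv 𝓘(ℝ, E) 𝓘(ℝ, E') f p)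

/-- `f` is CR transversal at `p`: contact forms of the target near `f p` pull back to covectors
that do not vanish at `p`. -/
def CRTransversalAt (S' : CRStructure E' M' n') (f : M → M') (p : M) : Prop :=
  ∀ (U' : Set M') (θ' : OneForm E' M' ℝ), IsOpen U' → f p ∈ U' → IsContactForm S' U' θ' →
    pullAt (E := E) f θ' p ≠ 0

/-- `W` and `W'` are open, `f` maps `W` into `W'`, and `(θ', θ'^α, θ'^a)` is an admissible coframe
of the target on `W'` with `f^*(θ', θ'^α, θ'^a) = (θ, θ^α, 0)` on `W`. -/
structure PullsBackTo {m : ℕ} (S' : CRStructure E' M' n') (f : M → M') (W : Set M) (W' : Set M')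
    (θ : OneForm E M ℝ) (θα : Fin n → OneForm E M ℂ)
    (θ' : OneForm E' M' ℝ) (θ'α : Fin n → OneForm E' M' ℂ) (θ'a : Fin m → OneForm E' M' ℂ) :
    Prop where
  isOpen_source : IsOpen W
  isOpen_target : IsOpen W'
  mapsTo : Set.MapsTo f W W'
  admissible : IsAdmissibleCoframe S' W' θ' (Sum.elim θ'α θ'a)
  pull_contact : ∀ p ∈ W, pullAt f θ' p = θ p
  pull_tangential : ∀ p ∈ W, ∀ α, pullAt f (θ'α α) p = θα α p
  pull_normal : ∀ p ∈ W, ∀ a, pullAt (E := E) f (θ'a a) p = 0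

/-- The coframe `(θ', θ'^α, θ'^a)` pulls back to `(θ, θ^α, 0)` as above, and the Levi form of the
target relative to it is constant and diagonal on `W'`, with diagonal entries `-1` (`l` times),
`1` (`n - l` times), `-1` (`k - l` times) and `1` (`m - (k - l)` times). -/
structure IsAdapted {m : ℕ} (S' : CRStructure E' M' n') (f : M → M') (l k : ℕ)
    (W : Set M) (W' : Set M')
    (θ : OneForm E M ℝ) (θα : Fin n → OneForm E M ℂ)
    (θ' : OneForm E' M' ℝ) (θ'α : Fin n → OneForm E' M' ℂ) (θ'a : Fin m → OneForm E' M' ℂ) : Prop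
    extends PullsBackTo S' f W W' θ θα θ' θ'α θ'a where
  levi : ∀ q ∈ W', HasLeviMatrixAt θ' (Sum.elim θ'α θ'a) q
    (Matrix.diagonal (Sum.elim (signs n l) (signs m (k - l))))

/-- `k` is the number of negative eigenvalues of the Levi form of the target at `f p`, for the
contact forms near `f p` that pull back to `θ` at `p`. -/
def IsNegIndexAlong (S' : CRStructure E' M' n') (f : M → M') (θ : OneForm E M ℝ) (p : M) (k : ℕ) :
    Prop :=
  ∀ (U' : Set M') (θ' : OneForm E' M' ℝ), IsOpen U' → f p ∈ U' → IsContactForm S' U' θ' →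
    pullAt f θ' p = θ p → S'.negIndex θ' (f p) = k

end Maps

end CRGeom

end

/-! By transversality, contact forms of the target pull back to contact forms of the source. Since
`d` commutes with pullback (`extDAt_pullAt`), a vector killed by `df` is killed by a contact form
and by its differential, and is zero because `dθ` is nondegenerate on `ker θ`
(`IsContactForm.eq_zero_of_extD`). So the map is an immersion (`IsCRMap.injective_dAt`), which gives
the inequality of dimensions and a local smooth left inverse, by means of which functions on the
source extend to the target.

The decisive point is the choice of the contact form (`IsCRMap.exists_adapted_contact`). Any contact
form of the target can be multiplied by an extended function so that it pulls back to `θ`. There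
remains a factor `u` equal to `1` along the image. If `ζ` is the form and `b` the image of the
characteristic vector of `θ`, then `d(uζ)(b, ·) = du(b) ζ - du + dζ(b, ·)` along the image, so `b`
becomes characteristic as soon as `du = dζ(b, ·)` there. This is compatible with `u = 1` on the
image exactly because `dζ(b, ·)` vanishes on tangential vectors, where it restricts to `dθ(T, ·) =
0` (`exists_rescaling`).

The remaining forms of any admissible coframe for this contact form kill `b`. Their pullbacks
therefore have no `θ` component and are combinations of the `θ^α` with an injective coefficient
matrix (`IsCRMap.exists_pullback_matrix`). Completing this matrix to an invertible one and inverting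
it gives a coframe that pulls back to `(θ, θ^α, 0)` (`IsCRMap.exists_pullsBackTo`). Conversely, for
every such coframe the difference between the target's characteristic vector and `df(T)` is killed
by the whole coframe, hence zero (`PullsBackTo.isReebAt`).

Along the image the tangential block of the Levi matrix of such a coframe is the Levi matrix of the
source (`PullsBackTo.toBlocks₁₁_eq`). Block elimination and a smooth matrix square root bring the
Levi matrix to diagonal form without touching the tangential frame vectors where their block is
already normalized (`exists_normal_form`), so the pullback conditions survive
(`IsCRMap.exists_isAdapted`). Counting signs, by `sSup_finrank_negative`, identifies `k` and gives
the inequalities. For uniqueness, the transition matrix is block triangular because normal forms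
pull back to zero, and it preserves a block diagonal nondegenerate Hermitian form, so it is block
diagonal (`blocks_of_isometry`). -/

set_option linter.unusedSectionVars false

noncomputable section

namespace CRGeom

open Filter Topology

/-! ### Forms, vector fields and the exterior derivative in charts. -/

section Coordinates

variable {E : Type*} [NormedAddCommGroup E] [NormedSpace ℝ E]
  {M : Type*} [TopologicalSpace M] [ChartedSpace E M]
  {F : Type*} [NormedAddCommGroup F] [NormedSpace ℝ F]
  {E' : Type*} [NormedAddCommGroup E'] [NormedSpace ℝ E']
  {M' : Type*} [TopologicalSpace M'] [ChartedSpace E' M']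
  {E₂ : Type*} [NormedAddCommGroup E₂] [NormedSpace ℝ E₂]
  {M₂ : Type*} [TopologicalSpace M₂] [ChartedSpace E₂ M₂]

/-- The value of a one-form, as a linear map on the model space. -/
def covAt (η : OneForm E M F) (q : M) : E →L[ℝ] F := η q

/-- The differential of a map, as a linear map between the model spaces. -/
def dAt (E E' : Type*) [NormedAddCommGroup E] [NormedSpace ℝ E]
    [NormedAddCommGroup E'] [NormedSpace ℝ E']
    {M : Type*} [TopologicalSpace M] [ChartedSpace E M]
    {M' : Type*} [TopologicalSpace M'] [ChartedSpace E' M'] (f : M → M') (q : M) : E →L[ℝ] E' :=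
  mfderiv 𝓘(ℝ, E) 𝓘(ℝ, E') f q

theorem dAt_comp {g : M' → M₂} {f : M → M'} {q : M}
    (hg : MDifferentiableAt 𝓘(ℝ, E') 𝓘(ℝ, E₂) g (f q)) (hf : MDifferentiableAt 𝓘(ℝ, E) 𝓘(ℝ, E') f q) :
    dAt E E₂ (g ∘ f) q = (dAt E' E₂ g (f q)).comp (dAt E E' f q) :=
  mfderiv_comp q hg hf

theorem dAt_eq_fderiv (f : E → E') (x : E) : dAt E E' f x = fderiv ℝ f x :=
  mfderiv_eq_fderiv

theorem dAt_congr {f g : M → M'} {q : M} (h : f =ᶠ[𝓝 q] g) : dAt E E' f q = dAt E E' g q :=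
  h.mfderiv_eq

theorem dAt_id (q : M) : dAt E E (id : M → M) q = ContinuousLinearMap.id ℝ E :=
  mfderiv_id

theorem chartRep_eq (η : OneForm E M F) (p : M) (y : E) :
    chartRep η p y = (covAt η ((extChartAt 𝓘(ℝ, E) p).symm y)).comp
      (dAt E E (extChartAt 𝓘(ℝ, E) p).symm y) := rfl

theorem covAt_pullAt (f : M → M') (η : OneForm E' M' F) (p : M) :
    covAt (E := E) (pullAt f η) p = (covAt η (f p)).comp (dAt E E' f p) := rfl

/-- The exterior derivative at a point, as a bilinear form on the model space. -/
def extDAt (η : OneForm E M F) (p : M) : E →L[ℝ] E →L[ℝ] F := extD η p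

theorem extDAt_apply (η : OneForm E M F) (p : M) (v w : E) :
    extDAt η p v w = fderiv ℝ (chartRep η p) (extChartAt 𝓘(ℝ, E) p p) v w
      - fderiv ℝ (chartRep η p) (extChartAt 𝓘(ℝ, E) p p) w v := rfl

theorem extDAt_swap (η : OneForm E M F) (p : M) (v w : E) :
    extDAt η p v w = - extDAt η p w v := by
  rw [extDAt_apply, extDAt_apply]; abel

theorem extD_swap (η : OneForm E M F) (p : M) (v w : TangentSpace 𝓘(ℝ, E) p) :
    extD η p v w = - extD η p w v := extDAt_swap η p v w

/-- Smoothness at a point of a one-form. -/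
def SmoothFormAt [IsManifold 𝓘(ℝ, E) ∞ M] (η : OneForm E M F) (p : M) : Prop :=
  ContMDiffAt 𝓘(ℝ, E) (𝓘(ℝ, E).prod 𝓘(ℝ, E →L[ℝ] F)) ∞
    (fun p ↦ Bundle.TotalSpace.mk' (E →L[ℝ] F)
      (E := fun q : M ↦ TangentSpace 𝓘(ℝ, E) q →L[ℝ] F) p (η p)) p

theorem smoothForm_iff [IsManifold 𝓘(ℝ, E) ∞ M] {η : OneForm E M F} {U : Set M} (hU : IsOpen U) :
    SmoothForm U η ↔ ∀ p ∈ U, SmoothFormAt η p :=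
  ⟨fun h p hp ↦ (h p hp).contMDiffAt (hU.mem_nhds hp),
    fun h p hp ↦ (h p hp).contMDiffWithinAt⟩

section
variable [IsManifold 𝓘(ℝ, E) ∞ M]

theorem mem_extChartAt_source' {p₀ p : M} (hp : p ∈ (chartAt E p₀).source) :
    p ∈ (extChartAt 𝓘(ℝ, E) p₀).source := by simpa using hp

theorem extChartAt_target_mem_nhds_of_mem {p₀ p : M} (hp : p ∈ (chartAt E p₀).source) :
    (extChartAt 𝓘(ℝ, E) p₀).target ∈ 𝓝 (extChartAt 𝓘(ℝ, E) p₀ p) :=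
  extChartAt_target_mem_nhds' ((extChartAt 𝓘(ℝ, E) p₀).map_source (mem_extChartAt_source' hp))

theorem contMDiffAt_extChartAt_symm {p₀ : M} {y : E} (hy : y ∈ (extChartAt 𝓘(ℝ, E) p₀).target) :
    ContMDiffAt 𝓘(ℝ, E) 𝓘(ℝ, E) ∞ (extChartAt 𝓘(ℝ, E) p₀).symm y :=
  (contMDiffOn_extChartAt_symm (I := 𝓘(ℝ, E)) p₀).contMDiffAt (extChartAt_target_mem_nhds' hy)

theorem dAt_symm_comp_dAt {p₀ p : M} (hp : p ∈ (chartAt E p₀).source) :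
    (dAt E E (extChartAt 𝓘(ℝ, E) p₀).symm (extChartAt 𝓘(ℝ, E) p₀ p)).comp
      (dAt E E (extChartAt 𝓘(ℝ, E) p₀) p) = ContinuousLinearMap.id ℝ E := by
  have hp' := mem_extChartAt_source' hp
  rw [← dAt_comp, ← dAt_id p]
  · refine dAt_congr ?_
    filter_upwards [(chartAt E p₀).open_source.mem_nhds hp] with q hq
    exact (extChartAt 𝓘(ℝ, E) p₀).left_inv (mem_extChartAt_source' hq)
  · exact (contMDiffAt_extChartAt_symm ((extChartAt 𝓘(ℝ, E) p₀).map_source hp')).mdifferentiableAt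
      (by norm_num)
  · exact (contMDiffAt_extChartAt' (n := ∞) hp).mdifferentiableAt (by norm_num)

theorem dAt_comp_dAt_symm {p₀ : M} {y : E} (hy : y ∈ (extChartAt 𝓘(ℝ, E) p₀).target) :
    (dAt E E (extChartAt 𝓘(ℝ, E) p₀) ((extChartAt 𝓘(ℝ, E) p₀).symm y)).comp
      (dAt E E (extChartAt 𝓘(ℝ, E) p₀).symm y) = ContinuousLinearMap.id ℝ E := by
  rw [← dAt_comp, ← dAt_id y]
  · refine dAt_congr ?_
    filter_upwards [extChartAt_target_mem_nhds' hy] with z hz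
    exact (extChartAt 𝓘(ℝ, E) p₀).right_inv hz
  · refine (contMDiffAt_extChartAt' (n := ∞) ?_).mdifferentiableAt (by norm_num)
    simpa using (extChartAt 𝓘(ℝ, E) p₀).map_target hy
  · exact (contMDiffAt_extChartAt_symm hy).mdifferentiableAt (by norm_num)

theorem contMDiffAt_comp_extChartAt_iff {g : E → F} {p₀ p : M}
    (hp : p ∈ (chartAt E p₀).source) :
    ContMDiffAt 𝓘(ℝ, E) 𝓘(ℝ, F) ∞ (fun q ↦ g (extChartAt 𝓘(ℝ, E) p₀ q)) p ↔
      ContDiffAt ℝ ∞ g (extChartAt 𝓘(ℝ, E) p₀ p) := by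
  have hp' := mem_extChartAt_source' hp
  constructor
  · intro h
    have h' := h.comp_of_eq (x := extChartAt 𝓘(ℝ, E) p₀ p)
      (contMDiffAt_extChartAt_symm ((extChartAt 𝓘(ℝ, E) p₀).map_source hp'))
      ((extChartAt 𝓘(ℝ, E) p₀).left_inv hp')
    rw [← contMDiffAt_iff_contDiffAt]
    refine h'.congr_of_eventuallyEq ?_
    filter_upwards [extChartAt_target_mem_nhds_of_mem hp] with y hy
    exact (congrArg g ((extChartAt 𝓘(ℝ, E) p₀).right_inv hy)).symm
  · intro h
    exact h.contMDiffAt.comp p (contMDiffAt_extChartAt' hp)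

theorem contMDiffAt_iff_comp_symm {g : M → F} {p₀ p : M}
    (hp : p ∈ (chartAt E p₀).source) :
    ContMDiffAt 𝓘(ℝ, E) 𝓘(ℝ, F) ∞ g p ↔
      ContDiffAt ℝ ∞ (fun y ↦ g ((extChartAt 𝓘(ℝ, E) p₀).symm y)) (extChartAt 𝓘(ℝ, E) p₀ p) := by
  rw [← contMDiffAt_comp_extChartAt_iff hp]
  refine Filter.EventuallyEq.contMDiffAt_iff ?_
  filter_upwards [(chartAt E p₀).open_source.mem_nhds hp] with q hq
  rw [(extChartAt 𝓘(ℝ, E) p₀).left_inv (mem_extChartAt_source' hq)]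

/-- The trivialization of the bundle of covectors centred at `p₀` composes with the differential of
the inverse chart, which is what `chartRep` does. The point `p` may be anywhere in the chart domain,
so a single chart serves for a whole neighborhood. -/
theorem smoothFormAt_iff {η : OneForm E M F} {p₀ p : M}
    (hp : p ∈ (chartAt E p₀).source) :
    SmoothFormAt η p ↔ ContDiffAt ℝ ∞ (chartRep η p₀) (extChartAt 𝓘(ℝ, E) p₀ p) := by
  rw [← contMDiffAt_comp_extChartAt_iff hp, SmoothFormAt,
    Bundle.Trivialization.contMDiffAt_section_iff
      (trivializationAt (E →L[ℝ] F) (fun q : M ↦ TangentSpace 𝓘(ℝ, E) q →L[ℝ] F) p₀)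
      (by simpa [hom_trivializationAt_baseSet] using hp)]
  refine Filter.EventuallyEq.contMDiffAt_iff ?_
  filter_upwards [(chartAt E p₀).open_source.mem_nhds hp] with q hq
  rw [hom_trivializationAt_apply, chartRep_eq,
    (extChartAt 𝓘(ℝ, E) p₀).left_inv (mem_extChartAt_source' hq)]
  have h1 := TangentBundle.symmL_trivializationAt (I := 𝓘(ℝ, E)) hq
  rw [ModelWithCorners.range_eq_univ, mfderivWithin_univ] at h1
  have h2 : ∀ v : E, (trivializationAt E (TangentSpace 𝓘(ℝ, E)) p₀).symmL ℝ q v =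
      dAt E E (extChartAt 𝓘(ℝ, E) p₀).symm (extChartAt 𝓘(ℝ, E) p₀ q) v :=
    fun v ↦ DFunLike.congr_fun h1 v
  ext v
  rw [ContinuousLinearMap.comp_apply, ← h2]
  simp only [ContinuousLinearMap.inCoordinates]
  rw [ContinuousLinearMap.comp_apply, ContinuousLinearMap.comp_apply]
  simp
  rfl

variable [IsManifold 𝓘(ℝ, E') ∞ M']

/-- The target chart followed by its inverse can be inserted between `η` and `df` where `f` stays in
the domain of the chart at `f p`; hence an equality only near the base point. -/
theorem chartRep_pullAt_eventuallyEq
    {f : M → M'} {p : M} (hf : ContMDiffAt 𝓘(ℝ, E) 𝓘(ℝ, E') ∞ f p) (η : OneForm E' M' F) :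
    chartRep (pullAt (E := E) f η) p =ᶠ[𝓝 (extChartAt 𝓘(ℝ, E) p p)]
      fun y ↦ (chartRep η (f p) (writtenInExtChartAt 𝓘(ℝ, E) 𝓘(ℝ, E') p f y)).comp
        (fderiv ℝ (writtenInExtChartAt 𝓘(ℝ, E) 𝓘(ℝ, E') p f) y) := by
  have : IsManifold 𝓘(ℝ, E) 1 M := .of_le (n := ∞) (by norm_cast)
  have : IsManifold 𝓘(ℝ, E') 1 M' := .of_le (n := ∞) (by norm_cast)
  have hf1 : ∀ᶠ q in 𝓝 p, ContMDiffAt 𝓘(ℝ, E) 𝓘(ℝ, E') 1 f q :=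
    (contMDiffAt_iff_contMDiffAt_nhds (by norm_num)).1 (hf.of_le (by norm_cast))
  have hs : ∀ᶠ q in 𝓝 p, f q ∈ (chartAt E' (f p)).source :=
    hf.continuousAt.eventually ((chartAt E' (f p)).open_source.mem_nhds (mem_chart_source E' (f p)))
  have hψ : Tendsto (extChartAt 𝓘(ℝ, E) p).symm (𝓝 (extChartAt 𝓘(ℝ, E) p p)) (𝓝 p) := by
    have := continuousAt_extChartAt_symm (I := 𝓘(ℝ, E)) p
    rwa [ContinuousAt, extChartAt_to_inv] at this
  filter_upwards [hψ.eventually hf1, hψ.eventually hs, extChartAt_target_mem_nhds (I := 𝓘(ℝ, E)) p]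
    with y hy1 hy2 hy3
  set q := (extChartAt 𝓘(ℝ, E) p).symm y with hq
  have d1 : MDifferentiableAt 𝓘(ℝ, E) 𝓘(ℝ, E) (extChartAt 𝓘(ℝ, E) p).symm y :=
    (contMDiffAt_extChartAt_symm hy3).mdifferentiableAt (by norm_num)
  have d2 : MDifferentiableAt 𝓘(ℝ, E) 𝓘(ℝ, E') f q := hy1.mdifferentiableAt (by norm_num)
  have d3 : MDifferentiableAt 𝓘(ℝ, E') 𝓘(ℝ, E') (extChartAt 𝓘(ℝ, E') (f p)) (f q) :=
    mdifferentiableAt_extChartAt hy2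
  have c1 : fderiv ℝ (writtenInExtChartAt 𝓘(ℝ, E) 𝓘(ℝ, E') p f) y =
      (dAt E' E' (extChartAt 𝓘(ℝ, E') (f p)) (f q)).comp ((dAt E E' f q).comp
        (dAt E E (extChartAt 𝓘(ℝ, E) p).symm y)) := by
    rw [← dAt_eq_fderiv]
    exact (dAt_comp (f := f ∘ (extChartAt 𝓘(ℝ, E) p).symm) d3 (d2.comp y d1)).trans
      (congrArg _ (dAt_comp (q := y) d2 d1))
  have hw : writtenInExtChartAt 𝓘(ℝ, E) 𝓘(ℝ, E') p f y = extChartAt 𝓘(ℝ, E') (f p) (f q) := rfl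
  rw [c1, chartRep_eq, covAt_pullAt, hw, chartRep_eq, ← hq,
    (extChartAt 𝓘(ℝ, E') (f p)).left_inv (mem_extChartAt_source' hy2)]
  have c2 := dAt_symm_comp_dAt hy2
  ext v
  simpa using congrArg (covAt η (f q)) (DFunLike.congr_fun c2 _).symm

theorem contDiffAt_writtenInExtChartAt
    {f : M → M'} {p : M} (hf : ContMDiffAt 𝓘(ℝ, E) 𝓘(ℝ, E') ∞ f p) :
    ContDiffAt ℝ ∞ (writtenInExtChartAt 𝓘(ℝ, E) 𝓘(ℝ, E') p f) (extChartAt 𝓘(ℝ, E) p p) := by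
  have := (contMDiffAt_iff.1 hf).2
  rwa [ModelWithCorners.range_eq_univ, contDiffWithinAt_univ] at this

theorem writtenInExtChartAt_self (f : M → M') (p : M) :
    writtenInExtChartAt 𝓘(ℝ, E) 𝓘(ℝ, E') p f (extChartAt 𝓘(ℝ, E) p p) =
      extChartAt 𝓘(ℝ, E') (f p) (f p) := by
  simp [writtenInExtChartAt]

theorem SmoothFormAt.pullAt
    {f : M → M'} {p : M} (hf : ContMDiffAt 𝓘(ℝ, E) 𝓘(ℝ, E') ∞ f p) {η : OneForm E' M' F}
    (hη : SmoothFormAt η (f p)) : SmoothFormAt (E := E) (pullAt f η) p := by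
  rw [smoothFormAt_iff (mem_chart_source E p)]
  refine ContDiffAt.congr_of_eventuallyEq ?_ (chartRep_pullAt_eventuallyEq hf η)
  rw [smoothFormAt_iff (mem_chart_source E' (f p)), ← writtenInExtChartAt_self (E := E)] at hη
  have hF := contDiffAt_writtenInExtChartAt hf
  exact ContDiffAt.clm_comp (hη.comp (extChartAt 𝓘(ℝ, E) p p) hF)
    (hF.fderiv_right (m := ∞) le_rfl)

theorem dAt_eq_fderiv_writtenInExtChartAt
    {f : M → M'} {p : M} (hf : MDifferentiableAt 𝓘(ℝ, E) 𝓘(ℝ, E') f p) :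
    dAt E E' f p = fderiv ℝ (writtenInExtChartAt 𝓘(ℝ, E) 𝓘(ℝ, E') p f)
      (extChartAt 𝓘(ℝ, E) p p) := by
  rw [dAt, hf.mfderiv, ModelWithCorners.range_eq_univ, fderivWithin_univ]

/-- In charts the product rule produces one term with the derivative of `η` and one with the second
derivative of the map; the latter is symmetric and disappears on antisymmetrizing. Applied to
inverse charts this also shows that the exterior derivative, defined through the preferred chart at
each point, is independent of the chart. -/
theorem extDAt_pullAt
    {f : M → M'} {p : M} (hf : ContMDiffAt 𝓘(ℝ, E) 𝓘(ℝ, E') ∞ f p) {η : OneForm E' M' F}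
    (hη : SmoothFormAt η (f p)) (v w : E) :
    extDAt (E := E) (pullAt f η) p v w =
      extDAt η (f p) (dAt E E' f p v) (dAt E E' f p w) := by
  have hF := contDiffAt_writtenInExtChartAt hf
  rw [smoothFormAt_iff (mem_chart_source E' (f p)), ← writtenInExtChartAt_self (E := E)] at hη
  rw [extDAt_apply, extDAt_apply, dAt_eq_fderiv_writtenInExtChartAt (hf.mdifferentiableAt (by norm_num)),
    (chartRep_pullAt_eventuallyEq hf η).fderiv_eq, ← writtenInExtChartAt_self (E := E)]
  set x := extChartAt 𝓘(ℝ, E) p p with hx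
  set G := writtenInExtChartAt 𝓘(ℝ, E) 𝓘(ℝ, E') p f with hG
  have hη' : DifferentiableAt ℝ (chartRep η (f p)) (G x) := hη.differentiableAt (by norm_num)
  have dG : DifferentiableAt ℝ G x := hF.differentiableAt (by norm_num)
  have dG2 : DifferentiableAt ℝ (fderiv ℝ G) x :=
    (hF.fderiv_right (m := ∞) le_rfl).differentiableAt (by norm_num)
  have e2 := ((hη'.hasFDerivAt.comp x dG.hasFDerivAt).clm_comp dG2.hasFDerivAt).fderiv
  have sym := (hF.isSymmSndFDerivAt (by simp only [minSmoothness_of_isRCLikeNormedField]; exact ENat.LEInfty.out)).eq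
  simp only [Function.comp_apply] at e2
  rw [e2]
  simp [sym v w]

theorem chartRep_model (η : OneForm E E F) (p : E) : chartRep η p = fun y ↦ covAt η y := by
  funext y
  rw [chartRep_eq]
  rw [extChartAt_model_space_eq_id]
  change (covAt η y).comp (dAt E E id y) = _
  rw [dAt_id, ContinuousLinearMap.comp_id]

theorem chartRep_apply_model (η : OneForm E E F) (p : E) : chartRep η p = covAt η :=
  chartRep_model η p

theorem smoothFormAt_model_iff {η : OneForm E E F} {p : E} :
    SmoothFormAt η p ↔ ContDiffAt ℝ ∞ (covAt η) p := by
  rw [smoothFormAt_iff (mem_chart_source E p), chartRep_apply_model, extChartAt_model_space_eq_id]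
  rfl

theorem extDAt_model (η : OneForm E E F) (p v w : E) :
    extDAt η p v w = fderiv ℝ (covAt η) p v w - fderiv ℝ (covAt η) p w v := by
  rw [extDAt_apply, chartRep_apply_model, extChartAt_model_space_eq_id]
  rfl

/-- The exterior derivative may be computed in any chart. -/
theorem extDAt_chart {η : OneForm E M F} {p₀ : M} {y : E}
    (hy : y ∈ (extChartAt 𝓘(ℝ, E) p₀).target)
    (hη : SmoothFormAt η ((extChartAt 𝓘(ℝ, E) p₀).symm y)) (v w : E) :
    extDAt η ((extChartAt 𝓘(ℝ, E) p₀).symm y) (dAt E E (extChartAt 𝓘(ℝ, E) p₀).symm y v)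
      (dAt E E (extChartAt 𝓘(ℝ, E) p₀).symm y w) =
      fderiv ℝ (chartRep η p₀) y v w - fderiv ℝ (chartRep η p₀) y w v := by
  rw [← extDAt_pullAt (contMDiffAt_extChartAt_symm hy) hη, extDAt_model]
  rfl

/-- A vector field in the chart at `p₀`. -/
def fieldRep (X : ∀ p : M, TangentSpace 𝓘(ℝ, E) p) (p₀ : M) (y : E) : E :=
  dAt E E (extChartAt 𝓘(ℝ, E) p₀) ((extChartAt 𝓘(ℝ, E) p₀).symm y)
    (X ((extChartAt 𝓘(ℝ, E) p₀).symm y))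

theorem dAt_symm_fieldRep (X : ∀ p : M, TangentSpace 𝓘(ℝ, E) p) {p₀ p : M}
    (hp : p ∈ (chartAt E p₀).source) :
    dAt E E (extChartAt 𝓘(ℝ, E) p₀).symm (extChartAt 𝓘(ℝ, E) p₀ p)
      (fieldRep X p₀ (extChartAt 𝓘(ℝ, E) p₀ p)) = X p := by
  have h := dAt_symm_comp_dAt hp
  rw [fieldRep, (extChartAt 𝓘(ℝ, E) p₀).left_inv (mem_extChartAt_source' hp)]
  exact DFunLike.congr_fun h _

/-- Smoothness at a point of a vector field. -/
def SmoothFieldAt (X : ∀ p : M, TangentSpace 𝓘(ℝ, E) p) (p : M) : Prop :=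
  ContMDiffAt 𝓘(ℝ, E) 𝓘(ℝ, E).tangent ∞
    (fun p ↦ (Bundle.TotalSpace.mk' E p (X p) : TangentBundle 𝓘(ℝ, E) M)) p

theorem smoothField_iff {X : ∀ p : M, TangentSpace 𝓘(ℝ, E) p} {U : Set M} (hU : IsOpen U) :
    SmoothField U X ↔ ∀ p ∈ U, SmoothFieldAt X p :=
  ⟨fun h p hp ↦ (h p hp).contMDiffAt (hU.mem_nhds hp),
    fun h p hp ↦ (h p hp).contMDiffWithinAt⟩

theorem smoothFieldAt_iff {X : ∀ p : M, TangentSpace 𝓘(ℝ, E) p} {p₀ p : M}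
    (hp : p ∈ (chartAt E p₀).source) :
    SmoothFieldAt X p ↔ ContDiffAt ℝ ∞ (fieldRep X p₀) (extChartAt 𝓘(ℝ, E) p₀ p) := by
  have : IsManifold 𝓘(ℝ, E) 1 M := .of_le (n := ∞) (by norm_cast)
  rw [← contMDiffAt_comp_extChartAt_iff hp, SmoothFieldAt]
  refine (Bundle.Trivialization.contMDiffAt_section_iff
      (trivializationAt E (TangentSpace 𝓘(ℝ, E)) p₀) (by simpa using hp)).trans ?_
  refine Filter.EventuallyEq.contMDiffAt_iff ?_
  filter_upwards [(chartAt E p₀).open_source.mem_nhds hp] with q hq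
  rw [fieldRep, (extChartAt 𝓘(ℝ, E) p₀).left_inv (mem_extChartAt_source' hq)]
  have h1 := TangentBundle.continuousLinearMapAt_trivializationAt (I := 𝓘(ℝ, E)) hq
  refine Eq.trans ?_ (DFunLike.congr_fun h1 (X q))
  rw [Bundle.Trivialization.continuousLinearMapAt_apply, Bundle.Trivialization.linearMapAt_apply]
  rw [if_pos (by simpa using hq)]

theorem contMDiffAt_covAt_apply {η : OneForm E M F} {X : ∀ p : M, TangentSpace 𝓘(ℝ, E) p} {p : M}
    (hη : SmoothFormAt η p) (hX : SmoothFieldAt X p) :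
    ContMDiffAt 𝓘(ℝ, E) 𝓘(ℝ, F) ∞ (fun q ↦ η q (X q)) p := by
  have hp := mem_chart_source E p
  rw [smoothFormAt_iff hp] at hη
  rw [smoothFieldAt_iff hp] at hX
  have := (contMDiffAt_comp_extChartAt_iff hp).2 (hη.clm_apply hX)
  refine this.congr_of_eventuallyEq ?_
  filter_upwards [(chartAt E p).open_source.mem_nhds hp] with q hq
  rw [chartRep_eq, ContinuousLinearMap.comp_apply, dAt_symm_fieldRep X hq,
    (extChartAt 𝓘(ℝ, E) p).left_inv (mem_extChartAt_source' hq)]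
  rfl

/-- The contraction `v ↦ dη(v, X)`. -/
def contrD (η : OneForm E M F) (X : ∀ p : M, TangentSpace 𝓘(ℝ, E) p) : OneForm E M F :=
  fun q ↦ (extDAt η q).flip (show E from X q)

/-- The exterior derivative at each nearby point refers to a different preferred chart;
`extDAt_chart` transfers all of them to the chart at `p`. This needs smoothness of `η` in a
neighborhood, not only at `p`. -/
theorem smoothFormAt_contrD {η : OneForm E M F} {X : ∀ p : M, TangentSpace 𝓘(ℝ, E) p} {p : M}
    (hη : ∀ᶠ q in 𝓝 p, SmoothFormAt η q) (hX : SmoothFieldAt X p) :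
    SmoothFormAt (contrD η X) p := by
  have hp := mem_chart_source E p
  have hη' := hη.self_of_nhds
  rw [smoothFormAt_iff hp] at hη' ⊢
  rw [smoothFieldAt_iff hp] at hX
  have hD := hη'.fderiv_right (m := ∞) le_rfl
  have h1 : ContDiffAt ℝ ∞ (fun y ↦ (fderiv ℝ (chartRep η p) y - (fderiv ℝ (chartRep η p) y).flip).flip
      (fieldRep X p y)) (extChartAt 𝓘(ℝ, E) p p) := by
    have hfl : ∀ {g : E → E →L[ℝ] E →L[ℝ] F} {x : E}, ContDiffAt ℝ ∞ g x →
        ContDiffAt ℝ ∞ (fun y ↦ (g y).flip) x := fun h ↦ by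
      have hL : IsBoundedLinearMap ℝ (fun B : E →L[ℝ] E →L[ℝ] F ↦ B.flip) :=
        ⟨⟨fun _ _ ↦ rfl, fun _ _ ↦ rfl⟩, 1, one_pos, fun B ↦ by simp⟩
      have hL' : ContDiff ℝ ∞ (fun B : E →L[ℝ] E →L[ℝ] F ↦ B.flip) := hL.contDiff
      exact hL'.contDiffAt.comp _ h
    exact (hfl (hD.sub (hfl hD))).clm_apply hX
  refine h1.congr_of_eventuallyEq ?_
  have hψ : Tendsto (extChartAt 𝓘(ℝ, E) p).symm (𝓝 (extChartAt 𝓘(ℝ, E) p p)) (𝓝 p) := by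
    have := continuousAt_extChartAt_symm (I := 𝓘(ℝ, E)) p
    rwa [ContinuousAt, extChartAt_to_inv] at this
  filter_upwards [hψ.eventually hη, extChartAt_target_mem_nhds (I := 𝓘(ℝ, E)) p] with y hy1 hy2
  ext v
  have hq : (extChartAt 𝓘(ℝ, E) p).symm y ∈ (chartAt E p).source := by
    simpa using (extChartAt 𝓘(ℝ, E) p).map_target hy2
  have h2 := dAt_symm_fieldRep X hq
  rw [(extChartAt 𝓘(ℝ, E) p).right_inv hy2] at h2
  have h3 := extDAt_chart hy2 hy1 v (fieldRep X p y)
  rw [h2] at h3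
  rw [chartRep_eq]
  simpa using! h3

end
end Coordinates

/-! ### Lie brackets and Cartan's formula. -/

section Cartan

variable {E : Type*} [NormedAddCommGroup E] [NormedSpace ℝ E]
  {M : Type*} [TopologicalSpace M] [ChartedSpace E M] [IsManifold 𝓘(ℝ, E) ∞ M]
  {F : Type*} [NormedAddCommGroup F] [NormedSpace ℝ F]

theorem dAt_extChartAt_self (p : M) :
    dAt E E (extChartAt 𝓘(ℝ, E) p) p = ContinuousLinearMap.id ℝ E := by
  have : IsManifold 𝓘(ℝ, E) 1 M := .of_le (n := ∞) (by norm_cast)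
  exact mfderiv_extChartAt_self

theorem dAt_extChartAt_symm_self (p : M) :
    dAt E E (extChartAt 𝓘(ℝ, E) p).symm (extChartAt 𝓘(ℝ, E) p p) = ContinuousLinearMap.id ℝ E := by
  have h := dAt_symm_comp_dAt (mem_chart_source E p)
  rwa [dAt_extChartAt_self, ContinuousLinearMap.comp_id] at h

theorem fieldRep_self (X : ∀ p : M, TangentSpace 𝓘(ℝ, E) p) (p : M) :
    fieldRep X p (extChartAt 𝓘(ℝ, E) p p) = X p := by
  have h := dAt_symm_fieldRep X (mem_chart_source E p)
  rw [dAt_extChartAt_symm_self] at h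
  exact h

theorem chartRep_self (η : OneForm E M F) (p : M) :
    chartRep η p (extChartAt 𝓘(ℝ, E) p p) = covAt η p := by
  rw [chartRep_eq, dAt_extChartAt_symm_self, extChartAt_to_inv, ContinuousLinearMap.comp_id]

/-- The fields pulled back to the model space agree near the base point with `fieldRep`, and the
differential of the preferred chart at its own centre is the identity, so nothing is left to
transport. -/
theorem mlieBracket_eq_fieldRep (X Y : ∀ p : M, TangentSpace 𝓘(ℝ, E) p) (p : M) :
    VectorField.mlieBracket 𝓘(ℝ, E) X Y p =
      (VectorField.lieBracket ℝ (fieldRep X p) (fieldRep Y p) (extChartAt 𝓘(ℝ, E) p p) : E) := by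
  have : IsManifold 𝓘(ℝ, E) 1 M := .of_le (n := ∞) (by norm_cast)
  have key : ∀ X : ∀ p : M, TangentSpace 𝓘(ℝ, E) p,
      (VectorField.mpullbackWithin 𝓘(ℝ, E) 𝓘(ℝ, E) (extChartAt 𝓘(ℝ, E) p).symm X
        (Set.range 𝓘(ℝ, E)) : E → E) =ᶠ[𝓝 (extChartAt 𝓘(ℝ, E) p p)] fieldRep X p := by
    intro X
    filter_upwards [extChartAt_target_mem_nhds (I := 𝓘(ℝ, E)) p] with y hy
    have hq : (extChartAt 𝓘(ℝ, E) p).symm y ∈ (chartAt E p).source := by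
      simpa using (extChartAt 𝓘(ℝ, E) p).map_target hy
    have h1 := dAt_comp_dAt_symm hy
    have h2 := dAt_symm_comp_dAt hq
    rw [(extChartAt 𝓘(ℝ, E) p).right_inv hy] at h2
    have h3 : (dAt E E (extChartAt 𝓘(ℝ, E) p).symm y).inverse = _ :=
      ContinuousLinearMap.inverse_eq h2 h1
    rw [ModelWithCorners.range_eq_univ, VectorField.mpullbackWithin_univ]
    exact DFunLike.congr_fun h3 _
  rw [← VectorField.mlieBracketWithin_univ, VectorField.mlieBracketWithin_apply]
  have h4 : (mfderiv 𝓘(ℝ, E) 𝓘(ℝ, E) (extChartAt 𝓘(ℝ, E) p) p).inverse = ContinuousLinearMap.id ℝ E := by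
    have h : (dAt E E (extChartAt 𝓘(ℝ, E) p) p).inverse = ContinuousLinearMap.id ℝ E := by
      rw [dAt_extChartAt_self, ContinuousLinearMap.inverse_id]
    exact h
  have k1 := key X
  have k2 := key Y
  have k3 : VectorField.lieBracketWithin ℝ
      (VectorField.mpullbackWithin 𝓘(ℝ, E) 𝓘(ℝ, E) (extChartAt 𝓘(ℝ, E) p).symm X
        (Set.range 𝓘(ℝ, E)) : E → E)
      (VectorField.mpullbackWithin 𝓘(ℝ, E) 𝓘(ℝ, E) (extChartAt 𝓘(ℝ, E) p).symm Y
        (Set.range 𝓘(ℝ, E)) : E → E)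
      ((extChartAt 𝓘(ℝ, E) p).symm ⁻¹' Set.univ ∩ Set.range 𝓘(ℝ, E)) (extChartAt 𝓘(ℝ, E) p p) =
      VectorField.lieBracket ℝ (fieldRep X p) (fieldRep Y p) (extChartAt 𝓘(ℝ, E) p p) := by
    rw [k1.lieBracketWithin_vectorField_eq_nhds k2, ModelWithCorners.range_eq_univ,
      Set.preimage_univ, Set.univ_inter, VectorField.lieBracketWithin_univ]
  exact (DFunLike.congr_fun h4 _).trans k3

/-- Cartan's formula for fields annihilated by the form. -/
theorem extD_eq_neg_mlieBracket {θ : OneForm E M F} {X Y : ∀ p : M, TangentSpace 𝓘(ℝ, E) p} {p : M}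
    (hθ : SmoothFormAt θ p) (hX : SmoothFieldAt X p) (hY : SmoothFieldAt Y p)
    (hθX : ∀ᶠ q in 𝓝 p, θ q (X q) = 0) (hθY : ∀ᶠ q in 𝓝 p, θ q (Y q) = 0) :
    extD θ p (X p) (Y p) = - θ p (VectorField.mlieBracket 𝓘(ℝ, E) X Y p) := by
  have hp := mem_chart_source E p
  rw [smoothFormAt_iff hp] at hθ
  set x := extChartAt 𝓘(ℝ, E) p p with hx
  -- Differentiating `θ(Z) = 0` in the chart moves the derivative from the form to the field;
  -- antisymmetrizing then leaves minus `θ` of the bracket.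
  have key : ∀ Z : (∀ p : M, TangentSpace 𝓘(ℝ, E) p), SmoothFieldAt Z p →
      (∀ᶠ q in 𝓝 p, θ q (Z q) = 0) → ∀ v : E,
      fderiv ℝ (chartRep θ p) x v (fieldRep Z p x) = - covAt θ p (fderiv ℝ (fieldRep Z p) x v) := by
    intro Z hZ hθZ v
    rw [smoothFieldAt_iff hp] at hZ
    have h0 : (fun y ↦ chartRep θ p y (fieldRep Z p y)) =ᶠ[𝓝 x] fun _ ↦ 0 := by
      have hψ : Tendsto (extChartAt 𝓘(ℝ, E) p).symm (𝓝 x) (𝓝 p) := by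
        have := continuousAt_extChartAt_symm (I := 𝓘(ℝ, E)) p
        rwa [ContinuousAt, extChartAt_to_inv] at this
      filter_upwards [hψ.eventually hθZ, extChartAt_target_mem_nhds (I := 𝓘(ℝ, E)) p] with y hy1 hy2
      have hq : (extChartAt 𝓘(ℝ, E) p).symm y ∈ (chartAt E p).source := by
        simpa using (extChartAt 𝓘(ℝ, E) p).map_target hy2
      have h2 := dAt_symm_fieldRep Z hq
      rw [(extChartAt 𝓘(ℝ, E) p).right_inv hy2] at h2
      rw [chartRep_eq, ContinuousLinearMap.comp_apply, h2]
      exact hy1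
    have h1 := ((hθ.differentiableAt (by norm_num)).hasFDerivAt.clm_apply
      (hZ.differentiableAt (by norm_num)).hasFDerivAt).fderiv
    rw [h0.fderiv_eq, fderiv_fun_const] at h1
    have h2 := DFunLike.congr_fun h1 v
    simp only [Pi.zero_apply, zero_apply, add_apply,
      ContinuousLinearMap.comp_apply, ContinuousLinearMap.flip_apply] at h2
    rw [hx, chartRep_self, ← hx] at h2
    exact eq_neg_of_add_eq_zero_right h2.symm
  have h5 : extDAt θ p (fieldRep X p x) (fieldRep Y p x) =
      - covAt θ p (VectorField.lieBracket ℝ (fieldRep X p) (fieldRep Y p) x) := by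
    rw [extDAt_apply, key Y hY hθY, key X hX hθX, VectorField.lieBracket, map_sub]
    abel
  rw [mlieBracket_eq_fieldRep]
  rw [hx, fieldRep_self, fieldRep_self] at h5
  exact h5

end Cartan

/-! ### Complexified tangent vectors and the Levi form as a Hermitian form. -/

section ComplexTangent

variable {E : Type*} [NormedAddCommGroup E] [NormedSpace ℝ E]
  {M : Type*} [TopologicalSpace M] [ChartedSpace E M]

instance [FiniteDimensional ℝ E] (p : M) : FiniteDimensional ℝ (TangentSpace 𝓘(ℝ, E) p) :=
  inferInstanceAs (FiniteDimensional ℝ E)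

theorem evalC_cvec (p : M) (η : TangentSpace 𝓘(ℝ, E) p →L[ℝ] ℂ) (v w : TangentSpace 𝓘(ℝ, E) p) :
    evalC p η (cvec p v w) = η v + Complex.I * η w := by
  simp [evalC, cvec]

theorem conjT_cvec (p : M) (v w : TangentSpace 𝓘(ℝ, E) p) :
    conjT p (cvec p v w) = cvec p v (-w) := by
  simp [conjT, cvec, TensorProduct.neg_tmul, TensorProduct.tmul_neg]

theorem cvec_add (p : M) (v w v' w' : TangentSpace 𝓘(ℝ, E) p) :
    cvec p v w + cvec p v' w' = cvec p (v + v') (w + w') := by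
  simp only [cvec, TensorProduct.tmul_add]; abel

theorem cvec_zero (p : M) : cvec p (0 : TangentSpace 𝓘(ℝ, E) p) 0 = 0 := by
  simp [cvec]

theorem smul_cvec (p : M) (c : ℂ) (v w : TangentSpace 𝓘(ℝ, E) p) :
    c • cvec p v w = cvec p (c.re • v - c.im • w) (c.im • v + c.re • w) := by
  have h : ∀ (a : ℝ) (z : ℂ) (u : TangentSpace 𝓘(ℝ, E) p), z ⊗ₜ[ℝ] (a • u) = ((a : ℂ) * z) ⊗ₜ[ℝ] u := by
    intro a z u
    rw [TensorProduct.tmul_smul, TensorProduct.smul_tmul', Complex.real_smul]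
  simp only [cvec, smul_add, TensorProduct.smul_tmul', TensorProduct.tmul_add, TensorProduct.tmul_sub, h]
  have e1 : c • (1 : ℂ) = (c.re : ℂ) * 1 + (c.im : ℂ) * Complex.I := by
    simp [Complex.re_add_im]
  have e2 : c • Complex.I = -((c.im : ℂ) * 1) + (c.re : ℂ) * Complex.I := by
    rw [smul_eq_mul]; apply Complex.ext <;> simp
  rw [e1, e2, TensorProduct.add_tmul, TensorProduct.add_tmul, TensorProduct.neg_tmul]
  abel

/-- This replaces tensors by pairs of real vectors, so that later identities can be checked on real
and imaginary parts. -/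
theorem exists_cvec (p : M) (Z : CTangent (E := E) p) : ∃ v w, Z = cvec p v w := by
  induction Z using TensorProduct.induction_on with
  | zero => exact ⟨0, 0, (cvec_zero p).symm⟩
  | tmul c u =>
    refine ⟨c.re • u, c.im • u, ?_⟩
    have : c ⊗ₜ[ℝ] u = c • cvec p u 0 := by simp [cvec, TensorProduct.smul_tmul']
    rw [this, smul_cvec]; simp
  | add a b ha hb =>
    obtain ⟨v, w, rfl⟩ := ha
    obtain ⟨v', w', rfl⟩ := hb
    exact ⟨_, _, cvec_add p v w v' w'⟩

/-- The real part of a complexified tangent vector. -/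
def reT (p : M) : CTangent (E := E) p →ₗ[ℝ] TangentSpace 𝓘(ℝ, E) p :=
  (TensorProduct.lid ℝ _).toLinearMap ∘ₗ LinearMap.rTensor (TangentSpace 𝓘(ℝ, E) p) Complex.reLm

/-- The imaginary part of a complexified tangent vector. -/
def imT (p : M) : CTangent (E := E) p →ₗ[ℝ] TangentSpace 𝓘(ℝ, E) p :=
  (TensorProduct.lid ℝ _).toLinearMap ∘ₗ LinearMap.rTensor (TangentSpace 𝓘(ℝ, E) p) Complex.imLm

@[simp] theorem reT_cvec (p : M) (v w : TangentSpace 𝓘(ℝ, E) p) : reT p (cvec p v w) = v := by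
  simp [reT, cvec]

@[simp] theorem imT_cvec (p : M) (v w : TangentSpace 𝓘(ℝ, E) p) : imT p (cvec p v w) = w := by
  simp [imT, cvec]

theorem cvec_reT_imT (p : M) (Z : CTangent (E := E) p) : cvec p (reT p Z) (imT p Z) = Z := by
  obtain ⟨v, w, rfl⟩ := exists_cvec p Z
  simp

theorem conjT_conjT (p : M) (Z : CTangent (E := E) p) : conjT p (conjT p Z) = Z := by
  obtain ⟨v, w, rfl⟩ := exists_cvec p Z
  simp [conjT_cvec]

theorem conjT_smul (p : M) (c : ℂ) (Z : CTangent (E := E) p) :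
    conjT p (c • Z) = (starRingEnd ℂ c) • conjT p Z := by
  obtain ⟨v, w, rfl⟩ := exists_cvec p Z
  rw [smul_cvec, conjT_cvec, conjT_cvec, smul_cvec]
  congr 1
  · simp
  · simp; abel

theorem extDC_cvec (θ : OneForm E M ℝ) (p : M) (v w v' w' : TangentSpace 𝓘(ℝ, E) p) :
    extDC θ p (cvec p v w) (cvec p v' w') =
      ((extD θ p v v' - extD θ p w w' : ℝ) : ℂ) +
        Complex.I * ((extD θ p v w' + extD θ p w v' : ℝ) : ℂ) := by
  simp only [extDC, cvec, map_add, LinearMap.add_apply, LinearMap.BilinForm.baseChange_tmul]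
  simp
  ring

/-- Hermitian symmetry holds because `dθ` is real and alternating and the factor `-i` changes sign
under conjugation. -/
theorem leviForm_conj_symm (θ : OneForm E M ℝ) (p : M) (Z W : CTangent (E := E) p) :
    starRingEnd ℂ (leviForm θ p Z W) = leviForm θ p W Z := by
  obtain ⟨v, w, rfl⟩ := exists_cvec p Z
  obtain ⟨v', w', rfl⟩ := exists_cvec p W
  simp only [leviForm, conjT_cvec, extDC_cvec, map_neg]
  rw [extD_swap θ p v' v, extD_swap θ p w' w, extD_swap θ p w' v, extD_swap θ p v' w]
  apply Complex.ext <;> simp <;> ring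

theorem leviForm_sum_left (θ : OneForm E M ℝ) (p : M) {ι : Type*} (s : Finset ι) (c : ι → ℂ)
    (Z : ι → CTangent (E := E) p) (W : CTangent (E := E) p) :
    leviForm θ p (∑ i ∈ s, c i • Z i) W = ∑ i ∈ s, c i * leviForm θ p (Z i) W := by
  simp only [leviForm, map_sum, LinearMap.sum_apply, map_smul, LinearMap.smul_apply,
    Finset.mul_sum, smul_eq_mul]
  exact Finset.sum_congr rfl fun i _ ↦ by ring

theorem leviForm_sum_right (θ : OneForm E M ℝ) (p : M) {ι : Type*} (s : Finset ι) (c : ι → ℂ)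
    (Z : ι → CTangent (E := E) p) (W : CTangent (E := E) p) :
    leviForm θ p W (∑ i ∈ s, c i • Z i) = ∑ i ∈ s, starRingEnd ℂ (c i) * leviForm θ p W (Z i) := by
  rw [← leviForm_conj_symm, leviForm_sum_left, map_sum]
  simp only [map_mul, leviForm_conj_symm]

theorem evalC_add (p : M) (η η' : TangentSpace 𝓘(ℝ, E) p →L[ℝ] ℂ) (Z : CTangent (E := E) p) :
    evalC p (η + η') Z = evalC p η Z + evalC p η' Z := by
  obtain ⟨v, w, rfl⟩ := exists_cvec p Z
  simp [evalC_cvec]; ring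

theorem evalC_smul (p : M) (c : ℂ) (η : TangentSpace 𝓘(ℝ, E) p →L[ℝ] ℂ) (Z : CTangent (E := E) p) :
    evalC p (c • η) Z = c * evalC p η Z := by
  obtain ⟨v, w, rfl⟩ := exists_cvec p Z
  simp [evalC_cvec]; ring

theorem evalC_sum (p : M) {ι : Type*} (s : Finset ι) (c : ι → ℂ)
    (η : ι → (TangentSpace 𝓘(ℝ, E) p →L[ℝ] ℂ)) (Z : CTangent (E := E) p) :
    evalC p (∑ i ∈ s, c i • η i) Z = ∑ i ∈ s, c i * evalC p (η i) Z := by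
  classical
  induction s using Finset.induction_on with
  | empty =>
    obtain ⟨v, w, rfl⟩ := exists_cvec p Z
    simp [evalC_cvec]
  | insert a s ha ih => rw [Finset.sum_insert ha, Finset.sum_insert ha, evalC_add, evalC_smul, ih]

theorem evalC_toComplex_eq_zero (p : M) {η : TangentSpace 𝓘(ℝ, E) p →L[ℝ] ℝ}
    {v w : TangentSpace 𝓘(ℝ, E) p} :
    evalC p (toComplex p η) (cvec p v w) = 0 ↔ η v = 0 ∧ η w = 0 := by
  rw [evalC_cvec, Complex.ext_iff]
  simp [toComplex]

/-- A covector is determined by the functional it induces on the complexified tangent space. -/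
theorem exists_evalC_eq [FiniteDimensional ℝ E] (p : M) (φ : CTangent (E := E) p →ₗ[ℂ] ℂ) :
    ∃ η : TangentSpace 𝓘(ℝ, E) p →L[ℝ] ℂ, evalC p η = φ := by
  let g : TangentSpace 𝓘(ℝ, E) p →ₗ[ℝ] ℂ :=
    (φ.restrictScalars ℝ) ∘ₗ (TensorProduct.mk ℝ ℂ (TangentSpace 𝓘(ℝ, E) p) 1)
  have hg : Continuous (g : E → ℂ) := by
    let g' : E →ₗ[ℝ] ℂ := g
    exact g'.continuous_of_finiteDimensional
  refine ⟨⟨g, hg⟩, ?_⟩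
  ext v
  simp [evalC, g]

end ComplexTangent

/-! ### Pointwise linear algebra of a CR structure, and its local frames. -/

section CRPointwise

variable {E : Type*} [NormedAddCommGroup E] [NormedSpace ℝ E]
  {M : Type*} [TopologicalSpace M] [ChartedSpace E M] [IsManifold 𝓘(ℝ, E) ∞ M] {n : ℕ}

theorem CRStructure.finiteDimensional (S : CRStructure E M n) : FiniteDimensional ℝ E :=
  Module.finite_of_finrank_pos (by rw [S.dim_eq]; omega)

theorem IsContactForm.apply_eq_zero {S : CRStructure E M n} {U : Set M} {θ : OneForm E M ℝ}
    (h : IsContactForm S U θ) {p : M} (hp : p ∈ U) {v w : TangentSpace 𝓘(ℝ, E) p}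
    (hv : cvec p v w ∈ S.V p) : θ p v = 0 ∧ θ p w = 0 :=
  (evalC_toComplex_eq_zero p).1 (h.annihilates p hp _ hv)

theorem IsContactForm.evalC_hol {S : CRStructure E M n} {U : Set M} {θ : OneForm E M ℝ}
    (h : IsContactForm S U θ) {p : M} (hp : p ∈ U) {Z : CTangent (E := E) p}
    (hZ : S.IsHol p Z) : evalC p (toComplex p (θ p)) Z = 0 := by
  obtain ⟨v, w, rfl⟩ := exists_cvec p Z
  rw [CRStructure.IsHol, conjT_cvec] at hZ
  have := h.apply_eq_zero hp hZ
  rw [evalC_toComplex_eq_zero]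
  simpa using this

/-- The double annihilator of `V` is `V`. -/
theorem CRStructure.mem_V_of_forall_holCotangent (S : CRStructure E M n) {p : M}
    {Z : CTangent (E := E) p} (h : ∀ η ∈ S.holCotangent p, evalC p η Z = 0) : Z ∈ S.V p := by
  have := S.finiteDimensional
  by_contra hZ
  obtain ⟨φ, hφ, hφV⟩ := Submodule.exists_le_ker_of_notMem hZ
  obtain ⟨η, rfl⟩ := exists_evalC_eq p φ
  exact hφ (h η fun W hW ↦ hφV hW)

/-- A real vector annihilated by a nonzero real covector of type `(1,0)` is the real part of an
element of `V`. -/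
theorem CRStructure.exists_cvec_mem (S : CRStructure E M n) {p : M}
    {θ : TangentSpace 𝓘(ℝ, E) p →L[ℝ] ℝ} (hθ : θ ≠ 0) (h : toComplex p θ ∈ S.holCotangent p)
    {v : TangentSpace 𝓘(ℝ, E) p} (hv : θ v = 0) : ∃ w, cvec p v w ∈ S.V p := by
  have := S.finiteDimensional
  let f : TangentSpace 𝓘(ℝ, E) p →ₗ[ℝ] ℝ := θ
  -- Taking real parts maps `V`, of real dimension `2n`, to `ker θ`, of the same dimension. It is
  -- injective: an element of `V` with zero real part is minus its conjugate, hence in `V ∩ V̄ = 0`.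
  let Φ : (S.V p).restrictScalars ℝ →ₗ[ℝ] LinearMap.ker f :=
    LinearMap.codRestrict _ ((reT p) ∘ₗ ((S.V p).restrictScalars ℝ).subtype) (by
      rintro ⟨Z, hZ⟩
      obtain ⟨a, b, rfl⟩ := exists_cvec p Z
      change θ (reT p (cvec p a b)) = 0
      rw [reT_cvec]
      exact ((evalC_toComplex_eq_zero p).1 (h _ hZ)).1)
  have hinj : Function.Injective Φ := by
    rw [← LinearMap.ker_eq_bot, LinearMap.ker_eq_bot']
    rintro ⟨Z, hZ⟩ hΦ
    obtain ⟨a, b, rfl⟩ := exists_cvec p Z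
    have ha : a = 0 := by simpa [Φ] using congrArg Subtype.val hΦ
    subst ha
    refine Subtype.ext (S.inf_conj p _ hZ ?_)
    have h2 := (S.V p).smul_mem (-1 : ℂ) hZ
    rw [smul_cvec] at h2
    rw [conjT_cvec]
    simpa using h2
  have hdim : Module.finrank ℝ ((S.V p).restrictScalars ℝ) = Module.finrank ℝ (LinearMap.ker f) := by
    have h1 : Module.finrank ℝ ((S.V p).restrictScalars ℝ) = 2 * n := by
      have := finrank_real_of_complex (S.V p)
      rw [S.rank_eq p] at this
      exact this
    have hf : f ≠ 0 := by
      intro h0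
      exact hθ (ContinuousLinearMap.ext fun x ↦ DFunLike.congr_fun h0 x)
    have h2 := Module.Dual.finrank_ker_add_one_of_ne_zero hf
    have h3 : Module.finrank ℝ (TangentSpace 𝓘(ℝ, E) p) = 2 * n + 1 := S.dim_eq
    omega
  have hsurj := (LinearMap.injective_iff_surjective_of_finrank_eq_finrank hdim).1 hinj
  obtain ⟨⟨Z, hZ⟩, hZv⟩ := hsurj ⟨v, hv⟩
  have : reT p Z = v := congrArg Subtype.val hZv
  exact ⟨imT p Z, by rw [← this, cvec_reT_imT]; exact hZ⟩

theorem IsContactForm.exists_cvec_mem {S : CRStructure E M n} {U : Set M} {θ : OneForm E M ℝ}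
    (h : IsContactForm S U θ) {p : M} (hp : p ∈ U) {v : TangentSpace 𝓘(ℝ, E) p}
    (hv : θ p v = 0) : ∃ w, cvec p v w ∈ S.V p :=
  S.exists_cvec_mem (h.ne_zero p hp) (h.annihilates p hp) hv

/-- Real covectors of type `(1,0)` are proportional. -/
theorem CRStructure.exists_eq_smul (S : CRStructure E M n) {p : M}
    {θ θ' : TangentSpace 𝓘(ℝ, E) p →L[ℝ] ℝ} (hθ : θ ≠ 0) (h : toComplex p θ ∈ S.holCotangent p)
    (h' : toComplex p θ' ∈ S.holCotangent p) : ∃ c : ℝ, θ' = c • θ := by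
  obtain ⟨u, hu⟩ : ∃ u, θ u ≠ 0 := by
    by_contra! h0
    exact hθ (ContinuousLinearMap.ext h0)
  refine ⟨θ' u / θ u, ContinuousLinearMap.ext fun v ↦ ?_⟩
  have hv : θ (v - (θ v / θ u) • u) = 0 := by
    rw [map_sub, map_smul, smul_eq_mul, div_mul_cancel₀ _ hu, sub_self]
  obtain ⟨w, hw⟩ := S.exists_cvec_mem hθ h hv
  have h1 := ((evalC_toComplex_eq_zero p).1 (h' _ hw)).1
  rw [map_sub, map_smul, sub_eq_zero] at h1
  rw [h1, smul_apply, smul_eq_mul, smul_eq_mul]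
  ring

/-- A local frame `X_j + i Y_j` of `V` on an open set. -/
structure CRStructure.IsFrame (S : CRStructure E M n) (U : Set M)
    (X Y : Fin n → ∀ q : M, TangentSpace 𝓘(ℝ, E) q) : Prop where
  isOpen : IsOpen U
  smooth_re : ∀ j, ∀ q ∈ U, SmoothFieldAt (X j) q
  smooth_im : ∀ j, ∀ q ∈ U, SmoothFieldAt (Y j) q
  span_eq : ∀ q ∈ U, S.V q = Submodule.span ℂ (Set.range fun j ↦ cvec q (X j q) (Y j q))

theorem CRStructure.exists_isFrame (S : CRStructure E M n) (p : M) :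
    ∃ U X Y, p ∈ U ∧ S.IsFrame U X Y := by
  obtain ⟨U, hU, hp, X, Y, hX, hY, hV⟩ := S.smooth p
  exact ⟨U, X, Y, hp, hU, fun j ↦ (smoothField_iff hU).1 (hX j),
    fun j ↦ (smoothField_iff hU).1 (hY j), hV⟩

namespace CRStructure.IsFrame

variable {S : CRStructure E M n} {U : Set M} {X Y : Fin n → ∀ q : M, TangentSpace 𝓘(ℝ, E) q}

theorem mem (h : S.IsFrame U X Y) {q : M} (hq : q ∈ U) (j : Fin n) :
    cvec q (X j q) (Y j q) ∈ S.V q := by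
  rw [h.span_eq q hq]; exact Submodule.subset_span ⟨j, rfl⟩

theorem linearIndependent (h : S.IsFrame U X Y) {q : M} (hq : q ∈ U) :
    LinearIndependent ℂ fun j ↦ cvec q (X j q) (Y j q) := by
  rw [linearIndependent_iff_card_eq_finrank_span, Set.finrank, ← h.span_eq q hq, S.rank_eq]
  simp

theorem exists_eq (h : S.IsFrame U X Y) {q : M} (hq : q ∈ U) {Z : CTangent (E := E) q}
    (hZ : Z ∈ S.V q) : ∃ c : Fin n → ℂ, Z = ∑ j, c j • cvec q (X j q) (Y j q) := by
  rw [h.span_eq q hq, Submodule.mem_span_range_iff_exists_fun] at hZ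
  obtain ⟨c, hc⟩ := hZ
  exact ⟨c, hc.symm⟩

/-- Real and imaginary parts of elements of `V` are real combinations of the `X_j` and `Y_j`. -/
theorem exists_re_eq (h : S.IsFrame U X Y) {q : M} (hq : q ∈ U) {v w : TangentSpace 𝓘(ℝ, E) q}
    (hZ : cvec q v w ∈ S.V q) : ∃ a b : Fin n → ℝ, v = ∑ j, (a j • X j q + b j • Y j q) := by
  obtain ⟨c, hc⟩ := h.exists_eq hq hZ
  refine ⟨fun j ↦ (c j).re, fun j ↦ -(c j).im, ?_⟩
  have := congrArg (reT q) hc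
  rw [reT_cvec, map_sum] at this
  rw [this]
  refine Finset.sum_congr rfl fun j _ ↦ ?_
  rw [smul_cvec, reT_cvec, neg_smul, sub_eq_add_neg]

end CRStructure.IsFrame

/-! ### The Levi form of a contact form and its characteristic vector. -/

section Contact

variable {S : CRStructure E M n} {U : Set M} {θ : OneForm E M ℝ}

theorem IsContactForm.smoothFormAt (h : IsContactForm S U θ) (hU : IsOpen U) {p : M} (hp : p ∈ U) :
    SmoothFormAt θ p := (smoothForm_iff hU).1 h.smooth p hp

theorem IsContactForm.mono (h : IsContactForm S U θ) {U' : Set M} (hU : U' ⊆ U) :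
    IsContactForm S U' θ :=
  ⟨fun p hp ↦ (h.smooth p (hU hp)).mono hU, fun p hp ↦ h.ne_zero p (hU hp),
    fun p hp ↦ h.annihilates p (hU hp)⟩

theorem IsContactForm.extD_frame (h : IsContactForm S U θ) (hU : IsOpen U) {p : M} (hp : p ∈ U)
    {X Y : ∀ q : M, TangentSpace 𝓘(ℝ, E) q} (hX : SmoothFieldAt X p) (hY : SmoothFieldAt Y p)
    (hθX : ∀ᶠ q in 𝓝 p, θ q (X q) = 0) (hθY : ∀ᶠ q in 𝓝 p, θ q (Y q) = 0) :
    extD θ p (X p) (Y p) = - θ p (VectorField.mlieBracket 𝓘(ℝ, E) X Y p) :=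
  extD_eq_neg_mlieBracket (h.smoothFormAt hU hp) hX hY hθX hθY

theorem IsContactForm.eventually_frame (h : IsContactForm S U θ) (hU : IsOpen U) {p : M} (hp : p ∈ U)
    {U₀ : Set M} {X Y : Fin n → ∀ q : M, TangentSpace 𝓘(ℝ, E) q} (hF : S.IsFrame U₀ X Y)
    (hp₀ : p ∈ U₀) (j : Fin n) :
    (∀ᶠ q in 𝓝 p, θ q (X j q) = 0) ∧ ∀ᶠ q in 𝓝 p, θ q (Y j q) = 0 := by
  constructor <;>
  filter_upwards [hU.mem_nhds hp, hF.isOpen.mem_nhds hp₀] with q hq hq₀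
  · exact (h.apply_eq_zero hq (hF.mem hq₀ j)).1
  · exact (h.apply_eq_zero hq (hF.mem hq₀ j)).2

/-- On `ker θ_p`, the form `dθ` depends only on the value of the contact form at `p`. -/
theorem IsContactForm.extD_eq_mul (h : IsContactForm S U θ) (hU : IsOpen U) {p : M} (hp : p ∈ U)
    {U' : Set M} {θ' : OneForm E M ℝ} (h' : IsContactForm S U' θ') (hU' : IsOpen U') (hp' : p ∈ U')
    {c : ℝ} (hc : θ' p = c • θ p) {v w : TangentSpace 𝓘(ℝ, E) p} (hv : θ p v = 0) (hw : θ p w = 0) :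
    extD θ' p v w = c * extD θ p v w := by
  obtain ⟨U₀, X, Y, hp₀, hF⟩ := S.exists_isFrame p
  obtain ⟨v', hv'⟩ := h.exists_cvec_mem hp hv
  obtain ⟨w', hw'⟩ := h.exists_cvec_mem hp hw
  obtain ⟨a, b, rfl⟩ := hF.exists_re_eq hp₀ hv'
  obtain ⟨a', b', rfl⟩ := hF.exists_re_eq hp₀ hw'
  -- On fields that both contact forms annihilate, Cartan's formula gives minus the form applied to
  -- a bracket, and the bracket does not involve the form. Real and imaginary parts of a frame of
  -- `V` are such fields and span `ker θ_p`.
  have key : ∀ {A B : ∀ q : M, TangentSpace 𝓘(ℝ, E) q}, SmoothFieldAt A p → SmoothFieldAt B p →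
      (∀ᶠ q in 𝓝 p, θ q (A q) = 0) → (∀ᶠ q in 𝓝 p, θ q (B q) = 0) →
      (∀ᶠ q in 𝓝 p, θ' q (A q) = 0) → (∀ᶠ q in 𝓝 p, θ' q (B q) = 0) →
      extD θ' p (A p) (B p) = c * extD θ p (A p) (B p) := by
    intro A B hA hB h1 h2 h3 h4
    rw [h.extD_frame hU hp hA hB h1 h2, h'.extD_frame hU' hp' hA hB h3 h4, hc]
    simp
  have sX := fun j ↦ hF.smooth_re j p hp₀
  have sY := fun j ↦ hF.smooth_im j p hp₀
  have e := fun j ↦ h.eventually_frame hU hp hF hp₀ j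
  have e' := fun j ↦ h'.eventually_frame hU' hp' hF hp₀ j
  have k1 := fun i j ↦ key (sX i) (sX j) (e i).1 (e j).1 (e' i).1 (e' j).1
  have k2 := fun i j ↦ key (sX i) (sY j) (e i).1 (e j).2 (e' i).1 (e' j).2
  have k3 := fun i j ↦ key (sY i) (sX j) (e i).2 (e j).1 (e' i).2 (e' j).1
  have k4 := fun i j ↦ key (sY i) (sY j) (e i).2 (e j).2 (e' i).2 (e' j).2
  simp only [map_sum, map_add, map_smul, FunLike.coe_sum, Finset.sum_apply, add_apply, smul_apply,
    Finset.mul_sum, k1, k2, k3, k4, smul_eq_mul, mul_add]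
  refine Finset.sum_congr rfl fun j _ ↦ ?_
  refine congrArg₂ _ (Finset.sum_congr rfl fun i _ ↦ ?_) (Finset.sum_congr rfl fun i _ ↦ ?_) <;> ring

/-- `dθ` vanishes on `V × V`. -/
theorem IsContactForm.extDC_eq_zero (h : IsContactForm S U θ) (hU : IsOpen U) {p : M} (hp : p ∈ U)
    {Z W : CTangent (E := E) p} (hZ : Z ∈ S.V p) (hW : W ∈ S.V p) : extDC θ p Z W = 0 := by
  obtain ⟨U₀, X, Y, hp₀, hF⟩ := S.exists_isFrame p
  obtain ⟨c, rfl⟩ := hF.exists_eq hp₀ hZ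
  obtain ⟨d, rfl⟩ := hF.exists_eq hp₀ hW
  have key : ∀ i j, extDC θ p (cvec p (X i p) (Y i p)) (cvec p (X j p) (Y j p)) = 0 := by
    intro i j
    have sX := fun j ↦ hF.smooth_re j p hp₀
    have sY := fun j ↦ hF.smooth_im j p hp₀
    have e := fun j ↦ h.eventually_frame hU hp hF hp₀ j
    rw [extDC_cvec, h.extD_frame hU hp (sX i) (sX j) (e i).1 (e j).1,
      h.extD_frame hU hp (sX i) (sY j) (e i).1 (e j).2,
      h.extD_frame hU hp (sY i) (sX j) (e i).2 (e j).1,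
      h.extD_frame hU hp (sY i) (sY j) (e i).2 (e j).2]
    have sX' := fun j ↦ (smoothField_iff hF.isOpen).2 (hF.smooth_re j)
    have sY' := fun j ↦ (smoothField_iff hF.isOpen).2 (hF.smooth_im j)
    -- The bracket of two frame sections lies in `V`, so `θ` kills its real and imaginary parts; up
    -- to sign these values are the real and imaginary parts of `dθ` on the two sections.
    have hinv := S.involutive U₀ hF.isOpen (X i) (Y i) (X j) (Y j) (sX' i) (sY' i) (sX' j) (sY' j)
      (fun q hq ↦ hF.mem hq i) (fun q hq ↦ hF.mem hq j) p hp₀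
    obtain ⟨h1, h2⟩ := h.apply_eq_zero hp hinv
    rw [map_sub] at h1
    rw [map_add] at h2
    have e1 : -θ p (VectorField.mlieBracket 𝓘(ℝ, E) (X i) (X j) p) -
      -θ p (VectorField.mlieBracket 𝓘(ℝ, E) (Y i) (Y j) p) = 0 := by linarith
    have e2 : -θ p (VectorField.mlieBracket 𝓘(ℝ, E) (X i) (Y j) p) +
      -θ p (VectorField.mlieBracket 𝓘(ℝ, E) (Y i) (X j) p) = 0 := by linarith
    rw [e1, e2]; simp
  simp only [map_sum, LinearMap.sum_apply, map_smul, LinearMap.smul_apply, key, smul_zero,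
    Finset.sum_const_zero]

/-- Levi nondegeneracy: `dθ` is nondegenerate on `ker θ`. -/
theorem IsContactForm.eq_zero_of_extD (h : IsContactForm S U θ) (hU : IsOpen U)
    (hS : S.LeviNondegenerate) {p : M} (hp : p ∈ U)
    {v : TangentSpace 𝓘(ℝ, E) p} (hv : θ p v = 0) (hvw : ∀ w, θ p w = 0 → extD θ p v w = 0) :
    v = 0 := by
  obtain ⟨w, hw⟩ := h.exists_cvec_mem hp hv
  -- The vector `v` is the real part of `v + iw` in `V`, and the hypothesis concerns `v` only. The
  -- vanishing of `dθ` on `V × V` supplies what is missing about `w`, so that `v - iw` lies in the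
  -- kernel of the Levi form.
  have hA : conjT p (cvec p v w) = 0 := by
    refine hS p U θ hU hp h _ (by rwa [CRStructure.IsHol, conjT_conjT]) fun C hC ↦ ?_
    obtain ⟨x, y, hxy⟩ := exists_cvec p (conjT p C)
    rw [CRStructure.IsHol, hxy] at hC
    obtain ⟨hx, hy⟩ := h.apply_eq_zero hp hC
    have h0 := h.extDC_eq_zero hU hp hw hC
    rw [extDC_cvec] at h0
    rw [leviForm, hxy, conjT_cvec, extDC_cvec]
    simp only [hvw x hx, hvw y hy, map_neg, neg_apply, zero_sub, zero_add, neg_neg] at h0 ⊢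
    apply mul_eq_zero_of_right
    push_cast at h0 ⊢
    linear_combination -h0
  rw [conjT_cvec] at hA
  simpa using congrArg (reT p) hA

/-- The map `v ↦ θ(v) θ + dθ(v, ·)`. -/
def reebMap (θ : OneForm E M ℝ) (p : M) : E →L[ℝ] E →L[ℝ] ℝ :=
  (covAt θ p).smulRight (covAt θ p) + extDAt θ p

theorem reebMap_apply (θ : OneForm E M ℝ) (p : M) (v w : E) :
    reebMap θ p v w = covAt θ p v * covAt θ p w + extDAt θ p v w := by
  simp [reebMap]

/-- Evaluating the image of `v` on `v` itself leaves `θ(v)² = 0`, since `dθ` is alternating; then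
`v` is in the kernel of `dθ` on `ker θ`. -/
theorem IsContactForm.reebMap_injective (h : IsContactForm S U θ) (hU : IsOpen U)
    (hS : S.LeviNondegenerate) {p : M} (hp : p ∈ U) : Function.Injective (reebMap θ p) := by
  rw [injective_iff_map_eq_zero]
  intro v hv
  have h0 : ∀ w, covAt θ p v * covAt θ p w + extDAt θ p v w = 0 := fun w ↦ by
    rw [← reebMap_apply, hv]; rfl
  have h1 : extDAt θ p v v = 0 := by have := extDAt_swap θ p v v; linarith
  have h2 : covAt θ p v = 0 := by have := h0 v; rw [h1] at this; simpa using this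
  refine h.eq_zero_of_extD hU hS hp h2 fun w _ ↦ ?_
  have := h0 w
  rw [h2] at this
  have h3 : extDAt θ p v w = 0 := by linarith
  exact h3

/-- The two conditions on the characteristic vector become one linear equation. Evaluation on `T`
gives `θ(T)² = θ(T)`; the root `0` would put `T` in the kernel of `dθ` on `ker θ`, so `T = 0` and
then `θ = 0`. -/
theorem IsContactForm.isReebAt_of_reebMap (h : IsContactForm S U θ) (hU : IsOpen U)
    (hS : S.LeviNondegenerate) {p : M} (hp : p ∈ U) {T : E} (hT : reebMap θ p T = covAt θ p) :
    IsReebAt θ p T := by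
  have h0 : ∀ w, covAt θ p T * covAt θ p w + extDAt θ p T w = covAt θ p w := fun w ↦ by
    rw [← reebMap_apply, hT]
  have h1 : extDAt θ p T T = 0 := by have := extDAt_swap θ p T T; linarith
  have h2 : covAt θ p T * (covAt θ p T - 1) = 0 := by have := h0 T; rw [h1] at this; linarith
  rcases mul_eq_zero.1 h2 with h3 | h3
  · exfalso
    have h4 : T = 0 := by
      refine h.eq_zero_of_extD hU hS hp h3 fun w hw ↦ ?_
      have hw' : covAt θ p w = 0 := hw
      have h5 := h0 w
      rw [hw'] at h5
      have h6 : extDAt θ p T w = 0 := by linarith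
      exact h6
    rw [h4, map_zero] at hT
    exact h.ne_zero p hp hT.symm
  · have h4 : covAt θ p T = 1 := by linarith
    refine ⟨h4, fun w ↦ ?_⟩
    have h5 := h0 w
    rw [h4] at h5
    have h6 : extDAt θ p T w = 0 := by linarith
    exact h6

theorem IsReebAt.reebMap_eq {p : M} {T : TangentSpace 𝓘(ℝ, E) p} (hT : IsReebAt θ p T) :
    reebMap θ p T = covAt θ p := by
  ext w
  have h1 : covAt θ p T = 1 := hT.1
  have h2 : extDAt θ p T w = 0 := hT.2 w
  refine (reebMap_apply θ p T w).trans ?_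
  rw [h1, h2]; ring

theorem IsContactForm.reeb_unique (h : IsContactForm S U θ) (hU : IsOpen U)
    (hS : S.LeviNondegenerate) {p : M} (hp : p ∈ U) {T T' : TangentSpace 𝓘(ℝ, E) p}
    (hT : IsReebAt θ p T) (hT' : IsReebAt θ p T') : T = T' :=
  h.reebMap_injective hU hS hp (hT.reebMap_eq.trans hT'.reebMap_eq.symm)

theorem IsContactForm.reebMap_bijective (h : IsContactForm S U θ) (hU : IsOpen U)
    (hS : S.LeviNondegenerate) {p : M} (hp : p ∈ U) : Function.Bijective (reebMap θ p) := by
  have := S.finiteDimensional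
  have hi := h.reebMap_injective hU hS hp
  refine ⟨hi, ?_⟩
  have hd : Module.finrank ℝ E = Module.finrank ℝ (E →L[ℝ] ℝ) := by
    rw [← (LinearMap.toContinuousLinearMap : (E →ₗ[ℝ] ℝ) ≃ₗ[ℝ] (E →L[ℝ] ℝ)).finrank_eq]
    exact Subspace.dual_finrank_eq.symm
  exact (LinearMap.injective_iff_surjective_of_finrank_eq_finrank
    (f := (reebMap θ p : E →ₗ[ℝ] (E →L[ℝ] ℝ))) hd).1 hi

theorem IsContactForm.exists_isReebAt (h : IsContactForm S U θ) (hU : IsOpen U)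
    (hS : S.LeviNondegenerate) {p : M} (hp : p ∈ U) : ∃ T, IsReebAt θ p T := by
  obtain ⟨T, hT⟩ := (h.reebMap_bijective hU hS hp).2 (covAt θ p)
  exact ⟨T, h.isReebAt_of_reebMap hU hS hp hT⟩

end Contact

end CRPointwise

/-! ### Smooth families of invertible linear maps. -/

section Calculus

variable {E : Type*} [NormedAddCommGroup E] [NormedSpace ℝ E]
  {V : Type*} [NormedAddCommGroup V] [NormedSpace ℝ V]
  {W : Type*} [NormedAddCommGroup W] [NormedSpace ℝ W]

theorem contDiffAt_clm_of_apply [FiniteDimensional ℝ V] {A : E → V →L[ℝ] W} {x : E}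
    (h : ∀ v, ContDiffAt ℝ ∞ (fun y ↦ A y v) x) : ContDiffAt ℝ ∞ A x := by
  let b := Module.finBasis ℝ V
  have e : A = fun y ↦ ∑ i, (LinearMap.toContinuousLinearMap (b.coord i)).smulRight (A y (b i)) := by
    funext y
    ext v
    rw [FunLike.coe_sum, Finset.sum_apply]
    conv_lhs => rw [← b.sum_repr v, map_sum]
    simp
  rw [e]
  refine ContDiffAt.sum fun i _ ↦ ?_
  exact (ContinuousLinearMap.smulRightL ℝ V W (LinearMap.toContinuousLinearMap
    (b.coord i))).contDiff.contDiffAt.comp x (h (b i))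

theorem exists_continuousLinearEquiv_of_bijective [FiniteDimensional ℝ V] {A : V →L[ℝ] W}
    (hA : Function.Bijective A) : ∃ e : V ≃L[ℝ] W, (e : V →L[ℝ] W) = A :=
  ⟨(LinearEquiv.ofBijective (A : V →ₗ[ℝ] W) hA).toContinuousLinearEquiv, rfl⟩

theorem contDiffAt_inverse [FiniteDimensional ℝ V] {A : E → V →L[ℝ] W} {x : E}
    (h : ContDiffAt ℝ ∞ A x) (hA : Function.Bijective (A x)) :
    ContDiffAt ℝ ∞ (fun y ↦ (A y).inverse) x := by
  have : CompleteSpace V := FiniteDimensional.complete ℝ V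
  obtain ⟨e, he⟩ := exists_continuousLinearEquiv_of_bijective hA
  have h1 := contDiffAt_map_inverse (𝕜 := ℝ) (n := ∞) e
  rw [he] at h1
  exact h1.comp x h

theorem apply_inverse_apply [FiniteDimensional ℝ V] {A : V →L[ℝ] W}
    (hA : Function.Bijective A) (w : W) : A (A.inverse w) = w := by
  obtain ⟨e, rfl⟩ := exists_continuousLinearEquiv_of_bijective hA
  simp

theorem eventually_bijective [FiniteDimensional ℝ V] {A : E → V →L[ℝ] W} {x : E}
    (h : ContinuousAt A x) (hA : Function.Bijective (A x)) :
    ∀ᶠ y in 𝓝 x, Function.Bijective (A y) := by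
  have : CompleteSpace V := FiniteDimensional.complete ℝ V
  obtain ⟨e, he⟩ := exists_continuousLinearEquiv_of_bijective hA
  have h1 := e.nhds
  rw [he] at h1
  filter_upwards [h h1] with y hy
  obtain ⟨e', he'⟩ := hy
  rw [← he']
  exact e'.bijective

end Calculus

/-! ### Algebraic operations on smooth one-forms. -/

section FormAlgebra

variable {E : Type*} [NormedAddCommGroup E] [NormedSpace ℝ E]
  {M : Type*} [TopologicalSpace M] [ChartedSpace E M] [IsManifold 𝓘(ℝ, E) ∞ M]
  {F : Type*} [NormedAddCommGroup F] [NormedSpace ℝ F]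
  {F' : Type*} [NormedAddCommGroup F'] [NormedSpace ℝ F']

theorem SmoothFormAt.add {η η' : OneForm E M F} {p : M} (h : SmoothFormAt η p)
    (h' : SmoothFormAt η' p) : SmoothFormAt (fun q ↦ η q + η' q) p := by
  have hp := mem_chart_source E p
  rw [smoothFormAt_iff hp] at h h' ⊢
  exact h.add h'

theorem SmoothFormAt.congr {η η' : OneForm E M F} {p : M} (h : SmoothFormAt η p)
    (h' : ∀ᶠ q in 𝓝 p, η' q = η q) : SmoothFormAt η' p := by
  refine ContMDiffAt.congr_of_eventuallyEq h ?_
  filter_upwards [h'] with q hq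
  rw [hq]

theorem smoothFormAt_zero (p : M) : SmoothFormAt (fun _ ↦ 0 : OneForm E M F) p := by
  rw [smoothFormAt_iff (mem_chart_source E p)]
  exact (contDiffAt_const (c := (0 : E →L[ℝ] F))).congr_of_eventuallyEq
    (Eventually.of_forall fun y ↦ by ext v; rfl)

theorem SmoothFormAt.compCLM {η : OneForm E M F} {p : M} (h : SmoothFormAt η p) (L : F →L[ℝ] F') :
    SmoothFormAt (fun q ↦ L.comp (η q) : OneForm E M F') p := by
  have hp := mem_chart_source E p
  rw [smoothFormAt_iff hp] at h ⊢
  exact (contDiffAt_const (c := L)).clm_comp h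

theorem SmoothFormAt.toComplex {η : OneForm E M ℝ} {p : M} (h : SmoothFormAt η p) :
    SmoothFormAt (fun q ↦ CRGeom.toComplex q (η q)) p := h.compCLM Complex.ofRealCLM

theorem SmoothFormAt.smul {η : OneForm E M ℂ} {p : M} (h : SmoothFormAt η p) {u : M → ℂ}
    (hu : ContMDiffAt 𝓘(ℝ, E) 𝓘(ℝ, ℂ) ∞ u p) : SmoothFormAt (fun q ↦ u q • η q) p := by
  have hp := mem_chart_source E p
  rw [smoothFormAt_iff hp] at h ⊢
  have h1 := ((contMDiffAt_iff_comp_symm hp).1 hu).smul h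
  refine h1.congr_of_eventuallyEq (Eventually.of_forall fun y ↦ ?_)
  ext v
  rfl

theorem SmoothFormAt.smulReal {η : OneForm E M ℝ} {p : M} (h : SmoothFormAt η p) {u : M → ℝ}
    (hu : ContMDiffAt 𝓘(ℝ, E) 𝓘(ℝ, ℝ) ∞ u p) : SmoothFormAt (fun q ↦ u q • η q) p := by
  have hp := mem_chart_source E p
  rw [smoothFormAt_iff hp] at h ⊢
  have h1 := ((contMDiffAt_iff_comp_symm hp).1 hu).smul h
  refine h1.congr_of_eventuallyEq (Eventually.of_forall fun y ↦ ?_)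
  ext v
  rfl

theorem SmoothFormAt.sum_smul {ι : Type*} (s : Finset ι) {η : ι → OneForm E M ℂ} {p : M}
    (h : ∀ i ∈ s, SmoothFormAt (η i) p) {u : M → ι → ℂ}
    (hu : ∀ i ∈ s, ContMDiffAt 𝓘(ℝ, E) 𝓘(ℝ, ℂ) ∞ (fun q ↦ u q i) p) :
    SmoothFormAt (fun q ↦ ∑ i ∈ s, u q i • η i q) p := by
  classical
  induction s using Finset.induction_on with
  | empty => exact (smoothFormAt_zero p).congr (Eventually.of_forall fun q ↦ by simp)
  | insert a s ha ih =>
    have h1 := (h a (Finset.mem_insert_self a s)).smul (hu a (Finset.mem_insert_self a s))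
    have h2 := ih (fun i hi ↦ h i (Finset.mem_insert_of_mem hi))
      (fun i hi ↦ hu i (Finset.mem_insert_of_mem hi))
    exact (h1.add h2).congr (Eventually.of_forall fun q ↦ by rw [Finset.sum_insert ha])

theorem extDAt_congr {η η' : OneForm E M F} {p : M} (h : ∀ᶠ q in 𝓝 p, η q = η' q) :
    extDAt η p = extDAt η' p := by
  have h1 : chartRep η p =ᶠ[𝓝 (extChartAt 𝓘(ℝ, E) p p)] chartRep η' p := by
    have hψ : Tendsto (extChartAt 𝓘(ℝ, E) p).symm (𝓝 (extChartAt 𝓘(ℝ, E) p p)) (𝓝 p) := by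
      have := continuousAt_extChartAt_symm (I := 𝓘(ℝ, E)) p
      rwa [ContinuousAt, extChartAt_to_inv] at this
    filter_upwards [hψ.eventually h] with y hy
    rw [chartRep_eq, chartRep_eq]
    exact congrArg (fun g : E →L[ℝ] F ↦ g.comp _) hy
  ext v w
  rw [extDAt_apply, extDAt_apply, h1.fderiv_eq]

end FormAlgebra

/-! ### Local existence of contact forms. -/

section LocalContact

variable {E : Type*} [NormedAddCommGroup E] [NormedSpace ℝ E]
  {M : Type*} [TopologicalSpace M] [ChartedSpace E M] [IsManifold 𝓘(ℝ, E) ∞ M] {n : ℕ}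

theorem CRStructure.mem_holCotangent_of_frame {S : CRStructure E M n} {U : Set M}
    {X Y : Fin n → ∀ q : M, TangentSpace 𝓘(ℝ, E) q} (h : S.IsFrame U X Y) {q : M} (hq : q ∈ U)
    {η : TangentSpace 𝓘(ℝ, E) q →L[ℝ] ℂ}
    (hη : ∀ j, evalC q η (cvec q (X j q) (Y j q)) = 0) : η ∈ S.holCotangent q := by
  intro Z hZ
  obtain ⟨c, rfl⟩ := h.exists_eq hq hZ
  simp [hη]

/-- Vanishing on the real and imaginary parts of a frame of `V` is a system of `2n` real equations
in a space of covectors of dimension `2n + 1`. -/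
theorem exists_real_holCotangent (S : CRStructure E M n) (p : M) :
    ∃ θ : TangentSpace 𝓘(ℝ, E) p →L[ℝ] ℝ, θ ≠ 0 ∧ toComplex p θ ∈ S.holCotangent p := by
  have := S.finiteDimensional
  obtain ⟨U, X, Y, hp, hF⟩ := S.exists_isFrame p
  let f : (E →L[ℝ] ℝ) →ₗ[ℝ] (Fin n → ℝ) × (Fin n → ℝ) :=
    { toFun := fun η ↦ (fun j ↦ η (X j p), fun j ↦ η (Y j p))
      map_add' := fun _ _ ↦ rfl
      map_smul' := fun _ _ ↦ rfl }
  have hd : Module.finrank ℝ (E →L[ℝ] ℝ) = 2 * n + 1 := by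
    rw [← S.dim_eq, ← (LinearMap.toContinuousLinearMap : (E →ₗ[ℝ] ℝ) ≃ₗ[ℝ] (E →L[ℝ] ℝ)).finrank_eq]
    exact Subspace.dual_finrank_eq
  have hk : LinearMap.ker f ≠ ⊥ := by
    apply LinearMap.ker_ne_bot_of_finrank_lt
    rw [hd, Module.finrank_prod]
    simp; omega
  obtain ⟨η, hη, hη0⟩ := Submodule.exists_mem_ne_zero_of_ne_bot hk
  refine ⟨η, hη0, CRStructure.mem_holCotangent_of_frame hF hp fun j ↦ ?_⟩
  exact (evalC_toComplex_eq_zero p (η := η)).2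
    ⟨congrFun (congrArg Prod.fst hη) j, congrFun (congrArg Prod.snd hη) j⟩

/-- Contact forms exist locally. -/
theorem CRStructure.exists_isContactForm (S : CRStructure E M n) (p : M) :
    ∃ U θ, IsOpen U ∧ p ∈ U ∧ IsContactForm S U θ := by
  have := S.finiteDimensional
  obtain ⟨U, X, Y, hp, hF⟩ := S.exists_isFrame p
  obtain ⟨η₀, hη₀, hηV⟩ := exists_real_holCotangent S p
  obtain ⟨u, hu⟩ : ∃ u, η₀ u ≠ 0 := by
    by_contra! h0
    exact hη₀ (ContinuousLinearMap.ext h0)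
  have hpc := mem_chart_source E p
  set x := extChartAt 𝓘(ℝ, E) p p with hx
  -- The contact form is the solution of a square linear system depending smoothly on the point:
  -- zero on the real and imaginary parts of the frame, and `1` on the fixed vector `u`, which
  -- excludes the zero form.
  let A : E → (E →L[ℝ] ℝ) →L[ℝ] (Fin n → ℝ) × (Fin n → ℝ) × ℝ := fun y ↦
    (ContinuousLinearMap.pi fun j ↦ ContinuousLinearMap.apply ℝ ℝ (fieldRep (X j) p y)).prod
      ((ContinuousLinearMap.pi fun j ↦ ContinuousLinearMap.apply ℝ ℝ (fieldRep (Y j) p y)).prod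
        (ContinuousLinearMap.apply ℝ ℝ (u : E)))
  have hAapp : ∀ y η, A y η = (fun j ↦ η (fieldRep (X j) p y), fun j ↦ η (fieldRep (Y j) p y), η u) :=
    fun y η ↦ rfl
  have hd : Module.finrank ℝ (E →L[ℝ] ℝ) = 2 * n + 1 := by
    rw [← S.dim_eq, ← (LinearMap.toContinuousLinearMap : (E →ₗ[ℝ] ℝ) ≃ₗ[ℝ] (E →L[ℝ] ℝ)).finrank_eq]
    exact Subspace.dual_finrank_eq
  -- A covector killed by the frame is a real `(1,0)`-covector, hence a multiple of `η₀`, and `η₀ u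
  -- ≠ 0`.
  have hAx : Function.Bijective (A x) := by
    have hi : Function.Injective (A x) := by
      rw [injective_iff_map_eq_zero]
      intro η hη
      rw [hAapp] at hη
      simp only [hx, fieldRep_self] at hη
      have h1 : toComplex p η ∈ S.holCotangent p := by
        refine CRStructure.mem_holCotangent_of_frame hF hp fun j ↦ ?_
        exact (evalC_toComplex_eq_zero p (η := η)).2
          ⟨congrFun (congrArg Prod.fst hη) j, congrFun (congrArg (fun z ↦ z.2.1) hη) j⟩
      obtain ⟨c, hc⟩ := S.exists_eq_smul hη₀ hηV h1
      have h2 : η u = 0 := congrArg (fun z ↦ z.2.2) hη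
      have h3 : (c • η₀) u = 0 := by rw [← hc]; exact h2
      rw [smul_apply, smul_eq_mul] at h3
      rcases mul_eq_zero.1 h3 with h4 | h4
      · exact hc.trans (by rw [h4, zero_smul]; rfl)
      · exact absurd h4 hu
    refine ⟨hi, ?_⟩
    refine (LinearMap.injective_iff_surjective_of_finrank_eq_finrank
      (f := (A x : (E →L[ℝ] ℝ) →ₗ[ℝ] (Fin n → ℝ) × (Fin n → ℝ) × ℝ)) ?_).1 hi
    rw [hd]; simp; omega
  have hAs : ∀ q ∈ U ∩ (chartAt E p).source, ContDiffAt ℝ ∞ A (extChartAt 𝓘(ℝ, E) p q) := by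
    intro q hq
    refine contDiffAt_clm_of_apply fun η ↦ ?_
    simp only [hAapp]
    refine ContDiffAt.prodMk (contDiffAt_pi.2 fun j ↦ ?_)
      (ContDiffAt.prodMk (contDiffAt_pi.2 fun j ↦ ?_) contDiffAt_const)
    · exact η.contDiff.contDiffAt.comp _ ((smoothFieldAt_iff hq.2).1 (hF.smooth_re j q hq.1))
    · exact η.contDiff.contDiffAt.comp _ ((smoothFieldAt_iff hq.2).1 (hF.smooth_im j q hq.1))
  have hev : ∀ᶠ q in 𝓝 p, Function.Bijective (A (extChartAt 𝓘(ℝ, E) p q)) ∧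
      q ∈ U ∩ (chartAt E p).source :=
    ((continuousAt_extChartAt (I := 𝓘(ℝ, E)) p).eventually
      (eventually_bijective (hAs p ⟨hp, hpc⟩).continuousAt hAx)).and
      ((hF.isOpen.inter (chartAt E p).open_source).mem_nhds ⟨hp, hpc⟩)
  obtain ⟨U', hU', hU'o, hpU'⟩ := eventually_nhds_iff.1 hev
  let Θ : E → E →L[ℝ] ℝ := fun y ↦ (A y).inverse (0, 0, 1)
  have hΘ : ∀ q ∈ U', A (extChartAt 𝓘(ℝ, E) p q) (Θ (extChartAt 𝓘(ℝ, E) p q)) = (0, 0, 1) :=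
    fun q hq ↦ apply_inverse_apply (hU' q hq).1 _
  have hv : ∀ q ∈ U', ∀ Z : ∀ q : M, TangentSpace 𝓘(ℝ, E) q,
      dAt E E (extChartAt 𝓘(ℝ, E) p) q (Z q) = fieldRep Z p (extChartAt 𝓘(ℝ, E) p q) := by
    intro q hq Z
    rw [fieldRep, (extChartAt 𝓘(ℝ, E) p).left_inv (mem_extChartAt_source' (hU' q hq).2.2)]
  refine ⟨U', fun q ↦ (Θ (extChartAt 𝓘(ℝ, E) p q)).comp (dAt E E (extChartAt 𝓘(ℝ, E) p) q),
    hU'o, hpU', ?_, ?_, ?_⟩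
  · rw [smoothForm_iff hU'o]
    intro q hq
    have h1 : ContDiffAt ℝ ∞ Θ (extChartAt 𝓘(ℝ, E) p q) :=
      (contDiffAt_inverse (hAs q (hU' q hq).2) (hU' q hq).1).clm_apply contDiffAt_const
    have h2 : SmoothFormAt (Θ : OneForm E E ℝ) (extChartAt 𝓘(ℝ, E) p q) :=
      smoothFormAt_model_iff.2 h1
    exact h2.pullAt (contMDiffAt_extChartAt' (hU' q hq).2.2)
  · intro q hq h0
    have h1 : Θ (extChartAt 𝓘(ℝ, E) p q) = 0 := by
      have h2 := dAt_comp_dAt_symm ((extChartAt 𝓘(ℝ, E) p).map_source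
        (mem_extChartAt_source' (hU' q hq).2.2))
      rw [(extChartAt 𝓘(ℝ, E) p).left_inv (mem_extChartAt_source' (hU' q hq).2.2)] at h2
      ext v
      have h3 := DFunLike.congr_fun h2 v
      have h4 : (Θ (extChartAt 𝓘(ℝ, E) p q)) (dAt E E (extChartAt 𝓘(ℝ, E) p) q
        (dAt E E (extChartAt 𝓘(ℝ, E) p).symm (extChartAt 𝓘(ℝ, E) p q) v)) = 0 :=
        DFunLike.congr_fun h0 _
      rw [← ContinuousLinearMap.comp_apply (dAt E E (extChartAt 𝓘(ℝ, E) p) q), h3] at h4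
      exact h4
    have h2 := hΘ q hq
    rw [h1, map_zero] at h2
    simpa using congrArg (fun z ↦ z.2.2) h2
  · intro q hq
    refine CRStructure.mem_holCotangent_of_frame hF (hU' q hq).2.1 fun j ↦ ?_
    rw [evalC_toComplex_eq_zero]
    have h1 := hΘ q hq
    rw [hAapp] at h1
    constructor
    · refine (congrArg _ (hv q hq (X j))).trans ?_
      exact congrFun (congrArg Prod.fst h1) j
    · refine (congrArg _ (hv q hq (Y j))).trans ?_
      exact congrFun (congrArg (fun z ↦ z.2.1) h1) j

end LocalContact

/-! ### Counting negative squares. -/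

section Index

/-- The maximal dimension of a negative subspace of a diagonalized Hermitian form. -/
theorem sSup_finrank_negative {V : Type*} [AddCommGroup V] [Module ℂ V] {ι : Type*} [Fintype ι]
    (P : V → Prop) (q : V → ℝ) (ε : ι → ℝ) (c : V →ₗ[ℂ] (ι → ℂ)) (L : ι → V)
    (hPL : ∀ a : ι → ℂ, P (∑ i, a i • L i)) (hL : ∀ a : ι → ℂ, c (∑ i, a i • L i) = a)
    (hq : ∀ Z, P Z → q Z = ∑ i, ε i * ‖c Z i‖ ^ 2) :
    sSup {d | ∃ W : Submodule ℂ V, Module.finrank ℂ W = d ∧ ∀ Z ∈ W, P Z ∧ (Z ≠ 0 → q Z < 0)} =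
      Nat.card {i // ε i < 0} := by
  classical
  apply IsGreatest.csSup_eq
  constructor
  -- The bound is attained on the span of the vectors `L i` with negative coefficient; `ext` is
  -- extension of coordinates by zero.
  · let ext : ({i // ε i < 0} → ℂ) →ₗ[ℂ] (ι → ℂ) :=
      { toFun := fun a i ↦ if h : ε i < 0 then a ⟨i, h⟩ else 0
        map_add' := fun a b ↦ by ext i; by_cases h : ε i < 0 <;> simp [h]
        map_smul' := fun a b ↦ by ext i; by_cases h : ε i < 0 <;> simp [h] }
    let f : ({i // ε i < 0} → ℂ) →ₗ[ℂ] V := Fintype.linearCombination ℂ L ∘ₗ ext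
    have hf : ∀ a, f a = ∑ i, ext a i • L i := fun a ↦ Fintype.linearCombination_apply ..
    have hcf : ∀ a, c (f a) = ext a := fun a ↦ by rw [hf, hL]
    have hext : Function.Injective ext := by
      intro a b hab
      funext i
      have := congrFun hab i.1
      simpa [ext, i.2] using this
    have hinjf : Function.Injective f := fun a b hab ↦ hext (by rw [← hcf, hab, hcf])
    refine ⟨LinearMap.range f, ?_, ?_⟩
    · rw [LinearMap.finrank_range_of_inj hinjf]
      simp [Nat.card_eq_fintype_card]
    · rintro _ ⟨a, rfl⟩
      have hP : P (f a) := by rw [hf]; exact hPL _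
      refine ⟨hP, fun hne ↦ ?_⟩
      rw [hq _ hP, hcf]
      have hterm : ∀ i, ε i * ‖ext a i‖ ^ 2 ≤ 0 := by
        intro i
        by_cases h : ε i < 0
        · exact mul_nonpos_of_nonpos_of_nonneg h.le (sq_nonneg _)
        · simp [ext, h]
      have hex : ∃ i, a i ≠ 0 := by
        by_contra! h
        exact hne (by rw [show a = 0 from funext h, map_zero])
      obtain ⟨i, hi⟩ := hex
      refine Finset.sum_neg' (fun i _ ↦ hterm i) ⟨i.1, Finset.mem_univ _, ?_⟩
      refine mul_neg_of_neg_of_pos i.2 (pow_pos (norm_pos_iff.2 ?_) 2)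
      simpa [ext, i.2] using hi
  · rintro d ⟨W, rfl, hW⟩
    -- A vector whose negative coordinates all vanish has nonnegative square, so on a negative
    -- subspace the projection to these coordinates is injective.
    let r : W →ₗ[ℂ] ({i // ε i < 0} → ℂ) :=
      (LinearMap.funLeft ℂ ℂ (Subtype.val : {i // ε i < 0} → ι)) ∘ₗ c ∘ₗ W.subtype
    have hr : Function.Injective r := by
      rw [← LinearMap.ker_eq_bot, LinearMap.ker_eq_bot']
      rintro ⟨Z, hZ⟩ h0
      by_contra hne
      have hZ0 : Z ≠ 0 := fun h ↦ hne (Subtype.ext h)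
      have h1 := (hW Z hZ).2 hZ0
      rw [hq Z (hW Z hZ).1] at h1
      refine absurd h1 (not_lt.2 (Finset.sum_nonneg fun i _ ↦ ?_))
      by_cases hi : ε i < 0
      · have : c Z i = 0 := congrFun h0 ⟨i, hi⟩
        rw [this]; simp
      · exact mul_nonneg (not_lt.1 hi) (sq_nonneg _)
    have := LinearMap.finrank_le_finrank_of_injective hr
    simpa [Nat.card_eq_fintype_card] using this

end Index

/-! ### Admissible coframes and their transformation. -/

section Coframes

theorem evalC_zero {E : Type*} [NormedAddCommGroup E] [NormedSpace ℝ E]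
    {M : Type*} [TopologicalSpace M] [ChartedSpace E M] (p : M) (Z : CTangent (E := E) p) :
    evalC p 0 Z = 0 := by
  obtain ⟨v, w, rfl⟩ := exists_cvec p Z
  rw [evalC_cvec]
  simp

variable {E : Type*} [NormedAddCommGroup E] [NormedSpace ℝ E]
  {M : Type*} [TopologicalSpace M] [ChartedSpace E M] [IsManifold 𝓘(ℝ, E) ∞ M] {n : ℕ}
  {S : CRStructure E M n} {U : Set M} {θ : OneForm E M ℝ}

/-- Covectors of type `(1,0)` are determined by their values on the characteristic vector and on
`T^{1,0}`. -/
theorem IsContactForm.holCotangent_ext (hθ : IsContactForm S U θ) {p : M} (hp : p ∈ U)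
    {T : TangentSpace 𝓘(ℝ, E) p} (hT : θ p T = 1) {η ζ : TangentSpace 𝓘(ℝ, E) p →L[ℝ] ℂ}
    (hη : η ∈ S.holCotangent p) (hζ : ζ ∈ S.holCotangent p) (h : ζ T = η T)
    (hH : ∀ Z, S.IsHol p Z → evalC p ζ Z = evalC p η Z) : η = ζ := by
  ext v
  -- After removing its `T` component, `v` is the real part of some `Z` in `V`. The covectors kill
  -- `Z` and agree on its conjugate, hence on the real part.
  have h1 : θ p (v - θ p v • T) = 0 := by simp [hT]
  obtain ⟨w, hw⟩ := hθ.exists_cvec_mem hp h1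
  have h2 := hH (conjT p (cvec p _ w)) (by rwa [CRStructure.IsHol, conjT_conjT])
  have h3 := hη _ hw
  have h4 := hζ _ hw
  rw [conjT_cvec] at h2
  rw [evalC_cvec] at h2 h3 h4
  rw [evalC_cvec] at h2
  simp only [map_sub, map_smul, map_neg, h] at h2 h3 h4
  linear_combination (1 / 2 : ℂ) * (h3 - h4 - h2)

/-- A family of `(1,0)`-covectors dual to a frame of `T^{1,0}` and annihilating the characteristic
vector completes a contact form to a basis of `T'`. -/
theorem coframe_of_dual {ι : Type*} [Fintype ι] [DecidableEq ι] {θα : ι → OneForm E M ℂ}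
    (hθ : IsContactForm S U θ) {p : M} (hp : p ∈ U) {T : TangentSpace 𝓘(ℝ, E) p}
    (hT : IsReebAt θ p T) {L : ι → CTangent (E := E) p} (hL : ∀ α, S.IsHol p (L α))
    (hspan : ∀ Z, S.IsHol p Z → ∃ c : ι → ℂ, Z = ∑ α, c α • L α)
    (hmem : ∀ α, θα α p ∈ S.holCotangent p) (hθT : ∀ α, θα α p T = 0)
    (hdual : ∀ α β, evalC p (θα β p) (L α) = if α = β then 1 else 0) :
    LinearIndependent ℂ (coframeAt θ θα p) ∧
      Submodule.span ℂ (Set.range (coframeAt θ θα p)) = S.holCotangent p := by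
  have hT1 : toComplex p (θ p) T = 1 := by simp [toComplex, hT.1]
  constructor
  · rw [Fintype.linearIndependent_iff]
    intro g hg
    rw [Fintype.sum_option] at hg
    simp only [coframeAt] at hg
    have h0 : g none = 0 := by
      have := DFunLike.congr_fun hg T
      simpa [FunLike.coe_sum, Finset.sum_apply, hθT, hT1] using this
    rintro (_ | α)
    · exact h0
    · have := congrArg (fun η ↦ evalC p η (L α)) hg
      simp only [evalC_sum, evalC_add, evalC_smul, hθ.evalC_hol hp (hL α), hdual, evalC_zero] at this
      simpa using this
  · apply le_antisymm
    · rw [Submodule.span_le]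
      rintro _ ⟨_ | α, rfl⟩
      · exact hθ.annihilates p hp
      · exact hmem α
    · intro η hη
      have key : η = η T • toComplex p (θ p) + ∑ α, evalC p η (L α) • θα α p := by
        set ζ := η T • toComplex p (θ p) + ∑ α, evalC p η (L α) • θα α p with hζ
        have hζmem : ζ ∈ S.holCotangent p :=
          Submodule.add_mem _ (Submodule.smul_mem _ _ (hθ.annihilates p hp))
            (Submodule.sum_mem _ fun α _ ↦ Submodule.smul_mem _ _ (hmem α))
        have hTζ : ζ T = η T := by
          simp [hζ, hθT, hT1]
        have hLζ : ∀ α, evalC p ζ (L α) = evalC p η (L α) := by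
          intro α
          rw [hζ, evalC_add, evalC_smul, hθ.evalC_hol hp (hL α), evalC_sum]
          simp [hdual]
        have hH : ∀ Z, S.IsHol p Z → evalC p ζ Z = evalC p η Z := by
          intro Z hZ
          obtain ⟨c, rfl⟩ := hspan Z hZ
          simp [hLζ]
        exact hθ.holCotangent_ext hp hT.1 hη hζmem hTζ hH
      rw [key]
      refine Submodule.add_mem _ (Submodule.smul_mem _ _ (Submodule.subset_span ⟨none, rfl⟩))
        (Submodule.sum_mem _ fun α _ ↦ Submodule.smul_mem _ _ (Submodule.subset_span ⟨some α, rfl⟩))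

namespace IsAdmissibleCoframe

variable {ι : Type*} {θα : ι → OneForm E M ℂ}

theorem mono (h : IsAdmissibleCoframe S U θ θα) {U' : Set M} (hU : U' ⊆ U) :
    IsAdmissibleCoframe S U' θ θα :=
  ⟨h.contact.mono hU, fun α p hp ↦ (h.smooth α p (hU hp)).mono hU,
    fun p hp ↦ h.linearIndependent p (hU hp), fun p hp ↦ h.span_eq p (hU hp),
    fun p hp ↦ h.reeb p (hU hp)⟩

theorem smoothFormAt (h : IsAdmissibleCoframe S U θ θα) (hU : IsOpen U) {p : M} (hp : p ∈ U)
    (α : ι) : SmoothFormAt (θα α) p := (smoothForm_iff hU).1 (h.smooth α) p hp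

theorem mem_holCotangent (h : IsAdmissibleCoframe S U θ θα) {p : M} (hp : p ∈ U) (α : ι) :
    θα α p ∈ S.holCotangent p := by
  rw [← h.span_eq p hp]
  exact Submodule.subset_span ⟨some α, rfl⟩

theorem mem_V (h : IsAdmissibleCoframe S U θ θα) {p : M} (hp : p ∈ U) {Z : CTangent (E := E) p}
    (h0 : evalC p (toComplex p (θ p)) Z = 0) (h1 : ∀ α, evalC p (θα α p) Z = 0) : Z ∈ S.V p := by
  refine S.mem_V_of_forall_holCotangent fun η hη ↦ ?_
  rw [← h.span_eq p hp] at hη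
  induction hη using Submodule.span_induction with
  | mem x hx =>
    obtain ⟨_ | α, rfl⟩ := hx
    · exact h0
    · exact h1 α
  | zero => exact evalC_zero p Z
  | add x y _ _ hx hy => rw [evalC_add, hx, hy, add_zero]
  | smul a x _ hx => rw [evalC_smul, hx, mul_zero]

theorem eq_zero (h : IsAdmissibleCoframe S U θ θα) {p : M} (hp : p ∈ U) {Z : CTangent (E := E) p}
    (hZ : S.IsHol p Z) (h1 : ∀ α, evalC p (θα α p) Z = 0) : Z = 0 :=
  S.inf_conj p Z (h.mem_V hp (h.contact.evalC_hol hp hZ) h1) hZ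

/-- A real vector killed by the coframe lies in `V` and equals its own conjugate. No separate
hypothesis on the conjugate forms is needed. -/
theorem real_eq_zero (h : IsAdmissibleCoframe S U θ θα) {p : M} (hp : p ∈ U)
    {v : TangentSpace 𝓘(ℝ, E) p} (h0 : θ p v = 0) (h1 : ∀ α, θα α p v = 0) : v = 0 := by
  have hm : cvec p v 0 ∈ S.V p := h.mem_V hp ((evalC_toComplex_eq_zero p).2 ⟨h0, map_zero _⟩)
    fun α ↦ by rw [evalC_cvec, h1 α, map_zero]; simp
  have := S.inf_conj p _ hm (by rw [conjT_cvec, neg_zero]; exact hm)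
  simpa using congrArg (reT p) this

variable [Fintype ι] [DecidableEq ι]

theorem isHol_of_dual (h : IsAdmissibleCoframe S U θ θα) {p : M} (hp : p ∈ U)
    {Z : CTangent (E := E) p} (h0 : evalC p (toComplex p (θ p)) Z = 0)
    (h1 : ∀ α, evalC p (θα α p) (conjT p Z) = 0) : S.IsHol p Z := by
  refine h.mem_V hp ?_ h1
  obtain ⟨v, w, rfl⟩ := exists_cvec p Z
  rw [conjT_cvec, evalC_toComplex_eq_zero]
  rw [evalC_toComplex_eq_zero] at h0
  simpa using h0

theorem eq_sum (h : IsAdmissibleCoframe S U θ θα) {p : M} (hp : p ∈ U) {L : ι → CTangent (E := E) p}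
    (hL : ∀ α, S.IsHol p (L α)) (hdual : ∀ α β, evalC p (θα β p) (L α) = if α = β then 1 else 0)
    {Z : CTangent (E := E) p} (hZ : S.IsHol p Z) : Z = ∑ α, evalC p (θα α p) Z • L α := by
  rw [← sub_eq_zero]
  refine h.eq_zero hp ?_ fun β ↦ ?_
  · rw [CRStructure.IsHol, map_sub, map_sum]
    refine Submodule.sub_mem _ hZ (Submodule.sum_mem _ fun α _ ↦ ?_)
    rw [conjT_smul]
    exact Submodule.smul_mem _ _ (hL α)
  · simp [hdual]

/-- Change of admissible coframe. -/
theorem change {κ : Type*} [Fintype κ] [DecidableEq κ] (h : IsAdmissibleCoframe S U θ θα)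
    (hU : IsOpen U)
    {C : M → Matrix κ ι ℂ} {D : M → Matrix ι κ ℂ}
    (hC : ∀ k i, ∀ q ∈ U, ContMDiffAt 𝓘(ℝ, E) 𝓘(ℝ, ℂ) ∞ (fun q ↦ C q k i) q)
    (hCD : ∀ q ∈ U, C q * D q = 1) (hDC : ∀ q ∈ U, D q * C q = 1) :
    IsAdmissibleCoframe S U θ (fun k q ↦ ∑ i, C q k i • θα i q) := by
  have hinv : ∀ q ∈ U, ∀ i, θα i q = ∑ k, D q i k • ∑ j, C q k j • θα j q := by
    intro q hq i
    have : ∀ j, ∑ k, D q i k * C q k j = if i = j then 1 else 0 := fun j ↦ by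
      rw [← Matrix.mul_apply, hDC q hq, Matrix.one_apply]
    simp only [Finset.smul_sum, smul_smul]
    rw [Finset.sum_comm]
    simp only [← Finset.sum_smul, this]
    simp
  refine ⟨h.contact, fun k ↦ ?_, fun p hp ↦ ?_, fun p hp ↦ ?_, fun p hp T hT k ↦ ?_⟩
  · rw [smoothForm_iff hU]
    intro q hq
    exact SmoothFormAt.sum_smul _ (fun i _ ↦ h.smoothFormAt hU hq i) (fun i _ ↦ hC k i q hq)
  · have hli := h.linearIndependent p hp
    rw [Fintype.linearIndependent_iff] at hli ⊢
    intro g hg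
    rw [Fintype.sum_option] at hg
    simp only [coframeAt] at hg
    have h1 := hli (fun o ↦ o.elim (g none) (fun i ↦ ∑ k, g (some k) * C p k i)) (by
      rw [Fintype.sum_option, ← hg]
      simp only [coframeAt, Option.elim, Finset.smul_sum, smul_smul, Finset.sum_smul]
      rw [Finset.sum_comm])
    have h2 : Matrix.vecMul (fun k ↦ g (some k)) (C p) = 0 := by
      funext i
      exact h1 (some i)
    have h3 : (fun k ↦ g (some k)) = 0 := by
      rw [← Matrix.vecMul_one (fun k ↦ g (some k)), ← hCD p hp, ← Matrix.vecMul_vecMul, h2,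
        Matrix.zero_vecMul]
    rintro (_ | k)
    · exact h1 none
    · exact congrFun h3 k
  · rw [← h.span_eq p hp]
    apply le_antisymm <;> rw [Submodule.span_le]
    · rintro _ ⟨_ | k, rfl⟩
      · exact Submodule.subset_span ⟨none, rfl⟩
      · exact Submodule.sum_mem _ fun i _ ↦
          Submodule.smul_mem _ _ (Submodule.subset_span ⟨some i, rfl⟩)
    · rintro _ ⟨_ | i, rfl⟩
      · exact Submodule.subset_span ⟨none, rfl⟩
      · change θα i p ∈ _
        rw [hinv p hp i]
        exact Submodule.sum_mem _ fun k _ ↦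
          Submodule.smul_mem _ _ (Submodule.subset_span ⟨some k, rfl⟩)
  · simp [h.reeb p hp T hT]

end IsAdmissibleCoframe

/-- The dual frame transforms by the columns of the inverse matrix `D`. The Levi form is linear in
the first slot and antilinear in the second, which is why the transpose stands on the left and the
conjugate on the right. -/
theorem HasLeviMatrixAt.change {ι κ : Type*} [Fintype ι] [DecidableEq ι] [Fintype κ] [DecidableEq κ]
    {θα : ι → OneForm E M ℂ} {p : M} {g : Matrix ι ι ℂ} (h : HasLeviMatrixAt θ θα p g)
    {C : M → Matrix κ ι ℂ} {D : Matrix ι κ ℂ} (hCD : C p * D = 1) :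
    HasLeviMatrixAt θ (fun k q ↦ ∑ i, C q k i • θα i q) p (Dᵀ * g * D.map (starRingEnd ℂ)) := by
  obtain ⟨L, h0, h1, h2, h3⟩ := h
  refine ⟨fun k ↦ ∑ i, D i k • L i, fun k ↦ by simp [h0], fun k k' ↦ ?_, fun k k' ↦ ?_, fun k k' ↦ ?_⟩
  · simp only [evalC_sum, map_sum, map_smul, h1, smul_eq_mul]
    have := congrFun (congrFun hCD k') k
    rw [Matrix.mul_apply, Matrix.one_apply] at this
    simp only [eq_comm (a := k)]
    rw [← this]
    simp only [mul_ite, mul_one, mul_zero, Finset.sum_ite_eq, Finset.mem_univ, if_true]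
    first | rfl | exact Finset.sum_congr rfl fun x _ ↦ mul_comm _ _
  · simp [evalC_sum, map_sum, conjT_smul, h2]
  · rw [leviForm_sum_left]
    simp only [leviForm_sum_right, h3, Matrix.mul_apply, Matrix.transpose_apply, Matrix.map_apply,
      Finset.mul_sum, Finset.sum_mul]
    rw [Finset.sum_comm]
    refine Finset.sum_congr rfl fun i _ ↦ Finset.sum_congr rfl fun j _ ↦ by ring

end Coframes

/-! ### Smooth matrix-valued functions. -/

section SmoothMatrices

variable {E : Type*} [NormedAddCommGroup E] [NormedSpace ℝ E]
  {M : Type*} [TopologicalSpace M] [ChartedSpace E M]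
  {E' : Type*} [NormedAddCommGroup E'] [NormedSpace ℝ E']
  {M' : Type*} [TopologicalSpace M'] [ChartedSpace E' M']

variable (E) in
/-- Smoothness at a point of a complex-valued function on a manifold. -/
def SmoothFunAt (g : M → ℂ) (p : M) : Prop := ContMDiffAt 𝓘(ℝ, E) 𝓘(ℝ, ℂ) ∞ g p

namespace SmoothFunAt

variable {g g' : M → ℂ} {p : M}

theorem const (c : ℂ) : SmoothFunAt E (fun _ : M ↦ c) p := contMDiffAt_const

theorem comp {φ : ℂ → ℂ} (hφ : ContDiffAt ℝ ∞ φ (g p)) (h : SmoothFunAt E g p) :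
    SmoothFunAt E (fun q ↦ φ (g q)) p := ContDiffAt.comp_contMDiffAt (g := φ) hφ h

theorem add (h : SmoothFunAt E g p) (h' : SmoothFunAt E g' p) :
    SmoothFunAt E (fun q ↦ g q + g' q) p := ContMDiffAt.add h h'

theorem neg (h : SmoothFunAt E g p) : SmoothFunAt E (fun q ↦ -g q) p :=
  h.comp contDiff_neg.contDiffAt

theorem mul (h : SmoothFunAt E g p) (h' : SmoothFunAt E g' p) :
    SmoothFunAt E (fun q ↦ g q * g' q) p :=
  ContDiffAt.comp_contMDiffAt (g := fun z : ℂ × ℂ ↦ z.1 * z.2) contDiff_mul.contDiffAt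
    (ContMDiffAt.prodMk_space h h')

theorem inv (h : SmoothFunAt E g p) (h0 : g p ≠ 0) : SmoothFunAt E (fun q ↦ (g q)⁻¹) p :=
  h.comp (contDiffAt_inv ℝ h0)

theorem conj (h : SmoothFunAt E g p) : SmoothFunAt E (fun q ↦ starRingEnd ℂ (g q)) p :=
  h.comp Complex.conjCLE.contDiff.contDiffAt

theorem sum {ι : Type*} {s : Finset ι} {a : ι → M → ℂ} (h : ∀ i ∈ s, SmoothFunAt E (a i) p) :
    SmoothFunAt E (fun q ↦ ∑ i ∈ s, a i q) p := contMDiffAt_finsetSum h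

theorem prod {ι : Type*} {s : Finset ι} {a : ι → M → ℂ} (h : ∀ i ∈ s, SmoothFunAt E (a i) p) :
    SmoothFunAt E (fun q ↦ ∏ i ∈ s, a i q) p := by
  classical
  induction s using Finset.induction_on with
  | empty => simpa using const 1
  | insert i s hi ih =>
    simp only [Finset.prod_insert hi]
    exact (h i (Finset.mem_insert_self _ _)).mul (ih fun j hj ↦ h j (Finset.mem_insert_of_mem hj))

theorem comp_map {u : M' → ℂ} {f : M → M'} (hu : SmoothFunAt E' u (f p))
    (hf : ContMDiffAt 𝓘(ℝ, E) 𝓘(ℝ, E') ∞ f p) : SmoothFunAt E (fun q ↦ u (f q)) p :=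
  ContMDiffAt.comp p hu hf

theorem congr (h : SmoothFunAt E g p) (h' : ∀ᶠ q in 𝓝 p, g' q = g q) : SmoothFunAt E g' p :=
  ContMDiffAt.congr_of_eventuallyEq h h'

end SmoothFunAt

variable (E) in
/-- Smoothness at a point of a matrix-valued function. -/
def SmoothMatAt {ι κ : Type*} (A : M → Matrix ι κ ℂ) (p : M) : Prop :=
  ∀ i j, SmoothFunAt E (fun q ↦ A q i j) p

namespace SmoothMatAt

variable {ι κ μ ν : Type*} {p : M}

theorem const (A : Matrix ι κ ℂ) : SmoothMatAt E (fun _ : M ↦ A) p := fun _ _ ↦ .const _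

theorem add {A B : M → Matrix ι κ ℂ} (hA : SmoothMatAt E A p) (hB : SmoothMatAt E B p) :
    SmoothMatAt E (fun q ↦ A q + B q) p := fun i j ↦ (hA i j).add (hB i j)

theorem neg {A : M → Matrix ι κ ℂ} (hA : SmoothMatAt E A p) :
    SmoothMatAt E (fun q ↦ -A q) p := fun i j ↦ (hA i j).neg

theorem mul [Fintype κ] {A : M → Matrix ι κ ℂ} {B : M → Matrix κ μ ℂ} (hA : SmoothMatAt E A p)
    (hB : SmoothMatAt E B p) : SmoothMatAt E (fun q ↦ A q * B q) p := fun i j ↦ by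
  simp only [Matrix.mul_apply]
  exact .sum fun k _ ↦ (hA i k).mul (hB k j)

theorem transpose {A : M → Matrix ι κ ℂ} (hA : SmoothMatAt E A p) :
    SmoothMatAt E (fun q ↦ (A q)ᵀ) p := fun i j ↦ hA j i

theorem conj {A : M → Matrix ι κ ℂ} (hA : SmoothMatAt E A p) :
    SmoothMatAt E (fun q ↦ (A q).map (starRingEnd ℂ)) p := fun i j ↦ (hA i j).conj

theorem comp_map {A : M' → Matrix ι κ ℂ} {f : M → M'} (hA : SmoothMatAt E' A (f p))
    (hf : ContMDiffAt 𝓘(ℝ, E) 𝓘(ℝ, E') ∞ f p) : SmoothMatAt E (fun q ↦ A (f q)) p :=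
  fun i j ↦ (hA i j).comp_map hf

theorem submatrix {A : M → Matrix ι κ ℂ} (hA : SmoothMatAt E A p) (r : μ → ι) (c : ν → κ) :
    SmoothMatAt E (fun q ↦ (A q).submatrix r c) p := fun i j ↦ hA (r i) (c j)

theorem fromBlocks {A : M → Matrix ι κ ℂ} {B : M → Matrix ι ν ℂ} {C : M → Matrix μ κ ℂ}
    {D : M → Matrix μ ν ℂ} (hA : SmoothMatAt E A p) (hB : SmoothMatAt E B p)
    (hC : SmoothMatAt E C p) (hD : SmoothMatAt E D p) :
    SmoothMatAt E (fun q ↦ Matrix.fromBlocks (A q) (B q) (C q) (D q)) p := by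
  rintro (i | i) (j | j)
  exacts [hA i j, hB i j, hC i j, hD i j]

theorem fromCols {A : M → Matrix ι κ ℂ} {B : M → Matrix ι ν ℂ} (hA : SmoothMatAt E A p)
    (hB : SmoothMatAt E B p) : SmoothMatAt E (fun q ↦ Matrix.fromCols (A q) (B q)) p := by
  rintro i (j | j)
  exacts [hA i j, hB i j]

variable [Fintype ι] [DecidableEq ι]

theorem det {A : M → Matrix ι ι ℂ} (hA : SmoothMatAt E A p) :
    SmoothFunAt E (fun q ↦ (A q).det) p := by
  simp only [Matrix.det_apply']
  exact .sum fun σ _ ↦ (SmoothFunAt.const _).mul (.prod fun i _ ↦ hA _ _)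

theorem continuousAt_det {A : M → Matrix ι ι ℂ} (hA : SmoothMatAt E A p) :
    ContinuousAt (fun q ↦ (A q).det) p := ContMDiffAt.continuousAt hA.det

theorem eventually_isUnit {A : M → Matrix ι ι ℂ} (hA : SmoothMatAt E A p) (h : IsUnit (A p)) :
    ∀ᶠ q in 𝓝 p, IsUnit (A q) := by
  simp only [Matrix.isUnit_iff_isUnit_det, isUnit_iff_ne_zero] at h ⊢
  exact hA.continuousAt_det.eventually_ne h

theorem inv {A : M → Matrix ι ι ℂ} (hA : SmoothMatAt E A p) (h : IsUnit (A p)) :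
    SmoothMatAt E (fun q ↦ (A q)⁻¹) p := by
  intro i j
  rw [Matrix.isUnit_iff_isUnit_det, isUnit_iff_ne_zero] at h
  simp only [Matrix.inv_def, Matrix.smul_apply, Ring.inverse_eq_inv', smul_eq_mul,
    Matrix.adjugate_apply]
  refine (hA.det.inv h).mul (det fun k l ↦ ?_)
  by_cases hk : k = j
  · subst hk
    simpa using SmoothFunAt.const _
  · simpa [Matrix.updateRow_apply, hk] using hA k l

end SmoothMatAt

end SmoothMatrices

theorem isUnit_of_mulVec_eq_zero {ι : Type*} [Fintype ι] [DecidableEq ι] {A : Matrix ι ι ℂ}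
    (h : ∀ v, A *ᵥ v = 0 → v = 0) : IsUnit A :=
  Matrix.mulVec_injective_iff_isUnit.1 fun v w hvw ↦
    sub_eq_zero.1 (h _ (by rw [Matrix.mulVec_sub, sub_eq_zero]; exact hvw))

/-! ### Local existence of admissible coframes. -/

section NiceCoframe

variable {E : Type*} [NormedAddCommGroup E] [NormedSpace ℝ E]
  {M : Type*} [TopologicalSpace M] [ChartedSpace E M] [IsManifold 𝓘(ℝ, E) ∞ M] {n : ℕ}
  {S : CRStructure E M n} {U : Set M} {θ : OneForm E M ℝ}

namespace CRStructure.IsFrame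
variable {U₀ : Set M} {X Y : Fin n → ∀ q : M, TangentSpace 𝓘(ℝ, E) q}

theorem isHol (h : S.IsFrame U₀ X Y) {q : M} (hq : q ∈ U₀) (j : Fin n) :
    S.IsHol q (cvec q (X j q) (-Y j q)) := by
  rw [CRStructure.IsHol, conjT_cvec, neg_neg]
  exact h.mem hq j

theorem exists_eq_of_isHol (h : S.IsFrame U₀ X Y) {q : M} (hq : q ∈ U₀) {Z : CTangent (E := E) q}
    (hZ : S.IsHol q Z) : ∃ c : Fin n → ℂ, Z = ∑ j, c j • cvec q (X j q) (-Y j q) := by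
  obtain ⟨c, hc⟩ := h.exists_eq hq hZ
  refine ⟨fun j ↦ starRingEnd ℂ (c j), ?_⟩
  rw [← conjT_conjT q Z, hc, map_sum]
  exact Finset.sum_congr rfl fun j _ ↦ by rw [conjT_smul, conjT_cvec]

theorem eq_zero_of_sum_eq_zero (h : S.IsFrame U₀ X Y) {q : M} (hq : q ∈ U₀) {c : Fin n → ℂ}
    (hc : ∑ j, c j • cvec q (X j q) (-Y j q) = 0) : c = 0 := by
  have h1 := congrArg (conjT q) hc
  simp only [map_sum, conjT_smul, conjT_cvec, neg_neg, map_zero] at h1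
  funext j
  have := Fintype.linearIndependent_iff.1 (h.linearIndependent hq) _ h1 j
  simpa using this

theorem smoothFunAt_evalC (h : S.IsFrame U₀ X Y) {q : M} (hq : q ∈ U₀) {φ : OneForm E M ℂ}
    (hφ : SmoothFormAt φ q) (j : Fin n) :
    SmoothFunAt E (fun q ↦ evalC q (φ q) (cvec q (X j q) (-Y j q))) q := by
  have h1 : SmoothFunAt E (fun q ↦ φ q (X j q)) q := contMDiffAt_covAt_apply hφ (h.smooth_re j q hq)
  have h2 : SmoothFunAt E (fun q ↦ φ q (Y j q)) q := contMDiffAt_covAt_apply hφ (h.smooth_im j q hq)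
  refine (h1.add ((SmoothFunAt.const (-Complex.I)).mul h2)).congr (Eventually.of_forall fun q ↦ ?_)
  rw [evalC_cvec, map_neg]; ring

end CRStructure.IsFrame

/-- The `(1,0)`-form `Z ↦ -i dθ(Z, X + iY)`. -/
def leviDual (θ : OneForm E M ℝ) (X Y : ∀ q : M, TangentSpace 𝓘(ℝ, E) q) : OneForm E M ℂ :=
  fun q ↦ toComplex q (contrD θ Y q) + (-Complex.I) • toComplex q (contrD θ X q)

theorem leviDual_apply (θ : OneForm E M ℝ) (X Y : ∀ q : M, TangentSpace 𝓘(ℝ, E) q) (q : M)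
    (v : TangentSpace 𝓘(ℝ, E) q) :
    leviDual θ X Y q v = (extD θ q v (Y q) : ℂ) - Complex.I * (extD θ q v (X q) : ℂ) := by
  have h1 : contrD θ Y q v = extD θ q v (Y q) := rfl
  have h2 : contrD θ X q v = extD θ q v (X q) := rfl
  simp [leviDual, toComplex, h1, h2, sub_eq_add_neg]

theorem evalC_leviDual (θ : OneForm E M ℝ) (X Y : ∀ q : M, TangentSpace 𝓘(ℝ, E) q) (q : M)
    (Z : CTangent (E := E) q) :
    evalC q (leviDual θ X Y q) Z = -Complex.I * extDC θ q Z (cvec q (X q) (Y q)) := by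
  obtain ⟨v, w, rfl⟩ := exists_cvec q Z
  rw [evalC_cvec, leviDual_apply, leviDual_apply, extDC_cvec]
  push_cast
  linear_combination (extD θ q v (Y q) : ℂ) * Complex.I_sq

theorem smoothFormAt_leviDual {X Y : ∀ q : M, TangentSpace 𝓘(ℝ, E) q} {p : M}
    (hθ : ∀ᶠ q in 𝓝 p, SmoothFormAt θ q) (hX : SmoothFieldAt X p) (hY : SmoothFieldAt Y p) :
    SmoothFormAt (leviDual θ X Y) p :=
  (smoothFormAt_contrD hθ hY).toComplex.add
    ((smoothFormAt_contrD hθ hX).toComplex.smul contMDiffAt_const)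

/-- Every contact form of a Levi-nondegenerate CR manifold is locally part of an admissible
coframe with smooth Levi matrix. -/
theorem IsContactForm.exists_coframe (hθ : IsContactForm S U θ) (hU : IsOpen U)
    (hS : S.LeviNondegenerate) {p : M} (hp : p ∈ U) :
    ∃ (W : Set M) (φ : Fin n → OneForm E M ℂ) (G : M → Matrix (Fin n) (Fin n) ℂ),
      IsOpen W ∧ p ∈ W ∧ W ⊆ U ∧ IsAdmissibleCoframe S W θ φ ∧ (∀ q ∈ W, SmoothMatAt E G q) ∧
      ∀ q ∈ W, HasLeviMatrixAt θ φ q (G q) := by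
  obtain ⟨U₀, X, Y, hp₀, hF⟩ := S.exists_isFrame p
  let L : ∀ (j : Fin n) (q : M), CTangent (E := E) q := fun j q ↦ cvec q (X j q) (-Y j q)
  -- Contracting `dθ` with the frame of `V` yields forms that satisfy all constraints automatically:
  -- they annihilate `V` by involutivity and kill the characteristic vector, which is in the kernel
  -- of `dθ`.
  let ψ : Fin n → OneForm E M ℂ := fun j ↦ leviDual θ (X j) (Y j)
  let G : M → Matrix (Fin n) (Fin n) ℂ := fun q i j ↦ evalC q (ψ j q) (L i q)
  -- The entries `G q i j = ψ j (L i)` form the Levi matrix of the frame `L`, invertible by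
  -- nondegeneracy. The inverse transpose makes the forms dual to `L`, so that `G` is also the Levi
  -- matrix of the new coframe.
  let A : M → Matrix (Fin n) (Fin n) ℂ := fun q ↦ ((G q)ᵀ)⁻¹
  have hWo : IsOpen (U ∩ U₀) := hU.inter hF.isOpen
  have hψ : ∀ j, ∀ q ∈ U ∩ U₀, SmoothFormAt (ψ j) q := fun j q hq ↦
    smoothFormAt_leviDual (Filter.Eventually.mono (hU.mem_nhds hq.1) fun y hy ↦ hθ.smoothFormAt hU hy)
      (hF.smooth_re j q hq.2) (hF.smooth_im j q hq.2)
  have hGs : ∀ q ∈ U ∩ U₀, SmoothMatAt E G q := fun q hq i j ↦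
    hF.smoothFunAt_evalC hq.2 (hψ j q hq) i
  have hψL : ∀ q Z j, evalC q (ψ j q) Z = leviForm θ q Z (L j q) := fun q Z j ↦ by
    rw [evalC_leviDual, leviForm, conjT_cvec, neg_neg]
  have hGu : ∀ q ∈ U ∩ U₀, IsUnit (G q)ᵀ := by
    intro q hq
    refine isUnit_of_mulVec_eq_zero fun c hc ↦ hF.eq_zero_of_sum_eq_zero hq.2 ?_
    have hol : S.IsHol q (∑ i, c i • L i q) := by
      rw [CRStructure.IsHol, map_sum]
      refine Submodule.sum_mem _ fun i _ ↦ ?_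
      rw [conjT_smul]
      exact Submodule.smul_mem _ _ (hF.isHol hq.2 i)
    refine hS q U θ hU hq.1 hθ _ hol fun Z hZ ↦ ?_
    obtain ⟨d, rfl⟩ := hF.exists_eq_of_isHol hq.2 hZ
    rw [leviForm_sum_right]
    refine Finset.sum_eq_zero fun j _ ↦ ?_
    rw [leviForm_sum_left]
    have := congrFun hc j
    simp only [Matrix.mulVec, dotProduct, Matrix.transpose_apply, Pi.zero_apply] at this
    rw [← mul_zero (starRingEnd ℂ (d j)), ← this]
    congr 1
    refine Finset.sum_congr rfl fun i _ ↦ ?_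
    rw [mul_comm, ← hψL]
  let φ : Fin n → OneForm E M ℂ := fun k q ↦ ∑ j, A q k j • ψ j q
  have hφ : ∀ k, ∀ q ∈ U ∩ U₀, SmoothFormAt (φ k) q := fun k q hq ↦
    SmoothFormAt.sum_smul _ (fun j _ ↦ hψ j q hq)
      (fun j _ ↦ ((hGs q hq).transpose.inv (hGu q hq)) k j)
  have hLhol : ∀ q ∈ U ∩ U₀, ∀ j, S.IsHol q (L j q) := fun q hq j ↦ hF.isHol hq.2 j
  have hdual : ∀ q ∈ U ∩ U₀, ∀ i k, evalC q (φ k q) (L i q) = if i = k then 1 else 0 := by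
    intro q hq i k
    have h1 : A q * (G q)ᵀ = 1 :=
      Matrix.nonsing_inv_mul _ ((Matrix.isUnit_iff_isUnit_det _).1 (hGu q hq))
    have h2 := congrFun (congrFun h1 k) i
    rw [Matrix.mul_apply, Matrix.one_apply] at h2
    simp only [eq_comm (a := i)]
    rw [← h2, evalC_sum]
    rfl
  have hmem : ∀ q ∈ U ∩ U₀, ∀ k, φ k q ∈ S.holCotangent q := by
    refine fun q hq k ↦ Submodule.sum_mem _ fun j _ ↦ Submodule.smul_mem _ _ fun Z hZ ↦ ?_
    rw [evalC_leviDual, hθ.extDC_eq_zero hU hq.1 hZ (hF.mem hq.2 j), mul_zero]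
  have hreeb : ∀ q ∈ U ∩ U₀, ∀ T, IsReebAt θ q T → ∀ k, φ k q T = 0 := by
    intro q hq T hT k
    have : ∀ j, ψ j q T = 0 := fun j ↦ by
      rw [leviDual_apply, hT.2, hT.2]; simp
    simp [φ, this]
  have hb : ∀ q ∈ U ∩ U₀, LinearIndependent ℂ (coframeAt θ φ q) ∧
      Submodule.span ℂ (Set.range (coframeAt θ φ q)) = S.holCotangent q := by
    intro q hq
    obtain ⟨T, hT⟩ := hθ.exists_isReebAt hU hS hq.1
    exact coframe_of_dual hθ hq.1 hT (hLhol q hq) (fun Z hZ ↦ hF.exists_eq_of_isHol hq.2 hZ)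
      (hmem q hq) (hreeb q hq T hT) (hdual q hq)
  refine ⟨U ∩ U₀, φ, G, hWo, ⟨hp, hp₀⟩, Set.inter_subset_left,
    ⟨hθ.mono Set.inter_subset_left, fun k ↦ (smoothForm_iff hWo).2 (hφ k),
      fun q hq ↦ (hb q hq).1, fun q hq ↦ (hb q hq).2, hreeb⟩, hGs, fun q hq ↦
    ⟨fun j ↦ L j q, fun j ↦ hθ.evalC_hol hq.1 (hLhol q hq j), hdual q hq, fun i k ↦
      hmem q hq k _ (hLhol q hq i), fun i j ↦ ?_⟩⟩
  rw [← hψL]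

end NiceCoframe

/-! ### Local inverses and square roots. -/

section InverseFunction

variable {V W : Type*} [NormedAddCommGroup V] [NormedSpace ℝ V] [NormedAddCommGroup W]
  [NormedSpace ℝ W]

/-- The inverse function theorem, with smoothness in a neighborhood. -/
theorem exists_smooth_local_inverse [FiniteDimensional ℝ V] {f : V → W} {a : V}
    (hf : ∀ᶠ x in 𝓝 a, ContDiffAt ℝ ∞ f x) (hb : Function.Bijective (fderiv ℝ f a)) :
    ∃ s : W → V, s (f a) = a ∧ (∀ᶠ y in 𝓝 (f a), ContDiffAt ℝ ∞ s y ∧ f (s y) = y) ∧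
      ∀ᶠ x in 𝓝 a, s (f x) = x := by
  have : CompleteSpace V := FiniteDimensional.complete ℝ V
  obtain ⟨e, he⟩ := exists_continuousLinearEquiv_of_bijective hb
  have hfa := hf.self_of_nhds
  have hd : HasFDerivAt f (e : V →L[ℝ] W) a := by
    rw [he]; exact (hfa.differentiableAt (by norm_num)).hasFDerivAt
  have hn : (∞ : ℕ∞ω) ≠ 0 := by norm_num
  let Φ := hfa.toOpenPartialHomeomorph f hd hn
  have ha : a ∈ Φ.source := hfa.mem_toOpenPartialHomeomorph_source hd hn
  have hΦ : ∀ x, Φ x = f x := fun x ↦ rfl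
  have hfat : f a ∈ Φ.target := Φ.map_source ha
  have hsa : Φ.symm (f a) = a := Φ.left_inv ha
  have hcont : Tendsto Φ.symm (𝓝 (f a)) (𝓝 a) := by
    have := Φ.continuousAt_symm hfat
    rwa [ContinuousAt, hsa] at this
  have hfd : ContinuousAt (fderiv ℝ f) a := (hfa.fderiv_right (m := 0) (by norm_num)).continuousAt
  refine ⟨Φ.symm, hsa, ?_, ?_⟩
  · filter_upwards [Φ.open_target.mem_nhds hfat, hcont.eventually hf,
      hcont.eventually (eventually_bijective hfd hb)] with y hy h1 h2
    obtain ⟨e', he'⟩ := exists_continuousLinearEquiv_of_bijective h2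
    refine ⟨Φ.contDiffAt_symm (f₀' := e') hy ?_ h1, Φ.right_inv hy⟩
    rw [he']
    exact (h1.differentiableAt (by norm_num)).hasFDerivAt
  · filter_upwards [Φ.open_source.mem_nhds ha] with x hx
    exact Φ.left_inv hx

/-- A smooth square root near `1` in a finite-dimensional algebra. -/
theorem exists_smooth_sqrt (A : Type*) [NormedRing A] [NormedAlgebra ℝ A] [FiniteDimensional ℝ A] :
    ∃ s : A → A, s 1 = 1 ∧ (∀ᶠ a in 𝓝 1, ContDiffAt ℝ ∞ s a ∧ s a * s a = a) ∧
      ∀ᶠ x in 𝓝 1, s (x * x) = x := by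
  have hc : ContDiff ℝ ∞ fun x : A ↦ x * x := contDiff_id.mul contDiff_id
  have hd : fderiv ℝ (fun x : A ↦ x * x) 1 = (2 : ℝ) • ContinuousLinearMap.id ℝ A := by
    have := ((hasFDerivAt_id (𝕜 := ℝ) (1 : A)).mul' (hasFDerivAt_id (𝕜 := ℝ) (1 : A))).fderiv
    refine this.trans ?_
    ext v
    simp [two_smul]
  have hb : Function.Bijective (fderiv ℝ (fun x : A ↦ x * x) 1) := by
    rw [hd]
    constructor
    · intro v w h
      simpa using h
    · intro v
      exact ⟨(2⁻¹ : ℝ) • v, by simp [smul_smul]⟩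
  obtain ⟨s, h1, h2, h3⟩ := exists_smooth_local_inverse (Eventually.of_forall fun x ↦ hc.contDiffAt) hb
  simp only [mul_one] at h1 h2
  exact ⟨s, h1, h2, h3⟩

end InverseFunction

/-! ### Smooth congruence of nearby Hermitian matrices. -/

section Normalize

variable {E : Type*} [NormedAddCommGroup E] [NormedSpace ℝ E]
  {M : Type*} [TopologicalSpace M] [ChartedSpace E M] {ι : Type*} [Fintype ι] [DecidableEq ι]

/-- Take `R` to be the square root near `1` of `B = H⁻¹ D`. The anti-automorphism `X ↦ D Xᴴ D` fixes
`B`, hence by local uniqueness also `R`; thus `Rᴴ = D R D`, and `Rᴴ H R · R = D R D H B = D R` gives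
the congruence after cancelling `R`. Where `H = D`, both `B` and `R` are `1`. The algebra `A` is a
normed copy of the matrix algebra, in which the calculus takes place. -/
theorem exists_smooth_congruence_aux {A : Type*} [NormedRing A] [NormedAlgebra ℝ A]
    [FiniteDimensional ℝ A] (Φ : Matrix ι ι ℂ ≃ₐ[ℝ] A)
    {D : Matrix ι ι ℂ} (hD : Dᴴ = D) (hDD : D * D = 1)
    {H : M → Matrix ι ι ℂ} {p : M} (hH : ∀ᶠ q in 𝓝 p, SmoothMatAt E H q)
    (hherm : ∀ᶠ q in 𝓝 p, (H q)ᴴ = H q) (hp : H p = D) :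
    ∃ R : M → Matrix ι ι ℂ, (∀ᶠ q in 𝓝 p, SmoothMatAt E R q ∧ (R q)ᴴ * H q * R q = D) ∧
      ∀ q, H q = D → R q = 1 := by
  obtain ⟨s, hs1, hs2, hs3⟩ := exists_smooth_sqrt A
  have hDu : IsUnit D := IsUnit.of_mul_eq_one D hDD
  let B : M → Matrix ι ι ℂ := fun q ↦ (H q)⁻¹ * D
  have hBD : ∀ q, H q = D → B q = 1 := fun q hq ↦ by
    simp only [B, hq]
    exact Matrix.nonsing_inv_mul _ ((Matrix.isUnit_iff_isUnit_det _).1 hDu)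
  have hunit : ∀ᶠ q in 𝓝 p, IsUnit (H q) := hH.self_of_nhds.eventually_isUnit (by rwa [hp])
  have hBs : ∀ᶠ q in 𝓝 p, SmoothMatAt E B q := by
    filter_upwards [hH, hunit] with q h1 h2
    exact (h1.inv h2).mul (.const _)
  have hBm : ∀ᶠ q in 𝓝 p, ContMDiffAt 𝓘(ℝ, E) 𝓘(ℝ, A) ∞ (fun q ↦ Φ (B q)) q := by
    filter_upwards [hBs] with q hq
    let ℓ : ι → ι → ℂ →ₗ[ℝ] A := fun i j ↦ Φ.toLinearMap ∘ₗ
      { toFun := fun z ↦ z • Matrix.single i j (1 : ℂ)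
        map_add' := fun a b ↦ add_smul _ _ _
        map_smul' := fun a b ↦ by simp }
    have : (fun q ↦ Φ (B q)) = fun q ↦ ∑ i, ∑ j, ℓ i j (B q i j) := by
      funext q
      conv_lhs => rw [Matrix.matrix_eq_sum_single (B q)]
      simp [ℓ, Matrix.smul_single]
    rw [this]
    exact contMDiffAt_finsetSum fun i _ ↦ contMDiffAt_finsetSum fun j _ ↦
      ContDiffAt.comp_contMDiffAt (g := (ℓ i j).toContinuousLinearMap)
      (ℓ i j).toContinuousLinearMap.contDiff.contDiffAt (hq i j)
  have hBt : Tendsto (fun q ↦ Φ (B q)) (𝓝 p) (𝓝 1) := by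
    have := hBm.self_of_nhds.continuousAt
    rwa [ContinuousAt, hBD p hp, map_one] at this
  let τ : Matrix ι ι ℂ →ₗ[ℝ] Matrix ι ι ℂ :=
    { toFun := fun X ↦ D * Xᴴ * D
      map_add' := fun X Y ↦ by simp [mul_add, add_mul]
      map_smul' := fun c X ↦ by simp [Matrix.conjTranspose_smul] }
  have hτ : ∀ X, τ X = D * Xᴴ * D := fun _ ↦ rfl
  have hτ1 : τ 1 = 1 := by rw [hτ, Matrix.conjTranspose_one, mul_one, hDD]
  have hτmul : ∀ X Y, τ (X * Y) = τ Y * τ X := fun X Y ↦ by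
    simp only [hτ, Matrix.conjTranspose_mul]
    calc D * (Yᴴ * Xᴴ) * D = D * Yᴴ * (1 : Matrix ι ι ℂ) * Xᴴ * D := by simp [mul_assoc]
      _ = _ := by rw [← hDD]; simp only [mul_assoc]
  let τ' : A →ₗ[ℝ] A := Φ.toLinearMap ∘ₗ τ ∘ₗ Φ.symm.toLinearMap
  have hτ' : ∀ X, τ' (Φ X) = Φ (τ X) := fun X ↦ by simp [τ']
  have hst : Tendsto (fun a ↦ τ' (s a)) (𝓝 1) (𝓝 1) := by
    have h1 : ContinuousAt s 1 := hs2.self_of_nhds.1.continuousAt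
    have h2 : Continuous τ' := τ'.continuous_of_finiteDimensional
    have := h2.continuousAt.comp h1
    rwa [ContinuousAt, Function.comp_apply, hs1, ← map_one Φ, hτ', hτ1, map_one] at this
  refine ⟨fun q ↦ Φ.symm (s (Φ (B q))), ?_, fun q hq ↦ by
    simp only [hBD q hq, map_one, hs1]⟩
  filter_upwards [hBm, hBt.eventually hs2, hBt.eventually (hst.eventually hs3), hunit, hherm]
    with q h1 h2 h3 h4 h5
  constructor
  · intro i j
    let ℓ : A →ₗ[ℝ] ℂ :=
      { toFun := fun X ↦ X i j, map_add' := fun _ _ ↦ rfl, map_smul' := fun _ _ ↦ rfl } ∘ₗ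
        Φ.symm.toLinearMap
    have h6 : ContMDiffAt 𝓘(ℝ, E) 𝓘(ℝ, A) ∞ (fun q ↦ s (Φ (B q))) q :=
      ContDiffAt.comp_contMDiffAt h2.1 h1
    exact ContDiffAt.comp_contMDiffAt (g := ℓ.toContinuousLinearMap)
      ℓ.toContinuousLinearMap.contDiff.contDiffAt h6
  · have hu := (Matrix.isUnit_iff_isUnit_det _).1 h4
    have hHB : H q * B q = D := by
      simp only [B]; rw [← mul_assoc, Matrix.mul_nonsing_inv _ hu, one_mul]
    have hτB : τ (B q) = B q := by
      rw [hτ]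
      simp only [B, Matrix.conjTranspose_mul, Matrix.conjTranspose_nonsing_inv, h5, hD]
      rw [← mul_assoc, hDD, one_mul]
    obtain ⟨R, hR⟩ := Φ.surjective (s (Φ (B q)))
    simp only [← hR, AlgEquiv.symm_apply_apply, ← map_mul, hτ'] at h2 h3 ⊢
    have hRR : R * R = B q := Φ.injective h2.2
    -- Since `τ R` is close to `1` and its square is `τ B = B`, it is the same local square root.
    have hτs : τ R = R := by
      rw [← hτmul, hRR, hτB, ← hR] at h3
      exact (Φ.injective h3).symm
    have hRu : IsUnit R := by
      have : IsUnit (R * R) := by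
        rw [hRR]; exact (IsUnit.mul ((Matrix.isUnit_nonsing_inv_iff).2 h4) hDu)
      rw [Matrix.isUnit_iff_isUnit_det, Matrix.det_mul] at this
      rw [Matrix.isUnit_iff_isUnit_det]
      exact isUnit_of_mul_isUnit_left this
    have hRh : Rᴴ = D * R * D := by
      rw [hτ] at hτs
      calc Rᴴ = (D * D) * Rᴴ * (D * D) := by rw [hDD, one_mul, mul_one]
        _ = D * (D * Rᴴ * D) * D := by simp only [mul_assoc]
        _ = D * R * D := by rw [hτs]
    have hfin : (Rᴴ * H q * R) * R = D * R := by
      rw [mul_assoc, hRR, mul_assoc, hHB, hRh, mul_assoc, hDD, mul_one]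
    exact hRu.mul_right_cancel hfin

/-- A smooth family of Hermitian matrices close to a matrix `D` with `D² = 1` is smoothly congruent
to `D`, by a congruence which is trivial where the matrix is equal to `D`. -/
theorem exists_smooth_congruence {D : Matrix ι ι ℂ} (hD : Dᴴ = D) (hDD : D * D = 1)
    {H : M → Matrix ι ι ℂ} {p : M} (hH : ∀ᶠ q in 𝓝 p, SmoothMatAt E H q)
    (hherm : ∀ᶠ q in 𝓝 p, (H q)ᴴ = H q) (hp : H p = D) :
    ∃ R : M → Matrix ι ι ℂ, (∀ᶠ q in 𝓝 p, SmoothMatAt E R q ∧ (R q)ᴴ * H q * R q = D) ∧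
      ∀ q, H q = D → R q = 1 := by
  let : NormedRing (Matrix ι ι ℂ) := Matrix.linftyOpNormedRing
  let : NormedAlgebra ℝ (Matrix ι ι ℂ) := Matrix.linftyOpNormedAlgebra
  exact exists_smooth_congruence_aux (AlgEquiv.refl : Matrix ι ι ℂ ≃ₐ[ℝ] Matrix ι ι ℂ) hD hDD hH
    hherm hp

end Normalize

/-! ### Sylvester's law, completion of matrices and block isometries. -/

section LinearAlgebra

/-- Sylvester's law: a nondegenerate Hermitian matrix is congruent to `diag(-1, …, -1, 1, …, 1)`. -/
theorem exists_congruence_signs {m : ℕ} {H : Matrix (Fin m) (Fin m) ℂ} (hH : Hᴴ = H)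
    (hu : IsUnit H) : ∃ j ≤ m, ∃ K, Kᴴ * H * K = Matrix.diagonal (signs m j) := by
  classical
  have hH' : H.IsHermitian := hH
  let lam := hH'.eigenvalues
  let Q : Matrix (Fin m) (Fin m) ℂ := hH'.eigenvectorUnitary
  have hQ : Qᴴ * H * Q = Matrix.diagonal fun i ↦ (lam i : ℂ) := by
    have h1 : Qᴴ * Q = 1 := Matrix.mem_unitaryGroup_iff'.1 hH'.eigenvectorUnitary.2
    have h2 : H = Q * Matrix.diagonal (fun i ↦ (lam i : ℂ)) * Qᴴ := by
      conv_lhs => rw [hH'.spectral_theorem]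
      rw [Unitary.conjStarAlgAut_apply]
      rfl
    calc Qᴴ * H * Q = (Qᴴ * Q) * Matrix.diagonal (fun i ↦ (lam i : ℂ)) * (Qᴴ * Q) := by
          conv_lhs => rw [h2]
          simp only [Matrix.mul_assoc]
      _ = _ := by rw [h1, one_mul, mul_one]
  have hQu : IsUnit Q.det := by
    have h1 : Qᴴ * Q = 1 := Matrix.mem_unitaryGroup_iff'.1 hH'.eigenvectorUnitary.2
    exact Matrix.isUnit_det_of_left_inverse h1
  have hlam : ∀ i, lam i ≠ 0 := by
    have h1 : (Qᴴ * H * Q).det ≠ 0 := by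
      rw [Matrix.det_mul, Matrix.det_mul, Matrix.det_conjTranspose]
      exact mul_ne_zero (mul_ne_zero (star_ne_zero.2 hQu.ne_zero)
        ((Matrix.isUnit_iff_isUnit_det _).1 hu).ne_zero) hQu.ne_zero
    rw [hQ, Matrix.det_diagonal, Finset.prod_ne_zero_iff] at h1
    exact fun i ↦ by simpa using h1 i (Finset.mem_univ _)
  let j := Fintype.card {i // lam i < 0}
  have hj : j ≤ m := by
    simpa using Fintype.card_subtype_le (fun i : Fin m ↦ lam i < 0)
  have hcard : Fintype.card {a : Fin m // (a : ℕ) < j} = j := by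
    rw [Fintype.card_subtype, Fin.card_filter_val_lt, min_eq_right hj]
  -- Extended to a permutation, this moves the negative eigenvalues to the first `j` places.
  let e : {a : Fin m // (a : ℕ) < j} ≃ {i // lam i < 0} := Fintype.equivOfCardEq hcard
  let σ := e.extendSubtype
  have hσ : ∀ a : Fin m, lam (σ a) < 0 ↔ (a : ℕ) < j := fun a ↦
    ⟨fun h ↦ by_contra fun h' ↦ e.extendSubtype_not_mem a h' h, fun h ↦ e.extendSubtype_mem a h⟩
  let c : Fin m → ℂ := fun i ↦ ((Real.sqrt |lam i|)⁻¹ : ℝ)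
  have hc : ∀ i, c i * lam i * c i = if lam i < 0 then -1 else 1 := by
    intro i
    have h1 : 0 < |lam i| := abs_pos.2 (hlam i)
    have h2 : (Real.sqrt |lam i|)⁻¹ * lam i * (Real.sqrt |lam i|)⁻¹ = lam i / |lam i| := by
      rw [mul_right_comm, ← mul_inv, Real.mul_self_sqrt h1.le]; field_simp
    have h3 : c i * lam i * c i = ((lam i / |lam i| : ℝ) : ℂ) := by
      rw [← h2]; simp [c]
    rw [h3]
    split_ifs with h
    · rw [abs_of_neg h, div_neg, div_self (hlam i)]; simp
    · rw [abs_of_nonneg (not_lt.1 h), div_self (hlam i)]; simp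
  refine ⟨j, hj, (Q * Matrix.diagonal c).submatrix id σ, ?_⟩
  have h1 : (Q * Matrix.diagonal c)ᴴ * H * (Q * Matrix.diagonal c) =
      Matrix.diagonal fun i ↦ c i * lam i * c i := by
    have hcc : (Matrix.diagonal c)ᴴ = Matrix.diagonal c := by
      rw [Matrix.diagonal_conjTranspose]
      congr 1
      funext i
      simp [c]
    rw [Matrix.conjTranspose_mul, hcc]
    calc Matrix.diagonal c * Qᴴ * H * (Q * Matrix.diagonal c)
        = Matrix.diagonal c * (Qᴴ * H * Q) * Matrix.diagonal c := by simp only [Matrix.mul_assoc]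
      _ = _ := by rw [hQ, Matrix.diagonal_mul_diagonal, Matrix.diagonal_mul_diagonal]
  have h2 : ((Q * Matrix.diagonal c).submatrix id σ)ᴴ * H * (Q * Matrix.diagonal c).submatrix id σ =
      ((Q * Matrix.diagonal c)ᴴ * H * (Q * Matrix.diagonal c)).submatrix σ σ := by
    ext a b
    simp [Matrix.mul_apply]
  rw [h2, h1, Matrix.submatrix_diagonal_equiv]
  congr 1
  funext a
  simp only [Function.comp_apply, hc, signs, hσ]

theorem signs_sq (m l : ℕ) :
    Matrix.diagonal (signs m l) * Matrix.diagonal (signs m l) = 1 := by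
  rw [Matrix.diagonal_mul_diagonal, ← Matrix.diagonal_one]
  congr 1
  funext i
  simp only [signs]
  split_ifs <;> simp

theorem signs_conjTranspose (m l : ℕ) :
    (Matrix.diagonal (signs m l))ᴴ = Matrix.diagonal (signs m l) := by
  rw [Matrix.diagonal_conjTranspose]
  congr 1
  funext i
  simp only [signs, Pi.star_apply]
  split_ifs <;> simp

/-- Completing an injective matrix to an invertible one. -/
theorem exists_isUnit_fromCols {ι κ : Type*} [Fintype ι] [Fintype κ] [DecidableEq ι] [DecidableEq κ]
    (h : Matrix (ι ⊕ κ) ι ℂ) (hi : ∀ v, h *ᵥ v = 0 → v = 0) :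
    ∃ N : Matrix (ι ⊕ κ) κ ℂ, IsUnit (Matrix.fromCols h N) := by
  let f := h.mulVecLin
  have hf : Function.Injective f := by
    rw [← LinearMap.ker_eq_bot, LinearMap.ker_eq_bot']
    exact fun v hv ↦ hi v hv
  obtain ⟨W, hW⟩ := Submodule.exists_isCompl (LinearMap.range f)
  have hd := Submodule.finrank_add_eq_of_isCompl hW
  rw [LinearMap.finrank_range_of_inj hf] at hd
  have hd' : Module.finrank ℂ W = Fintype.card κ := by
    simp at hd; omega
  let b : Module.Basis κ ℂ W :=
    (Module.finBasisOfFinrankEq ℂ W hd').reindex (Fintype.equivFin κ).symm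
  refine ⟨Matrix.of fun i k ↦ (b k : ι ⊕ κ → ℂ) i, isUnit_of_mulVec_eq_zero fun v hv ↦ ?_⟩
  rw [Matrix.fromCols_mulVec] at hv
  have hN : (Matrix.of fun i k ↦ (b k : ι ⊕ κ → ℂ) i) *ᵥ (v ∘ Sum.inr) =
      ((∑ k, v (Sum.inr k) • b k : W) : ι ⊕ κ → ℂ) := by
    ext i
    simp [Matrix.mulVec, dotProduct, mul_comm]
  rw [hN] at hv
  have hdis := Submodule.disjoint_def.1 hW.disjoint
  have h1 : h *ᵥ (v ∘ Sum.inl) = 0 := by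
    refine hdis _ ⟨v ∘ Sum.inl, rfl⟩ ?_
    rw [eq_neg_of_add_eq_zero_left hv]
    exact W.neg_mem (Submodule.coe_mem _)
  rw [h1, zero_add] at hv
  have h2 := hi _ h1
  have h3 := Fintype.linearIndependent_iff.1 b.linearIndependent _ (Subtype.ext hv)
  funext i
  rcases i with i | k
  · exact congrFun h2 i
  · exact h3 k

/-- Block triangular isometries of block diagonal nondegenerate forms are block diagonal. -/
theorem blocks_of_isometry {ι κ : Type*} [Fintype ι] [Fintype κ] [DecidableEq ι] [DecidableEq κ]
    {D₁ : Matrix ι ι ℂ} {D₂ : Matrix κ κ ℂ} (h₁ : IsUnit D₁) {u : Matrix ι ι ℂ} {c : Matrix ι κ ℂ}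
    {v : Matrix κ κ ℂ}
    (h : (Matrix.fromBlocks u c 0 v)ᴴ * Matrix.fromBlocks D₁ 0 0 D₂ * Matrix.fromBlocks u c 0 v =
      Matrix.fromBlocks D₁ 0 0 D₂) :
    uᴴ * D₁ * u = D₁ ∧ c = 0 ∧ vᴴ * D₂ * v = D₂ := by
  simp only [Matrix.fromBlocks_conjTranspose, Matrix.fromBlocks_multiply, Matrix.conjTranspose_zero,
    Matrix.mul_zero, Matrix.zero_mul, add_zero, zero_add, Matrix.fromBlocks_inj] at h
  obtain ⟨ha, hb, -, hd⟩ := h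
  -- The identity `uᴴ D₁ u = D₁` makes `uᴴ D₁` invertible, and the off-diagonal block of the
  -- isometry equation is `uᴴ D₁ c = 0`.
  have hu : IsUnit (uᴴ * D₁) := by
    rw [Matrix.isUnit_iff_isUnit_det] at h₁ ⊢
    rw [← ha, Matrix.det_mul] at h₁
    exact isUnit_of_mul_isUnit_left h₁
  have hc : c = 0 := by
    have h2 := (Matrix.isUnit_iff_isUnit_det _).1 hu
    rw [← Matrix.one_mul c, ← Matrix.nonsing_inv_mul _ h2, Matrix.mul_assoc, hb, Matrix.mul_zero]
  refine ⟨ha, hc, ?_⟩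
  rw [hc] at hd
  simpa using hd

end LinearAlgebra

/-! ### Normal form of a Levi matrix with prescribed tangential block. -/

section Normalize

variable {E : Type*} [NormedAddCommGroup E] [NormedSpace ℝ E]
  {M : Type*} [TopologicalSpace M] [ChartedSpace E M] {ι : Type*} [Fintype ι] [DecidableEq ι] {m : ℕ}

/-- Block elimination is Gram–Schmidt relative to the nondegenerate first block; the two diagonal
blocks are then normalized separately. The last clause is what matters for coframes along the image:
where the first block is already `D`, the first block column of `P` is that of the identity, so the
tangential frame vectors do not move. -/
theorem exists_normal_form {D : Matrix ι ι ℂ} (hD : Dᴴ = D) (hDD : D * D = 1)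
    {G : M → Matrix (ι ⊕ Fin m) (ι ⊕ Fin m) ℂ} {p : M} (hG : ∀ᶠ q in 𝓝 p, SmoothMatAt E G q)
    (hherm : ∀ᶠ q in 𝓝 p, (G q)ᴴ = G q) (hu : IsUnit (G p)) (hp : (G p).toBlocks₁₁ = D) :
    ∃ j ≤ m, ∃ P : M → Matrix (ι ⊕ Fin m) (ι ⊕ Fin m) ℂ,
      (∀ᶠ q in 𝓝 p, SmoothMatAt E P q ∧
        (P q)ᴴ * G q * P q = Matrix.fromBlocks D 0 0 (Matrix.diagonal (signs m j))) ∧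
      ∀ q, (G q).toBlocks₁₁ = D → (P q).toBlocks₁₁ = 1 ∧ (P q).toBlocks₂₁ = 0 := by
  let A : M → Matrix ι ι ℂ := fun q ↦ (G q).toBlocks₁₁
  let B : M → Matrix ι (Fin m) ℂ := fun q ↦ (G q).toBlocks₁₂
  let C : M → Matrix (Fin m) (Fin m) ℂ := fun q ↦ (G q).toBlocks₂₂
  have hA : ∀ᶠ q in 𝓝 p, SmoothMatAt E A q := hG.mono fun q hq ↦ hq.submatrix Sum.inl Sum.inl
  have hB : ∀ᶠ q in 𝓝 p, SmoothMatAt E B q := hG.mono fun q hq ↦ hq.submatrix Sum.inl Sum.inr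
  have hC : ∀ᶠ q in 𝓝 p, SmoothMatAt E C q := hG.mono fun q hq ↦ hq.submatrix Sum.inr Sum.inr
  have hblk : ∀ q, (G q)ᴴ = G q → G q = Matrix.fromBlocks (A q) (B q) (B q)ᴴ (C q) ∧
      (A q)ᴴ = A q ∧ (C q)ᴴ = C q := by
    intro q hq
    have h1 := Matrix.fromBlocks_toBlocks (G q)
    rw [← h1, Matrix.fromBlocks_conjTranspose, Matrix.fromBlocks_inj] at hq
    refine ⟨?_, hq.1, hq.2.2.2⟩
    rw [← h1, Matrix.fromBlocks_inj]
    exact ⟨rfl, rfl, hq.2.2.1.symm, rfl⟩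
  have hDu : IsUnit D := IsUnit.of_mul_eq_one D hDD
  have hAu : ∀ᶠ q in 𝓝 p, IsUnit (A q) := hA.self_of_nhds.eventually_isUnit (by rwa [← hp] at hDu)
  -- This choice kills the off-diagonal blocks, and `Y` is the Schur complement left over.
  let X : M → Matrix ι (Fin m) ℂ := fun q ↦ -((A q)⁻¹ * B q)
  let Y : M → Matrix (Fin m) (Fin m) ℂ := fun q ↦ (X q)ᴴ * B q + C q
  have hX : ∀ᶠ q in 𝓝 p, SmoothMatAt E X q := by
    filter_upwards [hA, hB, hAu] with q h1 h2 h3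
    exact ((h1.inv h3).mul h2).neg
  have hS : ∀ᶠ q in 𝓝 p, SmoothMatAt E Y q := by
    filter_upwards [hB, hC, hX] with q h1 h2 h3
    exact (SmoothMatAt.mul (A := fun q ↦ (X q)ᴴ) h3.conj.transpose h1).add h2
  have hAX : ∀ q, IsUnit (A q) → A q * X q + B q = 0 := fun q hq ↦ by
    have := (Matrix.isUnit_iff_isUnit_det _).1 hq
    simp only [X]
    rw [Matrix.mul_neg, Matrix.mul_nonsing_inv_cancel_left _ _ this, neg_add_cancel]
  have hTG : ∀ q, (G q)ᴴ = G q → IsUnit (A q) →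
      (Matrix.fromBlocks 1 (X q) 0 1)ᴴ * G q * Matrix.fromBlocks 1 (X q) 0 1 =
        Matrix.fromBlocks (A q) 0 0 (Y q) := by
    intro q hq hqu
    obtain ⟨h1, h2, h3⟩ := hblk q hq
    have h4 := hAX q hqu
    have h5 : (X q)ᴴ * A q + (B q)ᴴ = 0 := by
      have := congrArg Matrix.conjTranspose h4
      simpa [h2] using this
    rw [h1]
    simp only [Matrix.fromBlocks_conjTranspose, Matrix.fromBlocks_multiply,
      Matrix.conjTranspose_zero, Matrix.conjTranspose_one, Matrix.mul_zero, Matrix.zero_mul,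
      add_zero, zero_add, Matrix.mul_one, Matrix.one_mul, h5]
    rw [h4]
  have hYh : ∀ᶠ q in 𝓝 p, (Y q)ᴴ = Y q := by
    filter_upwards [hherm, hAu] with q h1 h2
    have h3 := congrArg Matrix.conjTranspose (hTG q h1 h2)
    have h4 : ((Matrix.fromBlocks 1 (X q) 0 1)ᴴ * G q * Matrix.fromBlocks 1 (X q) 0 1)ᴴ =
        (Matrix.fromBlocks 1 (X q) 0 1)ᴴ * G q * Matrix.fromBlocks 1 (X q) 0 1 := by
      simp only [Matrix.conjTranspose_mul, Matrix.conjTranspose_conjTranspose, h1, Matrix.mul_assoc]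
    rw [h4, hTG q h1 h2, Matrix.fromBlocks_conjTranspose, Matrix.fromBlocks_inj] at h3
    exact h3.2.2.2.symm
  have hYu : IsUnit (Y p) := by
    have h1 := congrArg Matrix.det (hTG p hherm.self_of_nhds hAu.self_of_nhds)
    rw [Matrix.det_mul, Matrix.det_mul, Matrix.det_conjTranspose, Matrix.det_fromBlocks_zero₂₁,
      Matrix.det_fromBlocks_zero₂₁] at h1
    rw [Matrix.isUnit_iff_isUnit_det] at hu ⊢
    simp only [Matrix.det_one, mul_one, star_one, one_mul] at h1
    rw [h1] at hu
    exact isUnit_of_mul_isUnit_right hu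
  -- A constant matrix `K` normalizes the Schur complement at `p`; the smooth congruence is needed
  -- only for matrices close to the normal form.
  obtain ⟨j, hj, K, hK⟩ := exists_congruence_signs hYh.self_of_nhds hYu
  obtain ⟨R₁, hR₁, hR₁'⟩ := exists_smooth_congruence hD hDD hA
    (hherm.mono fun q hq ↦ (hblk q hq).2.1) hp
  obtain ⟨R₂, hR₂, -⟩ := exists_smooth_congruence (signs_conjTranspose m j) (signs_sq m j)
    (H := fun q ↦ Kᴴ * Y q * K) (hS.mono fun q hq ↦ ((SmoothMatAt.const _).mul hq).mul (.const _))
    (hYh.mono fun q hq ↦ by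
      simp only [Matrix.conjTranspose_mul, Matrix.conjTranspose_conjTranspose, hq,
        Matrix.mul_assoc]) hK
  refine ⟨j, hj, fun q ↦ Matrix.fromBlocks 1 (X q) 0 1 * Matrix.fromBlocks (R₁ q) 0 0 (K * R₂ q),
    ?_, fun q hq ↦ ?_⟩
  · filter_upwards [hherm, hAu, hX, hR₁, hR₂] with q h1 h2 h3 h4 h5
    constructor
    · exact (SmoothMatAt.fromBlocks (.const _) h3 (.const _) (.const _)).mul
        (.fromBlocks h4.1 (.const _) (.const _) ((SmoothMatAt.const _).mul h5.1))
    · have h6 := hTG q h1 h2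
      rw [Matrix.conjTranspose_mul]
      calc _ = (Matrix.fromBlocks (R₁ q) 0 0 (K * R₂ q))ᴴ *
            ((Matrix.fromBlocks 1 (X q) 0 1)ᴴ * G q * Matrix.fromBlocks 1 (X q) 0 1) *
            Matrix.fromBlocks (R₁ q) 0 0 (K * R₂ q) := by simp only [Matrix.mul_assoc]
        _ = _ := by
          rw [h6]
          simp only [Matrix.fromBlocks_conjTranspose, Matrix.fromBlocks_multiply,
            Matrix.conjTranspose_zero, Matrix.mul_zero, Matrix.zero_mul, add_zero, zero_add]
          rw [h4.2, ← h5.2]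
          simp only [Matrix.conjTranspose_mul, Matrix.mul_assoc]
  · simp only [Matrix.fromBlocks_multiply, hR₁' q hq]
    simp

end Normalize

/-! ### CR maps, pullbacks and the immersion property. -/

section CRMaps

variable {E : Type*} [NormedAddCommGroup E] [NormedSpace ℝ E]
  {M : Type*} [TopologicalSpace M] [ChartedSpace E M]
  {E' : Type*} [NormedAddCommGroup E'] [NormedSpace ℝ E']
  {M' : Type*} [TopologicalSpace M'] [ChartedSpace E' M']
  {F : Type*} [NormedAddCommGroup F] [NormedSpace ℝ F]

variable (E E') in
/-- The differential of a map on complexified tangent vectors. -/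
def pushC (f : M → M') (p : M) : CTangent (E := E) p →ₗ[ℂ] CTangent (E := E') (f p) :=
  (mfderiv 𝓘(ℝ, E) 𝓘(ℝ, E') f p).toLinearMap.baseChange ℂ

theorem pushC_cvec (f : M → M') (p : M) (v w : TangentSpace 𝓘(ℝ, E) p) :
    pushC E E' f p (cvec p v w) =
      cvec (f p) (mfderiv 𝓘(ℝ, E) 𝓘(ℝ, E') f p v) (mfderiv 𝓘(ℝ, E) 𝓘(ℝ, E') f p w) := by
  simp [pushC, cvec]

theorem pushC_conjT (f : M → M') (p : M) (Z : CTangent (E := E) p) :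
    pushC E E' f p (conjT p Z) = conjT (f p) (pushC E E' f p Z) := by
  obtain ⟨v, w, rfl⟩ := exists_cvec p Z
  rw [conjT_cvec, pushC_cvec, pushC_cvec, conjT_cvec, map_neg]

theorem evalC_pullAt (f : M → M') (η : OneForm E' M' ℂ) (p : M) (Z : CTangent (E := E) p) :
    evalC p (pullAt f η p) Z = evalC (f p) (η (f p)) (pushC E E' f p Z) := by
  obtain ⟨v, w, rfl⟩ := exists_cvec p Z
  rw [pushC_cvec, evalC_cvec, evalC_cvec]
  rfl

theorem toComplex_pullAt (f : M → M') (η : OneForm E' M' ℝ) (p : M) :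
    toComplex p (pullAt (E := E) f η p) = pullAt f (fun q ↦ toComplex q (η q)) p := rfl

theorem pullAt_sum_smul (f : M → M') {ι : Type*} [Fintype ι] (c : M' → ι → ℂ)
    (η : ι → OneForm E' M' ℂ) (p : M) :
    pullAt (E := E) f (fun q ↦ ∑ i, c q i • η i q) p = ∑ i, c (f p) i • pullAt (E := E) f (η i) p := by
  ext v
  simp [pullAt]

variable [IsManifold 𝓘(ℝ, E) ∞ M] {n : ℕ} [IsManifold 𝓘(ℝ, E') ∞ M'] {n' : ℕ}
  {S : CRStructure E M n} {S' : CRStructure E' M' n'} {f : M → M'}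
  {U' : Set M'} {θ' : OneForm E' M' ℝ}

theorem extDC_pullAt {p : M} (hf : ContMDiffAt 𝓘(ℝ, E) 𝓘(ℝ, E') ∞ f p)
    (hθ : SmoothFormAt θ' (f p)) (Z W : CTangent (E := E) p) :
    extDC (pullAt f θ') p Z W = extDC θ' (f p) (pushC E E' f p Z) (pushC E E' f p W) := by
  have h : ∀ v w : TangentSpace 𝓘(ℝ, E) p, extD (pullAt f θ') p v w =
    extD θ' (f p) (mfderiv 𝓘(ℝ, E) 𝓘(ℝ, E') f p v) (mfderiv 𝓘(ℝ, E) 𝓘(ℝ, E') f p w) :=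
    extDAt_pullAt hf hθ
  obtain ⟨v, w, rfl⟩ := exists_cvec p Z
  obtain ⟨v', w', rfl⟩ := exists_cvec p W
  rw [pushC_cvec, pushC_cvec, extDC_cvec, extDC_cvec, h, h, h, h]

theorem leviForm_pullAt {p : M} (hf : ContMDiffAt 𝓘(ℝ, E) 𝓘(ℝ, E') ∞ f p)
    (hθ : SmoothFormAt θ' (f p)) (Z W : CTangent (E := E) p) :
    leviForm (pullAt f θ') p Z W = leviForm θ' (f p) (pushC E E' f p Z) (pushC E E' f p W) := by
  rw [leviForm, extDC_pullAt hf hθ, pushC_conjT, leviForm]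

namespace IsCRMap

theorem isHol (hf : IsCRMap S S' f) {p : M} {Z : CTangent (E := E) p} (hZ : S.IsHol p Z) :
    S'.IsHol (f p) (pushC E E' f p Z) := by
  rw [CRStructure.IsHol, ← pushC_conjT]
  exact hf.map_mem p _ hZ

theorem pullAt_mem (hf : IsCRMap S S' f) {p : M} {η : OneForm E' M' ℂ} (hη : η (f p) ∈ S'.holCotangent (f p)) :
    pullAt f η p ∈ S.holCotangent p := fun Z hZ ↦ by
  rw [evalC_pullAt]
  exact hη _ (hf.map_mem p Z hZ)

theorem isContactForm_pullAt (hf : IsCRMap S S' f)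
    (hft : ∀ p : M, CRTransversalAt (E := E) S' f p) (hU' : IsOpen U')
    (hθ : IsContactForm S' U' θ') : IsContactForm S (f ⁻¹' U') (pullAt f θ') := by
  have h1 : ∀ p ∈ f ⁻¹' U', SmoothFormAt (E := E) (pullAt f θ') p := fun p hp ↦
    SmoothFormAt.pullAt (η := θ') (hf.smooth p) (hθ.smoothFormAt hU' hp)
  have h2 : ∀ p ∈ f ⁻¹' U', toComplex p (pullAt (E := E) f θ' p) ∈ S.holCotangent p := fun p hp ↦ by
    rw [toComplex_pullAt]
    exact hf.pullAt_mem (η := fun q ↦ toComplex q (θ' q)) (hθ.annihilates (f p) hp)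
  exact ⟨(smoothForm_iff (hU'.preimage hf.smooth.continuous)).2 h1,
    fun p hp ↦ hft p U' θ' hU' hp hθ, h2⟩

/-- A transversal CR map of a Levi-nondegenerate manifold is an immersion. -/
theorem injective_dAt (hf : IsCRMap S S' f) (hft : ∀ p : M, CRTransversalAt (E := E) S' f p) (hS : S.LeviNondegenerate)
    (p : M) : Function.Injective (dAt E E' f p) := by
  obtain ⟨U', θ', hU', hp, hθ⟩ := S'.exists_isContactForm (f p)
  have h := hf.isContactForm_pullAt hft hU' hθ
  rw [injective_iff_map_eq_zero]
  intro v hv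
  -- Both conditions are evaluations of the target form, or of its differential, on `df(v) = 0`.
  refine h.eq_zero_of_extD (hU'.preimage hf.smooth.continuous) hS hp ?_ fun w _ ↦ ?_
  · change covAt θ' (f p) (dAt E E' f p v) = 0
    rw [hv, map_zero]
  · have := extDAt_pullAt (hf.smooth p) (hθ.smoothFormAt hU' hp) v w
    rw [hv, map_zero, zero_apply] at this
    exact this

theorem dim_le (hf : IsCRMap S S' f) (hft : ∀ p : M, CRTransversalAt (E := E) S' f p) (hS : S.LeviNondegenerate)
    (p : M) : n ≤ n' := by
  have := S'.finiteDimensional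
  have h : Module.finrank ℝ E ≤ Module.finrank ℝ E' :=
    LinearMap.finrank_le_finrank_of_injective (f := (dAt E E' f p : E →ₗ[ℝ] E'))
      (hf.injective_dAt hft hS p)
  rw [S.dim_eq, S'.dim_eq] at h
  omega

end IsCRMap

end CRMaps

/-! ### Left inverses of immersions and rescaling of forms in vector spaces. -/

section ModelSpace

variable {V V' : Type*} [NormedAddCommGroup V] [NormedSpace ℝ V] [NormedAddCommGroup V']
  [NormedSpace ℝ V']

theorem contDiffAt_flip {g : V → V' →L[ℝ] V' →L[ℝ] ℝ} {x : V} (h : ContDiffAt ℝ ∞ g x) :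
    ContDiffAt ℝ ∞ (fun y ↦ (g y).flip) x := by
  have hL : IsBoundedLinearMap ℝ (fun B : V' →L[ℝ] V' →L[ℝ] ℝ ↦ B.flip) :=
    ⟨⟨fun _ _ ↦ rfl, fun _ _ ↦ rfl⟩, 1, one_pos, fun B ↦ by simp⟩
  have hL' : ContDiff ℝ ∞ (fun B : V' →L[ℝ] V' →L[ℝ] ℝ ↦ B.flip) := hL.contDiff
  exact hL'.contDiffAt.comp _ h

/-- An immersion of vector spaces has a local smooth left inverse. -/
theorem exists_smooth_left_inverse [FiniteDimensional ℝ V] [FiniteDimensional ℝ V']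
    {F : V → V'} {a : V} (hF : ∀ᶠ x in 𝓝 a, ContDiffAt ℝ ∞ F x)
    (hi : Function.Injective (fderiv ℝ F a)) :
    ∃ G : V' → V, (∀ᶠ y in 𝓝 (F a), ContDiffAt ℝ ∞ G y) ∧ ∀ᶠ x in 𝓝 a, G (F x) = x := by
  obtain ⟨π, hπ⟩ := LinearMap.exists_leftInverse_of_injective (fderiv ℝ F a : V →ₗ[ℝ] V')
    (LinearMap.ker_eq_bot.2 hi)
  let π' : V' →L[ℝ] V := π.toContinuousLinearMap
  have hd : fderiv ℝ (fun x ↦ π' (F x)) a = ContinuousLinearMap.id ℝ V := by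
    have h1 := (hF.self_of_nhds.differentiableAt (by norm_num)).hasFDerivAt
    refine ((π'.hasFDerivAt (x := F a)).comp a h1).fderiv.trans ?_
    ext v
    exact LinearMap.congr_fun hπ v
  obtain ⟨s, h1, h2, h3⟩ := exists_smooth_local_inverse (f := fun x ↦ π' (F x)) (a := a)
    (hF.mono fun x hx ↦ π'.contDiff.contDiffAt.comp x hx) (by rw [hd]; exact Function.bijective_id)
  refine ⟨fun y ↦ s (π' y), ?_, h3⟩
  have hc : Tendsto π' (𝓝 (F a)) (𝓝 (π' (F a))) := π'.continuous.continuousAt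
  filter_upwards [hc.eventually h2] with y hy
  exact hy.1.comp y π'.contDiff.contDiffAt

/-- A one-form whose restriction to an immersed submanifold has the vector field `τ` as
characteristic vector field can be rescaled, without changing it along the submanifold, so that the
image of `τ` becomes characteristic. -/
theorem exists_rescaling {F : V → V'} {a : V} (hF : ∀ᶠ x in 𝓝 a, ContDiffAt ℝ ∞ F x)
    {G : V' → V} (hG : ∀ᶠ y in 𝓝 (F a), ContDiffAt ℝ ∞ G y) (hGF : ∀ᶠ x in 𝓝 a, G (F x) = x)
    {ζ : V' → V' →L[ℝ] ℝ} (hζ : ∀ᶠ y in 𝓝 (F a), ContDiffAt ℝ ∞ ζ y)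
    {τ : V → V} (hτ : ∀ᶠ x in 𝓝 a, ContDiffAt ℝ ∞ τ x)
    (h1 : ∀ᶠ x in 𝓝 a, ζ (F x) (fderiv ℝ F x (τ x)) = 1)
    (h2 : ∀ᶠ x in 𝓝 a, ∀ w, fderiv ℝ ζ (F x) (fderiv ℝ F x (τ x)) (fderiv ℝ F x w) -
      fderiv ℝ ζ (F x) (fderiv ℝ F x w) (fderiv ℝ F x (τ x)) = 0) :
    ∃ u : V' → ℝ, (∀ᶠ y in 𝓝 (F a), ContDiffAt ℝ ∞ u y) ∧ ∀ᶠ x in 𝓝 a, u (F x) = 1 ∧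
      ∀ v, fderiv ℝ (fun y ↦ u y • ζ y) (F x) (fderiv ℝ F x (τ x)) v -
        fderiv ℝ (fun y ↦ u y • ζ y) (F x) v (fderiv ℝ F x (τ x)) = 0 := by
  let b : V' → V' := fun y ↦ fderiv ℝ F (G y) (τ (G y))
  let B : V' → V' →L[ℝ] ℝ := fun y ↦ fderiv ℝ ζ y (b y) - (fderiv ℝ ζ y).flip (b y)
  -- Here `b` extends the image of `τ` off the submanifold and `B` is `dζ(b, ·)`. The argument `y -
  -- F (G y)` vanishes on the image, so `u = 1` there and `du` equals `B` composed with `id - dF ∘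
  -- dG`. The subtracted part is zero because `B` kills tangential vectors, hence `du = dζ(b, ·)`.
  let u : V' → ℝ := fun y ↦ 1 + B y (y - F (G y))
  have hGa : G (F a) = a := hGF.self_of_nhds
  have hGt : Tendsto G (𝓝 (F a)) (𝓝 a) := by
    have := hG.self_of_nhds.continuousAt
    rwa [ContinuousAt, hGa] at this
  have hFt : Tendsto F (𝓝 a) (𝓝 (F a)) := hF.self_of_nhds.continuousAt
  have hB : ∀ᶠ y in 𝓝 (F a), ContDiffAt ℝ ∞ B y := by
    filter_upwards [hG, hζ, hGt.eventually hF, hGt.eventually hτ] with y h1 h2 h3 h4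
    have hb : ContDiffAt ℝ ∞ b y :=
      ((h3.fderiv_right (m := ∞) le_rfl).comp y h1).clm_apply (h4.comp y h1)
    have hD := h2.fderiv_right (m := ∞) le_rfl
    exact (hD.clm_apply hb).sub ((contDiffAt_flip hD).clm_apply hb)
  have hr : ∀ᶠ y in 𝓝 (F a), ContDiffAt ℝ ∞ (fun y ↦ y - F (G y)) y := by
    filter_upwards [hG, hGt.eventually hF] with y h1 h3
    exact contDiffAt_id.sub (h3.comp y h1)
  have hu : ∀ᶠ y in 𝓝 (F a), ContDiffAt ℝ ∞ u y := by
    filter_upwards [hB, hr] with y h1 h2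
    exact contDiffAt_const.add (h1.clm_apply h2)
  refine ⟨u, hu, ?_⟩
  filter_upwards [h1, h2, hGF, hF, hFt.eventually hB, hFt.eventually hu, hFt.eventually hG,
    hFt.eventually hζ] with x e1 e2 e3 e4 e5 e6 e7 e8
  have hbx : b (F x) = fderiv ℝ F x (τ x) := by simp only [b, e3]
  have hu1 : u (F x) = 1 := by simp [u, e3]
  have hdr : HasFDerivAt (fun y ↦ y - F (G y))
      (ContinuousLinearMap.id ℝ V' - (fderiv ℝ F x).comp (fderiv ℝ G (F x))) (F x) := by
    have hGd := (e7.differentiableAt (by norm_num)).hasFDerivAt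
    have hFd : HasFDerivAt F (fderiv ℝ F x) (G (F x)) := by
      rw [e3]; exact (e4.differentiableAt (by norm_num)).hasFDerivAt
    exact (hasFDerivAt_id _).sub (hFd.comp (F x) hGd)
  have hdu : ∀ v, fderiv ℝ u (F x) v = fderiv ℝ ζ (F x) (fderiv ℝ F x (τ x)) v -
      fderiv ℝ ζ (F x) v (fderiv ℝ F x (τ x)) := by
    intro v
    have h3 := ((e5.differentiableAt (by norm_num)).hasFDerivAt.clm_apply hdr).const_add 1
    have h4 : fderiv ℝ u (F x) = _ := h3.fderiv
    rw [h4]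
    simp only [e3, sub_self, map_zero, add_zero, ContinuousLinearMap.comp_apply,
      sub_apply, ContinuousLinearMap.id_apply, map_sub, B, hbx, ContinuousLinearMap.flip_apply]
    have := e2 (fderiv ℝ G (F x) v)
    linarith
  refine ⟨hu1, fun v ↦ ?_⟩
  have hsm : HasFDerivAt (fun y ↦ u y • ζ y) _ (F x) :=
    (e6.differentiableAt (by norm_num)).hasFDerivAt.smul (e8.differentiableAt (by norm_num)).hasFDerivAt
  rw [hsm.fderiv]
  simp [hu1, hdu, e1]

end ModelSpace

/-! ### Transfer to manifolds; smoothness of the characteristic field. -/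

section Charts

variable {E : Type*} [NormedAddCommGroup E] [NormedSpace ℝ E]
  {M : Type*} [TopologicalSpace M] [ChartedSpace E M] [IsManifold 𝓘(ℝ, E) ∞ M]
  {E' : Type*} [NormedAddCommGroup E'] [NormedSpace ℝ E']
  {M' : Type*} [TopologicalSpace M'] [ChartedSpace E' M'] [IsManifold 𝓘(ℝ, E') ∞ M']

theorem tendsto_extChartAt_symm (p : M) :
    Tendsto (extChartAt 𝓘(ℝ, E) p).symm (𝓝 (extChartAt 𝓘(ℝ, E) p p)) (𝓝 p) := by
  have := continuousAt_extChartAt_symm (I := 𝓘(ℝ, E)) p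
  rwa [ContinuousAt, extChartAt_to_inv] at this

theorem eventually_contDiffAt_writtenInExtChartAt {f : M → M'} {p : M}
    (hf : ContMDiff 𝓘(ℝ, E) 𝓘(ℝ, E') ∞ f) :
    ∀ᶠ y in 𝓝 (extChartAt 𝓘(ℝ, E) p p),
      ContDiffAt ℝ ∞ (writtenInExtChartAt 𝓘(ℝ, E) 𝓘(ℝ, E') p f) y := by
  have hs : ∀ᶠ q in 𝓝 p, f q ∈ (chartAt E' (f p)).source :=
    hf.continuous.continuousAt.eventually
      ((chartAt E' (f p)).open_source.mem_nhds (mem_chart_source E' (f p)))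
  filter_upwards [(tendsto_extChartAt_symm p).eventually hs,
    extChartAt_target_mem_nhds (I := 𝓘(ℝ, E)) p] with y h1 h2
  rw [← contMDiffAt_iff_contDiffAt]
  exact (contMDiffAt_extChartAt' (I := 𝓘(ℝ, E')) (n := ∞) h1).comp y
    ((hf _).comp y (contMDiffAt_extChartAt_symm h2))

/-- The differential in charts. -/
theorem dAt_symm_fderiv_writtenInExtChartAt {f : M → M'} {p : M}
    (hf : ContMDiff 𝓘(ℝ, E) 𝓘(ℝ, E') ∞ f) {y : E} (hy : y ∈ (extChartAt 𝓘(ℝ, E) p).target)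
    (hs : f ((extChartAt 𝓘(ℝ, E) p).symm y) ∈ (chartAt E' (f p)).source) (v : E) :
    dAt E' E' (extChartAt 𝓘(ℝ, E') (f p)).symm (writtenInExtChartAt 𝓘(ℝ, E) 𝓘(ℝ, E') p f y)
      (fderiv ℝ (writtenInExtChartAt 𝓘(ℝ, E) 𝓘(ℝ, E') p f) y v) =
    dAt E E' f ((extChartAt 𝓘(ℝ, E) p).symm y) (dAt E E (extChartAt 𝓘(ℝ, E) p).symm y v) := by
  have : IsManifold 𝓘(ℝ, E') 1 M' := .of_le (n := ∞) (by norm_cast)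
  have d1 : MDifferentiableAt 𝓘(ℝ, E) 𝓘(ℝ, E) (extChartAt 𝓘(ℝ, E) p).symm y :=
    (contMDiffAt_extChartAt_symm hy).mdifferentiableAt (by norm_num)
  have d2 : MDifferentiableAt 𝓘(ℝ, E) 𝓘(ℝ, E') f ((extChartAt 𝓘(ℝ, E) p).symm y) :=
    (hf _).mdifferentiableAt (by norm_num)
  have d3 : MDifferentiableAt 𝓘(ℝ, E') 𝓘(ℝ, E') (extChartAt 𝓘(ℝ, E') (f p))
    (f ((extChartAt 𝓘(ℝ, E) p).symm y)) := mdifferentiableAt_extChartAt hs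
  have c1 : fderiv ℝ (writtenInExtChartAt 𝓘(ℝ, E) 𝓘(ℝ, E') p f) y =
      (dAt E' E' (extChartAt 𝓘(ℝ, E') (f p)) (f ((extChartAt 𝓘(ℝ, E) p).symm y))).comp
        ((dAt E E' f ((extChartAt 𝓘(ℝ, E) p).symm y)).comp
        (dAt E E (extChartAt 𝓘(ℝ, E) p).symm y)) := by
    rw [← dAt_eq_fderiv]
    exact (dAt_comp (f := f ∘ (extChartAt 𝓘(ℝ, E) p).symm) d3 (d2.comp y d1)).trans
      (congrArg _ (dAt_comp (q := y) d2 d1))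
  rw [c1]
  exact DFunLike.congr_fun (dAt_symm_comp_dAt hs) _

/-- An immersion has a local smooth left inverse. -/
theorem exists_smooth_left_inverse_manifold [FiniteDimensional ℝ E] [FiniteDimensional ℝ E']
    {f : M → M'} (hf : ContMDiff 𝓘(ℝ, E) 𝓘(ℝ, E') ∞ f) {p : M}
    (hi : Function.Injective (dAt E E' f p)) :
    ∃ g : M' → M, (∀ᶠ q in 𝓝 (f p), ContMDiffAt 𝓘(ℝ, E') 𝓘(ℝ, E) ∞ g q) ∧
      ∀ᶠ x in 𝓝 p, g (f x) = x := by
  obtain ⟨G, hG, hGF⟩ := exists_smooth_left_inverse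
    (eventually_contDiffAt_writtenInExtChartAt (p := p) hf) (by
      rw [← dAt_eq_fderiv_writtenInExtChartAt ((hf p).mdifferentiableAt (by norm_num))]; exact hi)
  have hφ : Tendsto (extChartAt 𝓘(ℝ, E) p) (𝓝 p) (𝓝 (extChartAt 𝓘(ℝ, E) p p)) :=
    continuousAt_extChartAt p
  have hφ' : Tendsto (extChartAt 𝓘(ℝ, E') (f p)) (𝓝 (f p)) (𝓝 (extChartAt 𝓘(ℝ, E') (f p) (f p))) :=
    continuousAt_extChartAt (f p)
  have hGa : G (extChartAt 𝓘(ℝ, E') (f p) (f p)) = extChartAt 𝓘(ℝ, E) p p := by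
    have := hGF.self_of_nhds
    rwa [writtenInExtChartAt_self] at this
  rw [writtenInExtChartAt_self] at hG
  have hGt : Tendsto G (𝓝 (extChartAt 𝓘(ℝ, E') (f p) (f p))) (𝓝 (extChartAt 𝓘(ℝ, E) p p)) := by
    have := hG.self_of_nhds.continuousAt
    rwa [ContinuousAt, hGa] at this
  refine ⟨fun q ↦ (extChartAt 𝓘(ℝ, E) p).symm (G (extChartAt 𝓘(ℝ, E') (f p) q)), ?_, ?_⟩
  · filter_upwards [hφ'.eventually hG,
      hφ'.eventually (hGt.eventually (extChartAt_target_mem_nhds (I := 𝓘(ℝ, E)) p)),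
      (chartAt E' (f p)).open_source.mem_nhds (mem_chart_source E' (f p))] with q h1 h2 h3
    exact (contMDiffAt_extChartAt_symm h2).comp q
      (h1.contMDiffAt.comp q (contMDiffAt_extChartAt' (I := 𝓘(ℝ, E')) h3))
  · filter_upwards [hφ.eventually hGF, (chartAt E p).open_source.mem_nhds (mem_chart_source E p)]
      with x h1 h2
    have h3 := (extChartAt 𝓘(ℝ, E) p).left_inv (mem_extChartAt_source' h2)
    have h4 : extChartAt 𝓘(ℝ, E') (f p) (f x) =
        writtenInExtChartAt 𝓘(ℝ, E) 𝓘(ℝ, E') p f (extChartAt 𝓘(ℝ, E) p x) := by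
      simp only [writtenInExtChartAt, Function.comp_apply, h3]
    simp only [h4, h1, h3]

/-- The characteristic vector field of a contact form is smooth. -/
theorem IsContactForm.exists_smooth_reeb {n : ℕ} {S : CRStructure E M n} {U : Set M}
    {θ : OneForm E M ℝ} (hθ : IsContactForm S U θ) (hU : IsOpen U) (hS : S.LeviNondegenerate)
    {p : M} (hp : p ∈ U) :
    ∃ τ : E → E, ∀ᶠ y in 𝓝 (extChartAt 𝓘(ℝ, E) p p), ContDiffAt ℝ ∞ τ y ∧
      IsReebAt θ ((extChartAt 𝓘(ℝ, E) p).symm y)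
        (dAt E E (extChartAt 𝓘(ℝ, E) p).symm y (τ y)) := by
  have := S.finiteDimensional
  let α := chartRep θ p
  -- This is `reebMap` in the chart; inverting it smoothly in `y` yields the characteristic field.
  let R : E → E →L[ℝ] E →L[ℝ] ℝ := fun y ↦
    (α y).smulRight (α y) + (fderiv ℝ α y - (fderiv ℝ α y).flip)
  have hRv : ∀ y v w, R y v w = α y v * α y w + (fderiv ℝ α y v w - fderiv ℝ α y w v) :=
    fun y v w ↦ by simp [R]
  have hψ := tendsto_extChartAt_symm (E := E) p
  have hα : ∀ᶠ y in 𝓝 (extChartAt 𝓘(ℝ, E) p p), ContDiffAt ℝ ∞ α y := by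
    filter_upwards [hψ.eventually (hU.mem_nhds hp),
      extChartAt_target_mem_nhds (I := 𝓘(ℝ, E)) p] with y h1 h2
    have h3 : (extChartAt 𝓘(ℝ, E) p).symm y ∈ (chartAt E p).source := by
      simpa using (extChartAt 𝓘(ℝ, E) p).map_target h2
    have h4 := (smoothFormAt_iff h3).1 (hθ.smoothFormAt hU h1)
    rwa [(extChartAt 𝓘(ℝ, E) p).right_inv h2] at h4
  have hR : ∀ᶠ y in 𝓝 (extChartAt 𝓘(ℝ, E) p p), ContDiffAt ℝ ∞ R y := by
    filter_upwards [hα] with y h1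
    have hD := h1.fderiv_right (m := ∞) le_rfl
    exact (h1.smulRight h1).add (hD.sub (contDiffAt_flip hD))
  have hR0 : Function.Bijective (R (extChartAt 𝓘(ℝ, E) p p)) := by
    have : R (extChartAt 𝓘(ℝ, E) p p) = reebMap θ p := by
      ext v w
      rw [hRv, reebMap_apply, extDAt_apply, ← chartRep_self]
    rw [this]
    exact hθ.reebMap_bijective hU hS hp
  refine ⟨fun y ↦ (R y).inverse (α y), ?_⟩
  filter_upwards [hα, hR, eventually_bijective hR.self_of_nhds.continuousAt hR0,
    hψ.eventually (hU.mem_nhds hp), extChartAt_target_mem_nhds (I := 𝓘(ℝ, E)) p]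
    with y h1 h2 h3 h4 h5
  refine ⟨(contDiffAt_inverse h2 h3).clm_apply h1, ?_⟩
  -- The characteristic vector at the nearby point exists intrinsically; its chart coordinates solve
  -- the same system, so bijectivity identifies the two.
  obtain ⟨T, hT⟩ := hθ.exists_isReebAt hU hS h4
  have h6 : (extChartAt 𝓘(ℝ, E) p).symm y ∈ (chartAt E p).source := by
    simpa using (extChartAt 𝓘(ℝ, E) p).map_target h5
  obtain ⟨t, ht⟩ : ∃ t : E, dAt E E (extChartAt 𝓘(ℝ, E) p).symm y t = T := by
    refine ⟨dAt E E (extChartAt 𝓘(ℝ, E) p) ((extChartAt 𝓘(ℝ, E) p).symm y) T, ?_⟩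
    have := dAt_symm_comp_dAt h6
    rw [(extChartAt 𝓘(ℝ, E) p).right_inv h5] at this
    exact DFunLike.congr_fun this T
  have h7 : R y t = α y := by
    ext w
    have e1 := extDAt_chart h5 (hθ.smoothFormAt hU h4) t w
    rw [ht] at e1
    have e2 : extDAt θ ((extChartAt 𝓘(ℝ, E) p).symm y) T
      (dAt E E (extChartAt 𝓘(ℝ, E) p).symm y w) = 0 := hT.2 _
    have e3 : α y t = 1 := by
      change covAt θ _ (dAt E E (extChartAt 𝓘(ℝ, E) p).symm y t) = 1
      rw [ht]; exact hT.1
    rw [hRv, ← e1, e2, e3]; ring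
  have h8 : (R y).inverse (α y) = t := h3.1 (by rw [apply_inverse_apply h3, h7])
  rw [h8, ht]
  exact hT

end Charts

/-! ### The contact form of the target adapted to the map. -/

section AdaptedContact

variable {E : Type*} [NormedAddCommGroup E] [NormedSpace ℝ E]
  {M : Type*} [TopologicalSpace M] [ChartedSpace E M] [IsManifold 𝓘(ℝ, E) ∞ M]
  {E' : Type*} [NormedAddCommGroup E'] [NormedSpace ℝ E']
  {M' : Type*} [TopologicalSpace M'] [ChartedSpace E' M'] [IsManifold 𝓘(ℝ, E') ∞ M']
  {n n' : ℕ} {S : CRStructure E M n} {S' : CRStructure E' M' n'}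

/-- Two contact forms are locally related by a smooth nonvanishing factor, here as a function in
the chart. -/
theorem IsContactForm.exists_factor {U U₀ : Set M} {θ θ₀ : OneForm E M ℝ}
    (hθ : IsContactForm S U θ) (hU : IsOpen U) (hθ₀ : IsContactForm S U₀ θ₀) (hU₀ : IsOpen U₀)
    {p : M} (hp : p ∈ U) (hp₀ : p ∈ U₀) :
    ∃ c : E → ℝ, c (extChartAt 𝓘(ℝ, E) p p) ≠ 0 ∧
      ∀ᶠ y in 𝓝 (extChartAt 𝓘(ℝ, E) p p), ContDiffAt ℝ ∞ c y ∧
        θ ((extChartAt 𝓘(ℝ, E) p).symm y) = c y • θ₀ ((extChartAt 𝓘(ℝ, E) p).symm y) := by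
  let α := chartRep θ p
  let α₀ := chartRep θ₀ p
  have hψ := tendsto_extChartAt_symm (E := E) p
  have hα : ∀ᶠ y in 𝓝 (extChartAt 𝓘(ℝ, E) p p), ContDiffAt ℝ ∞ α y ∧ ContDiffAt ℝ ∞ α₀ y := by
    filter_upwards [hψ.eventually (hU.mem_nhds hp), hψ.eventually (hU₀.mem_nhds hp₀),
      extChartAt_target_mem_nhds (I := 𝓘(ℝ, E)) p] with y h1 h1' h2
    have h3 : (extChartAt 𝓘(ℝ, E) p).symm y ∈ (chartAt E p).source := by
      simpa using (extChartAt 𝓘(ℝ, E) p).map_target h2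
    have h4 := (smoothFormAt_iff h3).1 (hθ.smoothFormAt hU h1)
    have h5 := (smoothFormAt_iff h3).1 (hθ₀.smoothFormAt hU₀ h1')
    rw [(extChartAt 𝓘(ℝ, E) p).right_inv h2] at h4 h5
    exact ⟨h4, h5⟩
  obtain ⟨u, hu⟩ : ∃ u : E, covAt θ₀ p u ≠ 0 := by
    by_contra! h0
    exact hθ₀.ne_zero p hp₀ (ContinuousLinearMap.ext h0)
  have hαu : ∀ᶠ y in 𝓝 (extChartAt 𝓘(ℝ, E) p p), α₀ y u ≠ 0 := by
    have h1 : ContinuousAt (fun y ↦ α₀ y u) (extChartAt 𝓘(ℝ, E) p p) :=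
      hα.self_of_nhds.2.continuousAt.clm_apply continuousAt_const
    refine h1.eventually_ne ?_
    simp only [α₀, chartRep_self]
    exact hu
  refine ⟨fun y ↦ α y u / α₀ y u, ?_, ?_⟩
  · refine div_ne_zero ?_ hαu.self_of_nhds
    obtain ⟨c, hc⟩ := S.exists_eq_smul (hθ₀.ne_zero p hp₀) (hθ₀.annihilates p hp₀)
      (hθ.annihilates p hp)
    have h1 : covAt θ p u = c * covAt θ₀ p u := DFunLike.congr_fun hc u
    simp only [α, chartRep_self]
    rw [h1]
    refine mul_ne_zero ?_ hu
    rintro rfl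
    exact hθ.ne_zero p hp (by rw [hc, zero_smul])
  · filter_upwards [hα, hαu, hψ.eventually (hU.mem_nhds hp), hψ.eventually (hU₀.mem_nhds hp₀)]
      with y h1 h2 h3 h4
    refine ⟨(h1.1.clm_apply contDiffAt_const).div (h1.2.clm_apply contDiffAt_const) h2, ?_⟩
    obtain ⟨c, hc⟩ := S.exists_eq_smul (hθ₀.ne_zero _ h4) (hθ₀.annihilates _ h4)
      (hθ.annihilates _ h3)
    have h5 : α y u = c * α₀ y u :=
      DFunLike.congr_fun hc (dAt E E (extChartAt 𝓘(ℝ, E) p).symm y u)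
    rw [h5, mul_div_assoc, div_self h2, mul_one]
    exact hc

theorem IsContactForm.smul {U : Set M} {θ : OneForm E M ℝ} (hθ : IsContactForm S U θ)
    {W : Set M} (hW : IsOpen W) (hWU : W ⊆ U) (hU : IsOpen U) {c : M → ℝ}
    (hc : ∀ q ∈ W, ContMDiffAt 𝓘(ℝ, E) 𝓘(ℝ, ℝ) ∞ c q) (hc0 : ∀ q ∈ W, c q ≠ 0) :
    IsContactForm S W (fun q ↦ c q • θ q) := by
  refine ⟨(smoothForm_iff hW).2 fun q hq ↦ (hθ.smoothFormAt hU (hWU hq)).smulReal (hc q hq),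
    fun q hq ↦ smul_ne_zero (hc0 q hq) (hθ.ne_zero q (hWU hq)), fun q hq ↦ ?_⟩
  have h1 : toComplex q (c q • θ q) = (c q : ℂ) • toComplex q (θ q) := by
    ext v
    simp [toComplex]
  rw [h1]
  exact Submodule.smul_mem _ _ (hθ.annihilates q (hWU hq))

/-- A contact form of the source of a transversal CR map is locally the pullback of a contact form
of the target whose characteristic vector field is tangent to the image. -/
theorem IsCRMap.exists_adapted_contact {f : M → M'} (hf : IsCRMap S S' f)
    (hft : ∀ p : M, CRTransversalAt (E := E) S' f p) (hS : S.LeviNondegenerate)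
    {U : Set M} {θ : OneForm E M ℝ} (hθ : IsContactForm S U θ) (hU : IsOpen U) {p : M} (hp : p ∈ U) :
    ∃ (U' : Set M') (θ' : OneForm E' M' ℝ), IsOpen U' ∧ f p ∈ U' ∧ IsContactForm S' U' θ' ∧
      ∀ᶠ x in 𝓝 p, pullAt f θ' x = θ x ∧
        ∀ T, IsReebAt θ x T → IsReebAt θ' (f x) (mfderiv 𝓘(ℝ, E) 𝓘(ℝ, E') f x T) := by
  have := S.finiteDimensional
  have := S'.finiteDimensional
  obtain ⟨U₀', θ₀, hU₀', hp', hθ₀⟩ := S'.exists_isContactForm (f p)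
  have hpull := hf.isContactForm_pullAt hft hU₀' hθ₀
  have hU₀ : IsOpen (f ⁻¹' U₀') := hU₀'.preimage hf.smooth.continuous
  obtain ⟨c, hc0, hc⟩ := hθ.exists_factor hU hpull hU₀ hp hp'
  obtain ⟨τ, hτ⟩ := hθ.exists_smooth_reeb hU hS hp
  let φ := extChartAt 𝓘(ℝ, E) p
  let φ' := extChartAt 𝓘(ℝ, E') (f p)
  let F : E → E' := writtenInExtChartAt 𝓘(ℝ, E) 𝓘(ℝ, E') p f
  have hFa : F (φ p) = φ' (f p) := writtenInExtChartAt_self f p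
  have hF : ∀ᶠ y in 𝓝 (φ p), ContDiffAt ℝ ∞ F y := eventually_contDiffAt_writtenInExtChartAt hf.smooth
  obtain ⟨G, hG, hGF⟩ := exists_smooth_left_inverse hF (by
    rw [← dAt_eq_fderiv_writtenInExtChartAt ((hf.smooth p).mdifferentiableAt (by norm_num))]
    exact hf.injective_dAt hft hS p)
  have hGa : G (F (φ p)) = φ p := hGF.self_of_nhds
  have hGt : Tendsto G (𝓝 (F (φ p))) (𝓝 (φ p)) := by
    have := hG.self_of_nhds.continuousAt
    rwa [ContinuousAt, hGa] at this
  have hFt : Tendsto F (𝓝 (φ p)) (𝓝 (F (φ p))) := hF.self_of_nhds.continuousAt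
  have hψ : Tendsto φ.symm (𝓝 (φ p)) (𝓝 p) := tendsto_extChartAt_symm (E := E) p
  have hψ' : Tendsto φ'.symm (𝓝 (φ' (f p))) (𝓝 (f p)) := tendsto_extChartAt_symm (E := E') (f p)
  have htar : ∀ᶠ y in 𝓝 (φ p), y ∈ φ.target := extChartAt_target_mem_nhds (I := 𝓘(ℝ, E)) p
  have htar' : ∀ᶠ y in 𝓝 (φ' (f p)), y ∈ φ'.target := extChartAt_target_mem_nhds (I := 𝓘(ℝ, E')) (f p)
  have hsrc : ∀ᶠ q in 𝓝 p, f q ∈ (chartAt E' (f p)).source :=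
    hf.smooth.continuous.continuousAt.eventually
      ((chartAt E' (f p)).open_source.mem_nhds (mem_chart_source E' (f p)))
  let ζ₀ : E' → E' →L[ℝ] ℝ := chartRep θ₀ (f p)
  -- The factor `c` lives on the source and is carried to the target by the left inverse `G`. This
  -- form pulls back to `θ`, but its characteristic vector need not be tangent to the image yet.
  let ζ : E' → E' →L[ℝ] ℝ := fun z ↦ c (G z) • ζ₀ z
  have hζ₀ : ∀ᶠ z in 𝓝 (F (φ p)), ContDiffAt ℝ ∞ ζ₀ z := by
    rw [hFa]
    filter_upwards [hψ'.eventually (hU₀'.mem_nhds hp'), htar'] with z h1 h2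
    have h3 : φ'.symm z ∈ (chartAt E' (f p)).source := by
      simpa [φ'] using (extChartAt 𝓘(ℝ, E') (f p)).map_target h2
    have h4 := (smoothFormAt_iff h3).1 (hθ₀.smoothFormAt hU₀' h1)
    have h5 : extChartAt 𝓘(ℝ, E') (f p) (φ'.symm z) = z := φ'.right_inv h2
    rwa [h5] at h4
  have hcG : ∀ᶠ z in 𝓝 (F (φ p)), ContDiffAt ℝ ∞ (fun z ↦ c (G z)) z := by
    filter_upwards [hG, hGt.eventually hc] with z h1 h2
    exact h2.1.comp z h1
  have hζ : ∀ᶠ z in 𝓝 (F (φ p)), ContDiffAt ℝ ∞ ζ z := by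
    filter_upwards [hζ₀, hcG] with z h1 h2
    exact h2.smul h1
  -- Equality in a neighborhood of every nearby `y` is needed, since it is going to be
  -- differentiated at `y`.
  have hpb : ∀ᶠ y in 𝓝 (φ p), ∀ᶠ x in 𝓝 y, ∀ v, ζ (F x) (fderiv ℝ F x v) = chartRep θ p x v := by
    rw [eventually_eventually_nhds]
    filter_upwards [hGF, hc, htar, hψ.eventually hsrc] with y h1 h2 h3 h4 v
    have h5 := dAt_symm_fderiv_writtenInExtChartAt hf.smooth h3 h4 v
    have h7 : φ'.symm (F y) = f (φ.symm y) := φ'.left_inv (mem_extChartAt_source' h4)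
    have h6 : ζ₀ (F y) (fderiv ℝ F y v) = covAt (pullAt (E := E) f θ₀) (φ.symm y)
        (dAt E E φ.symm y v) := by
      change covAt θ₀ (φ'.symm (F y)) (dAt E' E' φ'.symm (F y) (fderiv ℝ F y v)) = _
      rw [h7]
      exact congrArg (covAt θ₀ (f (φ.symm y))) h5
    have h8 : covAt θ (φ.symm y) (dAt E E φ.symm y v) =
      c y * covAt (pullAt (E := E) f θ₀) (φ.symm y) (dAt E E φ.symm y v) :=
      DFunLike.congr_fun h2.2 _
    change c (G (F y)) * ζ₀ (F y) (fderiv ℝ F y v) = covAt θ (φ.symm y) (dAt E E φ.symm y v)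
    rw [h1, h6, h8]
  have hx1 : ∀ᶠ y in 𝓝 (φ p), ζ (F y) (fderiv ℝ F y (τ y)) = 1 := by
    filter_upwards [hpb, hτ] with y h1 h2
    rw [h1.self_of_nhds]
    exact h2.2.1
  have hx2 : ∀ᶠ y in 𝓝 (φ p), ∀ w, fderiv ℝ ζ (F y) (fderiv ℝ F y (τ y)) (fderiv ℝ F y w) -
      fderiv ℝ ζ (F y) (fderiv ℝ F y w) (fderiv ℝ F y (τ y)) = 0 := by
    filter_upwards [hpb, hτ, hF, hFt.eventually hζ, htar, hψ.eventually (hU.mem_nhds hp)]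
      with y h1 h2 h3 h4 h5 h6 w
    have e1 := extDAt_pullAt (f := F) (η := (ζ : OneForm E' E' ℝ)) h3.contMDiffAt
      (smoothFormAt_model_iff.2 h4) (τ y) w
    have e2 : extDAt (pullAt (E := E) F (ζ : OneForm E' E' ℝ)) y =
        extDAt (chartRep θ p : OneForm E E ℝ) y := by
      refine extDAt_congr (h1.mono fun x hx ↦ ContinuousLinearMap.ext fun v ↦ ?_)
      have e3 : covAt (pullAt (E := E) F (ζ : OneForm E' E' ℝ)) x v = ζ (F x) (dAt E E' F x v) := rfl
      rw [dAt_eq_fderiv, hx v] at e3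
      exact e3
    rw [e2, dAt_eq_fderiv] at e1
    have e6 := extDAt_model (chartRep θ p : OneForm E E ℝ) y (τ y) w
    have e7 := extDAt_model (ζ : OneForm E' E' ℝ) (F y) (fderiv ℝ F y (τ y)) (fderiv ℝ F y w)
    have e4 := extDAt_chart h5 (hθ.smoothFormAt hU h6) (τ y) w
    have e5 : extDAt θ (φ.symm y) (dAt E E φ.symm y (τ y)) (dAt E E φ.symm y w) = 0 := h2.2.2 _
    exact e7.symm.trans (e1.symm.trans (e6.trans (e4.symm.trans e5)))
  obtain ⟨u, hu, hu'⟩ := exists_rescaling hF hG hGF hζ (hτ.mono fun y hy ↦ hy.1) hx1 hx2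
  -- The total factor applied to the original contact form `θ₀`; it is nonzero near `f p`, since
  -- along the image `u = 1` and it reduces to `c`.
  let κ : E' → ℝ := fun z ↦ u z * c (G z)
  have hκ : ∀ᶠ z in 𝓝 (φ' (f p)), ContDiffAt ℝ ∞ κ z ∧ κ z ≠ 0 := by
    rw [← hFa]
    have h1 : ∀ᶠ z in 𝓝 (F (φ p)), ContDiffAt ℝ ∞ κ z := by
      filter_upwards [hu, hcG] with z h1 h2
      exact h1.mul h2
    refine h1.and (h1.self_of_nhds.continuousAt.eventually_ne ?_)
    simp only [κ, hGa, hu'.self_of_nhds.1, one_mul]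
    exact hc0
  have hφ' : Tendsto φ' (𝓝 (f p)) (𝓝 (φ' (f p))) := continuousAt_extChartAt (f p)
  have hφ : Tendsto φ (𝓝 p) (𝓝 (φ p)) := continuousAt_extChartAt p
  obtain ⟨U', hU's, hU'o, hU'p⟩ := mem_nhds_iff.1 ((hφ'.eventually hκ).and
    ((show ∀ᶠ q in 𝓝 (f p), q ∈ U₀' from hU₀'.mem_nhds hp').and
      (show ∀ᶠ q in 𝓝 (f p), q ∈ (chartAt E' (f p)).source from
        (chartAt E' (f p)).open_source.mem_nhds (mem_chart_source E' (f p)))))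
  let θ' : OneForm E' M' ℝ := fun q ↦ κ (φ' q) • θ₀ q
  have hθ' : IsContactForm S' U' θ' := hθ₀.smul (c := fun q ↦ κ (φ' q)) hU'o
    (fun q hq ↦ (hU's hq).2.1) hU₀'
    (fun q hq ↦ (contMDiffAt_comp_extChartAt_iff (hU's hq).2.2).2 (hU's hq).1.1)
    (fun q hq ↦ (hU's hq).1.2)
  refine ⟨U', θ', hU'o, hU'p, hθ', ?_⟩
  have hmain : ∀ᶠ y in 𝓝 (φ p), pullAt f θ' (φ.symm y) = θ (φ.symm y) ∧
      ∀ T, IsReebAt θ (φ.symm y) T →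
        IsReebAt θ' (f (φ.symm y)) (mfderiv 𝓘(ℝ, E) 𝓘(ℝ, E') f (φ.symm y) T) := by
    have hfψ : ∀ᶠ y in 𝓝 (φ p), f (φ.symm y) ∈ U' :=
      (hf.smooth.continuous.continuousAt.tendsto.comp hψ).eventually (hU'o.mem_nhds hU'p)
    filter_upwards [hu', hGF, hc, htar, hψ.eventually hsrc, hfψ, hτ,
      hψ.eventually (hU.mem_nhds hp)] with y h1 h2 h3 h4 h5 h6 h7 h8
    have hFy : F y = φ' (f (φ.symm y)) := rfl
    have hsy : φ'.symm (F y) = f (φ.symm y) := φ'.left_inv (mem_extChartAt_source' h5)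
    have hty : F y ∈ φ'.target := φ'.map_source (mem_extChartAt_source' h5)
    have hκy : κ (φ' (f (φ.symm y))) = c y := by
      rw [← hFy]; simp only [κ, h1.1, h2, one_mul]
    have hpul : pullAt f θ' (φ.symm y) = θ (φ.symm y) := by
      rw [h3.2, ← hκy]
      rfl
    refine ⟨hpul, fun T hT ↦ ?_⟩
    have hTτ : T = dAt E E φ.symm y (τ y) := hθ.reeb_unique hU hS h8 hT h7.2
    refine ⟨?_, fun v ↦ ?_⟩
    · have := DFunLike.congr_fun hpul T
      rw [hT.1] at this
      exact this
    · have hrep : chartRep θ' (f p) =ᶠ[𝓝 (F y)] fun z ↦ u z • ζ z := by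
        filter_upwards [extChartAt_target_mem_nhds' hty] with z hz
        have e1 : chartRep θ' (f p) z = κ (φ' (φ'.symm z)) • ζ₀ z := rfl
        rw [e1, φ'.right_inv hz]
        simp only [κ, ζ, smul_smul]
      have e2 := extDAt_chart (η := θ') hty
        (by rw [hsy]; exact hθ'.smoothFormAt hU'o h6) (fderiv ℝ F y (τ y))
        (dAt E' E' φ' (f (φ.symm y)) v)
      rw [hrep.fderiv_eq, h1.2, dAt_symm_fderiv_writtenInExtChartAt hf.smooth h4 h5] at e2
      have e3 : dAt E' E' φ'.symm (F y) (dAt E' E' φ' (f (φ.symm y)) v) = v :=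
        DFunLike.congr_fun (dAt_symm_comp_dAt h5) v
      have e4 : extDAt θ' (φ'.symm (F y)) (dAt E E' f (φ.symm y) (dAt E E φ.symm y (τ y)))
        (dAt E' E' φ'.symm (F y) (dAt E' E' φ' (f (φ.symm y)) v)) = 0 := e2
      rw [e3, hsy, ← hTτ] at e4
      exact e4
  filter_upwards [hφ.eventually hmain, (chartAt E p).open_source.mem_nhds (mem_chart_source E p)]
    with x h1 h2
  have h3 : φ.symm (φ x) = x := φ.left_inv (mem_extChartAt_source' h2)
  rw [h3] at h1
  exact h1

end AdaptedContact

/-! ### Coframes of the target that pull back to a given coframe. -/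

section Coframe

variable {E : Type*} [NormedAddCommGroup E] [NormedSpace ℝ E]
  {M : Type*} [TopologicalSpace M] [ChartedSpace E M] [IsManifold 𝓘(ℝ, E) ∞ M]
  {E' : Type*} [NormedAddCommGroup E'] [NormedSpace ℝ E']
  {M' : Type*} [TopologicalSpace M'] [ChartedSpace E' M'] [IsManifold 𝓘(ℝ, E') ∞ M']
  {n n' : ℕ} {S : CRStructure E M n} {S' : CRStructure E' M' n'}

theorem HasLeviMatrixAt.conjTranspose {ι : Type*} [DecidableEq ι] {θ : OneForm E M ℝ}
    {θα : ι → OneForm E M ℂ} {p : M} {g : Matrix ι ι ℂ} (h : HasLeviMatrixAt θ θα p g) :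
    gᴴ = g := by
  obtain ⟨L, -, -, -, h3⟩ := h
  ext i j
  rw [Matrix.conjTranspose_apply, ← h3, ← h3]
  exact leviForm_conj_symm θ p _ _

namespace IsAdmissibleCoframe

variable {U : Set M} {θ : OneForm E M ℝ} {ι κ : Type*} [Fintype ι] [DecidableEq ι]
  [Fintype κ] [DecidableEq κ] {θα : ι → OneForm E M ℂ}

/-- A null vector of the transposed matrix gives the components of a vector Levi-orthogonal to all
of `T^{1,0}`. -/
theorem isUnit_leviMatrix (h : IsAdmissibleCoframe S U θ θα) (hU : IsOpen U)
    (hS : S.LeviNondegenerate) {p : M} (hp : p ∈ U) {g : Matrix ι ι ℂ}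
    (hg : HasLeviMatrixAt θ θα p g) : IsUnit g := by
  obtain ⟨L, h0, h1, h2, h3⟩ := hg
  have hL : ∀ α, S.IsHol p (L α) := fun α ↦ h.isHol_of_dual hp (h0 α) (h2 α)
  rw [← Matrix.isUnit_transpose]
  refine isUnit_of_mulVec_eq_zero fun c hc ↦ ?_
  have hZ : S.IsHol p (∑ i, c i • L i) := by
    rw [CRStructure.IsHol, map_sum]
    exact Submodule.sum_mem _ fun i _ ↦ by
      rw [conjT_smul]; exact Submodule.smul_mem _ _ (hL i)
  have hZ0 : ∑ i, c i • L i = 0 := by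
    refine hS p U θ hU hp h.contact _ hZ fun W hW ↦ ?_
    rw [h.eq_sum hp hL h1 hW, leviForm_sum_right]
    refine Finset.sum_eq_zero fun j _ ↦ ?_
    rw [leviForm_sum_left]
    have := congrFun hc j
    simp only [Matrix.mulVec, dotProduct, Matrix.transpose_apply, Pi.zero_apply] at this
    simp only [h3, mul_comm (c _), this, mul_zero]
  funext j
  have := congrArg (evalC p (θα j p)) hZ0
  simpa [h1] using this

theorem reindex (h : IsAdmissibleCoframe S U θ θα) (hU : IsOpen U) (e : ι ≃ κ) :
    IsAdmissibleCoframe S U θ (fun k ↦ θα (e.symm k)) := by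
  have h1 := h.change hU (C := fun _ ↦ (1 : Matrix ι ι ℂ).submatrix e.symm id)
    (D := fun _ ↦ (1 : Matrix ι ι ℂ).submatrix id e.symm)
    (fun k i q _ ↦ contMDiffAt_const)
    (fun q _ ↦ by
      ext i j
      simp [Matrix.mul_apply, Matrix.one_apply])
    (fun q _ ↦ by
      ext i j
      exact (Equiv.sum_comp e.symm fun k ↦ (1 : Matrix ι ι ℂ) i k * (1 : Matrix ι ι ℂ) k j).trans
        (by rw [← Matrix.mul_apply, one_mul]))
  convert h1 using 3 with k q
  simp [Matrix.one_apply]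

end IsAdmissibleCoframe

theorem HasLeviMatrixAt.reindex {ι κ : Type*} [DecidableEq ι] [DecidableEq κ]
    {θ : OneForm E M ℝ} {θα : ι → OneForm E M ℂ} {p : M} {g : Matrix ι ι ℂ}
    (h : HasLeviMatrixAt θ θα p g) (e : ι ≃ κ) :
    HasLeviMatrixAt θ (fun k ↦ θα (e.symm k)) p (g.submatrix e.symm e.symm) := by
  obtain ⟨L, h0, h1, h2, h3⟩ := h
  refine ⟨fun k ↦ L (e.symm k), fun k ↦ h0 _, fun k k' ↦ ?_, fun k k' ↦ h2 _ _, fun k k' ↦ h3 _ _⟩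
  rw [h1]
  simp

/-- The components of the pullback of an admissible coframe. -/
theorem IsCRMap.exists_pullback_matrix {f : M → M'} (hf : IsCRMap S S' f)
    (hi : ∀ p, Function.Injective (dAt E E' f p)) (hS : S.LeviNondegenerate)
    {U : Set M} (hU : IsOpen U) {θ : OneForm E M ℝ} {θα : Fin n → OneForm E M ℂ}
    (hθ : IsAdmissibleCoframe S U θ θα) {p : M} (hp : p ∈ U)
    {κ : Type*} [Fintype κ] [DecidableEq κ]
    {U' : Set M'} (hU' : IsOpen U') {θ' : OneForm E' M' ℝ} {φ : κ → OneForm E' M' ℂ}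
    (hφ : IsAdmissibleCoframe S' U' θ' φ) (hp' : f p ∈ U')
    (hT : ∀ᶠ x in 𝓝 p, ∀ T, IsReebAt θ x T → IsReebAt θ' (f x) (mfderiv 𝓘(ℝ, E) 𝓘(ℝ, E') f x T)) :
    ∃ h : M → Matrix κ (Fin n) ℂ, (∀ᶠ x in 𝓝 p, SmoothMatAt E h x) ∧
      (∀ v, h p *ᵥ v = 0 → v = 0) ∧
      ∀ᶠ x in 𝓝 p, ∀ k, pullAt f (φ k) x = ∑ α, h x k α • θα α x := by
  obtain ⟨U₀, X, Y, hp₀, hF⟩ := S.exists_isFrame p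
  let L : ∀ (j : Fin n) (q : M), CTangent (E := E) q := fun j q ↦ cvec q (X j q) (-Y j q)
  -- Both coframes are evaluated on one local frame `L` of `T^{1,0}`; the coefficient matrix is then
  -- `a b⁻¹`, which is visibly smooth.
  let a : M → Matrix κ (Fin n) ℂ := fun x k j ↦ evalC x (pullAt f (φ k) x) (L j x)
  let b : M → Matrix (Fin n) (Fin n) ℂ := fun x α j ↦ evalC x (θα α x) (L j x)
  have hnear : ∀ᶠ x in 𝓝 p, x ∈ U ∧ x ∈ U₀ ∧ f x ∈ U' :=
    (show ∀ᶠ x in 𝓝 p, x ∈ U from hU.mem_nhds hp).and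
      ((show ∀ᶠ x in 𝓝 p, x ∈ U₀ from hF.isOpen.mem_nhds hp₀).and
        (hf.smooth.continuous.continuousAt.eventually (hU'.mem_nhds hp')))
  have ha : ∀ᶠ x in 𝓝 p, SmoothMatAt E a x := hnear.mono fun x hx k j ↦
    hF.smoothFunAt_evalC hx.2.1
      (SmoothFormAt.pullAt (η := φ k) (hf.smooth x) (hφ.smoothFormAt hU' hx.2.2 k)) j
  have hb : ∀ᶠ x in 𝓝 p, SmoothMatAt E b x := hnear.mono fun x hx α j ↦
    hF.smoothFunAt_evalC hx.2.1 (hθ.smoothFormAt hU hx.1 α) j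
  have hol : ∀ x ∈ U₀, ∀ c : Fin n → ℂ, S.IsHol x (∑ j, c j • L j x) := fun x hx c ↦ by
    rw [CRStructure.IsHol, map_sum]
    exact Submodule.sum_mem _ fun i _ ↦ by
      rw [conjT_smul]; exact Submodule.smul_mem _ _ (hF.isHol hx i)
  have hbu : ∀ x, x ∈ U → x ∈ U₀ → IsUnit (b x) := fun x hx hx₀ ↦ by
    refine isUnit_of_mulVec_eq_zero fun c hc ↦ hF.eq_zero_of_sum_eq_zero hx₀ ?_
    refine hθ.eq_zero hx (hol x hx₀ c) fun α ↦ ?_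
    have := congrFun hc α
    simp only [Matrix.mulVec, dotProduct, Pi.zero_apply, b] at this
    simp only [map_sum, map_smul, smul_eq_mul, mul_comm (c _)]
    exact this
  have hab : ∀ x, x ∈ U → x ∈ U₀ → a x * (b x)⁻¹ * b x = a x := fun x hx hx₀ ↦
    Matrix.nonsing_inv_mul_cancel_right _ _ ((Matrix.isUnit_iff_isUnit_det _).1 (hbu x hx hx₀))
  refine ⟨fun x ↦ a x * (b x)⁻¹, ?_, fun v hv ↦ ?_, ?_⟩
  · filter_upwards [ha, hb, hnear] with x h1 h2 h3
    exact h1.mul (h2.inv (hbu x h3.1 h3.2.1))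
  · set c := (b p)⁻¹ *ᵥ v with hc
    have hac : a p *ᵥ c = 0 := by rw [hc, Matrix.mulVec_mulVec]; exact hv
    have hbc : b p *ᵥ c = v := by
      rw [hc, Matrix.mulVec_mulVec,
        Matrix.mul_nonsing_inv _ ((Matrix.isUnit_iff_isUnit_det _).1 (hbu p hp hp₀)),
        Matrix.one_mulVec]
    -- A kernel vector of the coefficient matrix gives a `(1,0)`-vector whose image is killed by the
    -- target coframe, hence zero; injectivity of `df` on real and imaginary parts finishes.
    have hpush : pushC E E' f p (∑ j, c j • L j p) = 0 := by
      refine hφ.eq_zero hp' (hf.isHol (hol p hp₀ c)) fun k ↦ ?_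
      have := congrFun hac k
      simp only [Matrix.mulVec, dotProduct, Pi.zero_apply, a, evalC_pullAt] at this
      simp only [map_sum, map_smul, smul_eq_mul, mul_comm (c _)]
      exact this
    have hZ : ∑ j, c j • L j p = 0 := by
      obtain ⟨v, w, hvw⟩ := exists_cvec p (∑ j, c j • L j p)
      rw [hvw, pushC_cvec] at hpush
      have e1 : mfderiv 𝓘(ℝ, E) 𝓘(ℝ, E') f p v = 0 := by
        simpa using congrArg (reT (f p)) hpush
      have e2 : mfderiv 𝓘(ℝ, E) 𝓘(ℝ, E') f p w = 0 := by
        simpa using congrArg (imT (f p)) hpush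
      rw [hvw, hi p (e1.trans (map_zero (dAt E E' f p)).symm),
        hi p (e2.trans (map_zero (dAt E E' f p)).symm)]
      exact cvec_zero p
    rw [← hbc, hF.eq_zero_of_sum_eq_zero hp₀ hZ, Matrix.mulVec_zero]
  · filter_upwards [hnear, hT] with x h1 h2 k
    obtain ⟨T, hTx⟩ := hθ.contact.exists_isReebAt hU hS h1.1
    refine hθ.contact.holCotangent_ext h1.1 hTx.1 (hf.pullAt_mem (hφ.mem_holCotangent h1.2.2 k))
      (Submodule.sum_mem _ fun α _ ↦ Submodule.smul_mem _ _ (hθ.mem_holCotangent h1.1 α)) ?_ ?_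
    -- This is where the choice of contact form enters: `df(T)` is characteristic, so the pulled
    -- back form has no `θ` component.
    · have e1 : pullAt f (φ k) x T = 0 := hφ.reeb (f x) h1.2.2 _ (h2 T hTx) k
      rw [e1]
      simp [hθ.reeb x h1.1 T hTx]
    · intro Z hZ
      obtain ⟨c, rfl⟩ := hF.exists_eq_of_isHol h1.2.1 hZ
      simp only [map_sum, map_smul, smul_eq_mul]
      refine Finset.sum_congr rfl fun j _ ↦ congrArg (c j * ·) ?_
      rw [evalC_sum]
      exact congrFun (congrFun (hab x h1.1 h1.2.1) k) j

/-- The index set of a coframe of the target, split into tangential and normal indices. -/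
def splitIndex {n n' : ℕ} (h : n ≤ n') : Fin n' ≃ Fin n ⊕ Fin (n' - n) :=
  (finCongr (by omega)).trans finSumFinEquiv.symm

/-- Adapted coframes along a transversal CR map, with smooth Levi matrix. -/
theorem IsCRMap.exists_pullsBackTo {f : M → M'} (hf : IsCRMap S S' f)
    (hft : ∀ p : M, CRTransversalAt (E := E) S' f p) (hS : S.LeviNondegenerate)
    (hS' : S'.LeviNondegenerate) {U : Set M} (hU : IsOpen U) {θ : OneForm E M ℝ}
    {θα : Fin n → OneForm E M ℂ} (hθ : IsAdmissibleCoframe S U θ θα) {p : M} (hp : p ∈ U) :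
    ∃ (W : Set M) (W' : Set M') (θ' : OneForm E' M' ℝ) (ψ : Fin n ⊕ Fin (n' - n) → OneForm E' M' ℂ)
      (G : M' → Matrix (Fin n ⊕ Fin (n' - n)) (Fin n ⊕ Fin (n' - n)) ℂ),
      p ∈ W ∧ W ⊆ U ∧
      PullsBackTo S' f W W' θ θα θ' (fun α ↦ ψ (Sum.inl α)) (fun a ↦ ψ (Sum.inr a)) ∧
      ∀ q ∈ W', SmoothMatAt E' G q ∧ HasLeviMatrixAt θ' ψ q (G q) := by
  have := S.finiteDimensional
  have := S'.finiteDimensional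
  have hi := hf.injective_dAt hft hS
  obtain ⟨U', θ', hU', hp', hθ', hpull⟩ := hf.exists_adapted_contact hft hS hθ.contact hU hp
  obtain ⟨W₁, φ₀, G₀, hW₁, hpW₁, hWU', hφ₀, hG₀, hG₀'⟩ := hθ'.exists_coframe hU' hS' hp'
  let e := splitIndex (hf.dim_le hft hS p)
  let φ : Fin n ⊕ Fin (n' - n) → OneForm E' M' ℂ := fun k ↦ φ₀ (e.symm k)
  have hφ : IsAdmissibleCoframe S' W₁ θ' φ := hφ₀.reindex hW₁ e
  obtain ⟨h, hh, hinj, hφh⟩ := hf.exists_pullback_matrix hi hS hU hθ hp hW₁ hφ hpW₁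
    (hpull.mono fun x hx ↦ hx.2)
  obtain ⟨N, hN⟩ := exists_isUnit_fromCols (h p) hinj
  obtain ⟨g, hg, hgf⟩ := exists_smooth_left_inverse_manifold hf.smooth (hi p)
  have hgp : g (f p) = p := hgf.self_of_nhds
  have hgt : Tendsto g (𝓝 (f p)) (𝓝 p) := by
    have := hg.self_of_nhds.continuousAt
    rwa [ContinuousAt, hgp] at this
  -- The coefficient matrix, extended off the image by the left inverse `g`, is completed by
  -- constant columns `N` to a matrix invertible near `f p`. Along the image its first `n` columns
  -- are `h`, so `P⁻¹` turns `f^* φ = h θ` into `(θ^α, 0)`.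
  let P : M' → Matrix (Fin n ⊕ Fin (n' - n)) (Fin n ⊕ Fin (n' - n)) ℂ :=
    fun q ↦ Matrix.fromCols (h (g q)) N
  have hP : ∀ᶠ q in 𝓝 (f p), SmoothMatAt E' P q := by
    filter_upwards [hg, hgt.eventually hh] with q h1 h2
    exact (h2.comp_map h1).fromCols (.const _)
  have hPu : ∀ᶠ q in 𝓝 (f p), IsUnit (P q) := hP.self_of_nhds.eventually_isUnit (by
    simp only [P, hgp]; exact hN)
  obtain ⟨W', hW's, hW'o, hpW'⟩ := mem_nhds_iff.1 ((hP.and hPu).and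
    (show ∀ᶠ q in 𝓝 (f p), q ∈ W₁ from hW₁.mem_nhds hpW₁))
  obtain ⟨W, hWs, hWo, hpW⟩ := mem_nhds_iff.1 ((hpull.and (hφh.and hgf)).and
    ((show ∀ᶠ x in 𝓝 p, x ∈ U from hU.mem_nhds hp).and
      (hf.smooth.continuous.continuousAt.eventually (hW'o.mem_nhds hpW'))))
  have hW'W₁ : W' ⊆ W₁ := fun q hq ↦ (hW's hq).2
  have hdet : ∀ q ∈ W', IsUnit (P q).det := fun q hq ↦
    (Matrix.isUnit_iff_isUnit_det _).1 (hW's hq).1.2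
  let ψ : Fin n ⊕ Fin (n' - n) → OneForm E' M' ℂ := fun k q ↦ ∑ i, (P q)⁻¹ k i • φ i q
  have hψ : IsAdmissibleCoframe S' W' θ' ψ := (hφ.mono hW'W₁).change hW'o
    (C := fun q ↦ (P q)⁻¹) (D := P)
    (fun k i q hq ↦ ((hW's hq).1.1.inv (hW's hq).1.2) k i)
    (fun q hq ↦ Matrix.nonsing_inv_mul _ (hdet q hq))
    (fun q hq ↦ Matrix.mul_nonsing_inv _ (hdet q hq))
  have hpb : ∀ x ∈ W, ∀ k, pullAt (E := E) f (ψ k) x =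
      ∑ α : Fin n, (1 : Matrix (Fin n ⊕ Fin (n' - n)) (Fin n ⊕ Fin (n' - n)) ℂ) k (Sum.inl α) • θα α x := by
    intro x hx k
    have hfx : f x ∈ W' := (hWs hx).2.2
    have h1 : (P (f x))⁻¹ * P (f x) = 1 := Matrix.nonsing_inv_mul _ (hdet _ hfx)
    rw [← h1]
    refine (pullAt_sum_smul f (fun q i ↦ (P q)⁻¹ k i) φ x).trans ?_
    simp only [(hWs hx).1.2.1, Finset.smul_sum, smul_smul]
    rw [Finset.sum_comm]
    refine Finset.sum_congr rfl fun α _ ↦ ?_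
    rw [← Finset.sum_smul, Matrix.mul_apply]
    congr 1
    refine Finset.sum_congr rfl fun i _ ↦ ?_
    have h2 : g (f x) = x := (hWs hx).1.2.2
    simp only [P, Matrix.fromCols_apply_inl, h2]
  refine ⟨W, W', θ', ψ, fun q ↦ (P q)ᵀ * (G₀ q).submatrix e.symm e.symm *
    (P q).map (starRingEnd ℂ), hpW, fun x hx ↦ (hWs hx).2.1,
    ⟨hWo, hW'o, fun x hx ↦ (hWs hx).2.2, ?_, fun x hx ↦ (hWs hx).1.1.1, fun x hx α ↦ ?_,
      fun x hx a ↦ ?_⟩, fun q hq ↦ ⟨?_, ?_⟩⟩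
  · rw [show (Sum.elim (fun α ↦ ψ (Sum.inl α)) fun a ↦ ψ (Sum.inr a)) = ψ from
      Sum.elim_comp_inl_inr ψ]
    exact hψ
  · rw [hpb x hx]
    simp [Matrix.one_apply]
  · rw [hpb x hx]
    simp
  · exact ((hW's hq).1.1.transpose.mul ((hG₀ q (hW'W₁ hq)).submatrix _ _)).mul (hW's hq).1.1.conj
  · exact ((hG₀' q (hW'W₁ hq)).reindex e).change (C := fun q ↦ (P q)⁻¹)
      (Matrix.nonsing_inv_mul _ (hdet q hq))

end Coframe

/-! ### Eigenvalue counts of the Levi form. -/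

section Signature

variable {E : Type*} [NormedAddCommGroup E] [NormedSpace ℝ E]
  {M : Type*} [TopologicalSpace M] [ChartedSpace E M] [IsManifold 𝓘(ℝ, E) ∞ M]
  {n : ℕ} {S : CRStructure E M n}

section
variable {U : Set M} {θ : OneForm E M ℝ} {ι : Type*} [Fintype ι] [DecidableEq ι]
  {θα : ι → OneForm E M ℂ}

/-- In the dual frame the Levi form is a weighted sum of squares of the coframe components; the
positive count is the negative count of the opposite form. -/
theorem IsAdmissibleCoframe.index_eq (h : IsAdmissibleCoframe S U θ θα) {p : M} (hp : p ∈ U)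
    {r : ι → ℝ} (hg : HasLeviMatrixAt θ θα p (Matrix.diagonal fun i ↦ (r i : ℂ))) :
    S.negIndex θ p = Nat.card {i // r i < 0} ∧ S.posIndex θ p = Nat.card {i // 0 < r i} := by
  obtain ⟨L, h0, h1, h2, h3⟩ := hg
  have hL : ∀ α, S.IsHol p (L α) := fun α ↦ h.isHol_of_dual hp (h0 α) (h2 α)
  let c : CTangent (E := E) p →ₗ[ℂ] (ι → ℂ) := LinearMap.pi fun i ↦ evalC p (θα i p)
  have hPL : ∀ a : ι → ℂ, S.IsHol p (∑ i, a i • L i) := fun a ↦ by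
    rw [CRStructure.IsHol, map_sum]
    exact Submodule.sum_mem _ fun i _ ↦ by
      rw [conjT_smul]; exact Submodule.smul_mem _ _ (hL i)
  have hcL : ∀ a : ι → ℂ, c (∑ i, a i • L i) = a := fun a ↦ by
    funext j
    simp [c, h1]
  have hq : ∀ Z, S.IsHol p Z → (leviForm θ p Z Z).re = ∑ i, r i * ‖c Z i‖ ^ 2 := by
    intro Z hZ
    have hZc : Z = ∑ i, c Z i • L i := h.eq_sum hp hL h1 hZ
    conv_lhs => rw [hZc]
    rw [leviForm_sum_left, Complex.re_sum]
    refine Finset.sum_congr rfl fun i _ ↦ ?_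
    rw [leviForm_sum_right]
    simp only [h3, Matrix.diagonal_apply, mul_ite, mul_zero, Finset.sum_ite_eq, Finset.mem_univ,
      if_true]
    rw [← mul_assoc, Complex.mul_conj, Complex.normSq_eq_norm_sq, ← Complex.ofReal_mul,
      Complex.ofReal_re, mul_comm]
  constructor
  · exact sSup_finrank_negative (S.IsHol p) (fun Z ↦ (leviForm θ p Z Z).re) r c L hPL hcL hq
  · have := sSup_finrank_negative (S.IsHol p) (fun Z ↦ -(leviForm θ p Z Z).re) (fun i ↦ -r i) c L
      hPL hcL fun Z hZ ↦ by simp [hq Z hZ]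
    simp only [neg_lt_zero] at this
    exact this

/-- At a point, contact forms with the same value have the same Levi form. -/
theorem IsContactForm.leviForm_eq {U' : Set M} {θ' : OneForm E M ℝ} (h : IsContactForm S U θ)
    (hU : IsOpen U) (h' : IsContactForm S U' θ') (hU' : IsOpen U') {p : M} (hp : p ∈ U)
    (hp' : p ∈ U') (he : θ' p = θ p) {Z W : CTangent (E := E) p} (hZ : S.IsHol p Z)
    (hW : S.IsHol p W) : leviForm θ' p Z W = leviForm θ p Z W := by
  have key : ∀ v w, θ p v = 0 → θ p w = 0 → extD θ' p v w = extD θ p v w := fun v w hv hw ↦ by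
    rw [h.extD_eq_mul hU hp h' hU' hp' (c := 1) (by rw [he, one_smul]) hv hw, one_mul]
  have hol : ∀ {v w}, S.IsHol p (cvec p v w) → θ p v = 0 ∧ θ p w = 0 := fun hZ ↦ by
    have := h.evalC_hol hp hZ
    rwa [evalC_toComplex_eq_zero] at this
  obtain ⟨v, w, rfl⟩ := exists_cvec p Z
  obtain ⟨v', w', rfl⟩ := exists_cvec p W
  obtain ⟨a1, a2⟩ := hol hZ
  obtain ⟨b1, b2⟩ := hol hW
  have b3 : θ p (-w') = 0 := by rw [map_neg, b2, neg_zero]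
  rw [leviForm, leviForm, conjT_cvec, extDC_cvec, extDC_cvec, key _ _ a1 b1, key _ _ a2 b3,
    key _ _ a1 b3, key _ _ a2 b1]

theorem IsContactForm.negIndex_eq {U' : Set M} {θ' : OneForm E M ℝ} (h : IsContactForm S U θ)
    (hU : IsOpen U) (h' : IsContactForm S U' θ') (hU' : IsOpen U') {p : M} (hp : p ∈ U)
    (hp' : p ∈ U') (he : θ' p = θ p) : S.negIndex θ' p = S.negIndex θ p := by
  unfold CRStructure.negIndex
  congr 1
  ext d
  refine exists_congr fun W ↦ and_congr_right fun _ ↦ forall₂_congr fun Z _ ↦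
    and_congr_right fun hZ ↦ ?_
  rw [h.leviForm_eq hU h' hU' hp hp' he hZ hZ]

end

/-- The real diagonal `(-1, …, -1, 1, …, 1)`. -/
def realSigns (m l : ℕ) : Fin m → ℝ := fun j ↦ if (j : ℕ) < l then -1 else 1

theorem ofReal_realSigns (m l : ℕ) (j : Fin m) : (realSigns m l j : ℂ) = signs m l j := by
  simp only [realSigns, signs]
  split_ifs <;> simp

theorem card_realSigns_neg (m l : ℕ) : Nat.card {j // realSigns m l j < 0} = min l m := by
  have h : ∀ j, realSigns m l j < 0 ↔ (j : ℕ) < l := fun j ↦ by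
    simp only [realSigns]
    split_ifs with h <;> simp [h]
  simp only [h]
  rw [Nat.card_eq_fintype_card, Fintype.card_subtype, Fin.card_filter_val_lt, min_comm]

theorem card_realSigns_pos (m l : ℕ) : Nat.card {j // 0 < realSigns m l j} = m - l := by
  have h : ∀ j, 0 < realSigns m l j ↔ ¬ realSigns m l j < 0 := fun j ↦ by
    simp only [realSigns]
    split_ifs with h <;> norm_num
  have h1 := card_realSigns_neg m l
  rw [Nat.card_eq_fintype_card] at h1 ⊢
  simp only [h]
  rw [Fintype.card_subtype_compl, h1, Fintype.card_fin]
  omega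

variable {U : Set M} {θ : OneForm E M ℝ}

/-- The minimum appears because `signs n l` makes sense for `l > n` as well and then has only `n`
negative entries. -/
theorem IsAdmissibleCoframe.index_signs {θα : Fin n → OneForm E M ℂ}
    (h : IsAdmissibleCoframe S U θ θα) {p : M} (hp : p ∈ U) {l : ℕ}
    (hg : HasLeviMatrixAt θ θα p (Matrix.diagonal (signs n l))) :
    S.negIndex θ p = min l n ∧ S.posIndex θ p = n - l := by
  rw [← card_realSigns_neg, ← card_realSigns_pos]
  exact h.index_eq hp (by simpa only [ofReal_realSigns] using hg)

theorem IsAdmissibleCoframe.index_signs_sum {a b : ℕ} {θα : Fin a ⊕ Fin b → OneForm E M ℂ}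
    (h : IsAdmissibleCoframe S U θ θα) {p : M} (hp : p ∈ U) {l j : ℕ}
    (hg : HasLeviMatrixAt θ θα p (Matrix.diagonal (Sum.elim (signs a l) (signs b j)))) :
    S.negIndex θ p = min l a + min j b ∧ S.posIndex θ p = (a - l) + (b - j) := by
  have h1 : Sum.elim (signs a l) (signs b j) =
      fun i ↦ ((Sum.elim (realSigns a l) (realSigns b j) i : ℝ) : ℂ) := by
    funext i
    rcases i with i | i <;> simp [ofReal_realSigns]
  rw [h1] at hg
  obtain ⟨h2, h3⟩ := h.index_eq hp hg
  rw [h2, h3, Nat.card_congr Equiv.subtypeSum, Nat.card_congr Equiv.subtypeSum, Nat.card_sum,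
    Nat.card_sum]
  simp only [Sum.elim_inl, Sum.elim_inr, card_realSigns_neg, card_realSigns_pos, and_self]

end Signature

/-! ### Consequences of the pullback conditions. -/

section Adapted

variable {E : Type*} [NormedAddCommGroup E] [NormedSpace ℝ E]
  {M : Type*} [TopologicalSpace M] [ChartedSpace E M] [IsManifold 𝓘(ℝ, E) ∞ M]
  {E' : Type*} [NormedAddCommGroup E'] [NormedSpace ℝ E']
  {M' : Type*} [TopologicalSpace M'] [ChartedSpace E' M'] [IsManifold 𝓘(ℝ, E') ∞ M']
  {n n' m : ℕ} {S : CRStructure E M n} {S' : CRStructure E' M' n'} {f : M → M'}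
  {U W : Set M} {W' : Set M'} {θ : OneForm E M ℝ} {θα : Fin n → OneForm E M ℂ}
  {θ' : OneForm E' M' ℝ} {θ'α : Fin n → OneForm E' M' ℂ} {θ'a : Fin m → OneForm E' M' ℂ}

/-- The target's characteristic vector and `df(T)` have the same values under `θ'` and under all
other forms of the coframe, and a real vector is determined by these. -/
theorem PullsBackTo.isReebAt (h : PullsBackTo S' f W W' θ θα θ' θ'α θ'a)
    (hS' : S'.LeviNondegenerate) (hθ : IsAdmissibleCoframe S U θ θα) (hWU : W ⊆ U) {p : M}
    (hp : p ∈ W) {T : TangentSpace 𝓘(ℝ, E) p} (hT : IsReebAt θ p T) :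
    IsReebAt θ' (f p) (mfderiv 𝓘(ℝ, E) 𝓘(ℝ, E') f p T) := by
  obtain ⟨T', hT'⟩ := h.admissible.contact.exists_isReebAt h.isOpen_target hS' (h.mapsTo hp)
  have h1 : θ' (f p) (mfderiv 𝓘(ℝ, E) 𝓘(ℝ, E') f p T) = 1 :=
    (DFunLike.congr_fun (h.pull_contact p hp) T).trans hT.1
  have h2 : mfderiv 𝓘(ℝ, E) 𝓘(ℝ, E') f p T - T' = 0 := by
    refine h.admissible.real_eq_zero (h.mapsTo hp) (by rw [map_sub, h1, hT'.1, sub_self]) ?_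
    intro k
    rw [map_sub, h.admissible.reeb _ (h.mapsTo hp) T' hT' k, sub_zero]
    rcases k with α | a
    · exact (DFunLike.congr_fun (h.pull_tangential p hp α) T).trans
        (hθ.reeb p (hWU hp) T hT α)
    · exact DFunLike.congr_fun (h.pull_normal p hp a) T
  rw [sub_eq_zero.1 h2]
  exact hT'

/-- The tangential block of the Levi matrix of an adapted coframe. -/
theorem PullsBackTo.toBlocks₁₁_eq (h : PullsBackTo S' f W W' θ θα θ' θ'α θ'a) (hf : IsCRMap S S' f)
    (hθ : IsAdmissibleCoframe S U θ θα) (hWU : W ⊆ U) {p : M}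
    (hp : p ∈ W) {g : Matrix (Fin n) (Fin n) ℂ} (hg : HasLeviMatrixAt θ θα p g)
    {G : Matrix (Fin n ⊕ Fin m) (Fin n ⊕ Fin m) ℂ}
    (hG : HasLeviMatrixAt θ' (Sum.elim θ'α θ'a) (f p) G) : G.toBlocks₁₁ = g := by
  obtain ⟨L, h0, h1, h2, h3⟩ := hg
  obtain ⟨L', h0', h1', h2', h3'⟩ := hG
  have hL : ∀ α, S.IsHol p (L α) := fun α ↦ hθ.isHol_of_dual (hWU hp) (h0 α) (h2 α)
  have hL' : ∀ α, S'.IsHol (f p) (L' α) := fun α ↦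
    h.admissible.isHol_of_dual (h.mapsTo hp) (h0' α) (h2' α)
  -- The pullback conditions say that `df` carries the dual frame of the source to the tangential
  -- part of the dual frame of the target.
  have hpush : ∀ α, pushC E E' f p (L α) = L' (Sum.inl α) := by
    intro α
    rw [h.admissible.eq_sum (h.mapsTo hp) hL' h1' (hf.isHol (hL α)), Fintype.sum_sum_type]
    simp only [Sum.elim_inl, Sum.elim_inr, ← evalC_pullAt, h.pull_tangential p hp,
      h.pull_normal p hp, h1, evalC_zero]
    simp
  ext α β
  change G (Sum.inl α) (Sum.inl β) = g α β
  rw [← h3', ← h3, ← hpush, ← hpush, ← leviForm_pullAt (hf.smooth p)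
    (h.admissible.contact.smoothFormAt h.isOpen_target (h.mapsTo hp))]
  -- Equality on the open set `W`, not only at `p`, is what allows differentiation.
  have hext : extD (pullAt (E := E) f θ') p = extD θ p :=
    extDAt_congr (Filter.eventually_of_mem (h.isOpen_source.mem_nhds hp) h.pull_contact)
  simp only [leviForm, extDC, hext]

/-- Contact forms of the target are determined at a point by their pullback. -/
theorem IsContactForm.eq_of_pullAt_eq {U₁ U₂ : Set M'} {θ₁ θ₂ : OneForm E' M' ℝ}
    (h₁ : IsContactForm S' U₁ θ₁) (h₂ : IsContactForm S' U₂ θ₂) {p : M} (hp₁ : f p ∈ U₁)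
    (hp₂ : f p ∈ U₂) (h0 : θ p ≠ 0) (e₁ : pullAt f θ₁ p = θ p) (e₂ : pullAt f θ₂ p = θ p) :
    θ₂ (f p) = θ₁ (f p) := by
  obtain ⟨c, hc⟩ := S'.exists_eq_smul (h₁.ne_zero _ hp₁) (h₁.annihilates _ hp₁)
    (h₂.annihilates _ hp₂)
  have h3 : θ p = c • θ p := by
    conv_lhs => rw [← e₂]
    rw [← e₁]
    ext v
    exact DFunLike.congr_fun hc _
  have h4 : c = 1 := by
    have h5 : (1 - c) • θ p = 0 := by rw [sub_smul, one_smul, ← h3, sub_self]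
    rcases smul_eq_zero.1 h5 with h | h
    · linarith
    · exact absurd h h0
  rw [hc, h4, one_smul]

end Adapted

/-! ### Normalized coframes: existence, uniqueness and change. -/

section Normalization

variable {E : Type*} [NormedAddCommGroup E] [NormedSpace ℝ E]
  {M : Type*} [TopologicalSpace M] [ChartedSpace E M] [IsManifold 𝓘(ℝ, E) ∞ M]
  {E' : Type*} [NormedAddCommGroup E'] [NormedSpace ℝ E']
  {M' : Type*} [TopologicalSpace M'] [ChartedSpace E' M'] [IsManifold 𝓘(ℝ, E') ∞ M']
  {n n' : ℕ} {S : CRStructure E M n} {S' : CRStructure E' M' n'} {f : M → M'}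

theorem isUnit_signs (m l : ℕ) : IsUnit (Matrix.diagonal (signs m l)) :=
  IsUnit.of_mul_eq_one _ (signs_sq m l)

/-- The normalizing matrix leaves the tangential columns alone at points of the image, so the
pullback conditions are kept while the Levi matrix becomes diagonal on a whole neighborhood. The
number `j` counts the negative entries of the normal block. -/
theorem IsCRMap.exists_isAdapted (hf : IsCRMap S S' f)
    (hft : ∀ p : M, CRTransversalAt (E := E) S' f p) (hS : S.LeviNondegenerate)
    (hS' : S'.LeviNondegenerate) {U : Set M} (hU : IsOpen U) {θ : OneForm E M ℝ}
    {θα : Fin n → OneForm E M ℂ} (hθ : IsAdmissibleCoframe S U θ θα) {l : ℕ}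
    (hg : ∀ p ∈ U, HasLeviMatrixAt θ θα p (Matrix.diagonal (signs n l))) {p : M} (hp : p ∈ U) :
    ∃ j ≤ n' - n, ∃ (W : Set M) (W' : Set M') (θ' : OneForm E' M' ℝ)
      (θ'α : Fin n → OneForm E' M' ℂ) (θ'a : Fin (n' - n) → OneForm E' M' ℂ),
      p ∈ W ∧ W ⊆ U ∧ IsAdapted S' f l (l + j) W W' θ θα θ' θ'α θ'a := by
  obtain ⟨W₀, W₀', θ', ψ, G, hpW₀, hW₀U, hpb, hG⟩ := hf.exists_pullsBackTo hft hS hS' hU hθ hp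
  have hψ : IsAdmissibleCoframe S' W₀' θ' ψ := by
    have := hpb.admissible
    rwa [show (Sum.elim (fun α ↦ ψ (Sum.inl α)) fun a ↦ ψ (Sum.inr a)) = ψ from
      Sum.elim_comp_inl_inr ψ] at this
  have hpW₀' : f p ∈ W₀' := hpb.mapsTo hpW₀
  have hnear : ∀ᶠ q in 𝓝 (f p), q ∈ W₀' := hpb.isOpen_target.mem_nhds hpW₀'
  have hblock : ∀ x ∈ W₀, (G (f x)).toBlocks₁₁ = Matrix.diagonal (signs n l) := by
    intro x hx
    refine hpb.toBlocks₁₁_eq hf hθ hW₀U hx (hg x (hW₀U hx)) ?_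
    rw [show (Sum.elim (fun α ↦ ψ (Sum.inl α)) fun a ↦ ψ (Sum.inr a)) = ψ from
      Sum.elim_comp_inl_inr ψ]
    exact (hG _ (hpb.mapsTo hx)).2
  obtain ⟨j, hj, P, hP, hPf⟩ := exists_normal_form (signs_conjTranspose n l) (signs_sq n l)
    (hnear.mono fun q hq ↦ (hG q hq).1) (hnear.mono fun q hq ↦ (hG q hq).2.conjTranspose)
    (hψ.isUnit_leviMatrix hpb.isOpen_target hS' hpW₀' (hG _ hpW₀').2) (hblock p hpW₀)
  obtain ⟨W', hW's, hW'o, hpW'⟩ := mem_nhds_iff.1 (hP.and hnear)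
  -- The Levi matrix changes by `Qᵀ G` times the conjugate of `Q`, so the conjugate of `P` is needed
  -- in order to obtain `Pᴴ G P`.
  let Q : M' → Matrix (Fin n ⊕ Fin (n' - n)) (Fin n ⊕ Fin (n' - n)) ℂ :=
    fun q ↦ (P q).map (starRingEnd ℂ)
  have hdet : ∀ q ∈ W', IsUnit (Q q).det := by
    intro q hq
    have h1 : IsUnit ((P q)ᴴ * G q * P q).det := by
      rw [(hW's hq).1.2, Matrix.det_fromBlocks_zero₂₁]
      exact ((Matrix.isUnit_iff_isUnit_det _).1 (isUnit_signs n l)).mul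
        ((Matrix.isUnit_iff_isUnit_det _).1 (isUnit_signs _ j))
    rw [Matrix.det_mul, Matrix.det_mul] at h1
    have h2 : IsUnit ((P q)ᴴ).det := isUnit_of_mul_isUnit_left (isUnit_of_mul_isUnit_left h1)
    rw [← Matrix.det_transpose] at h2
    exact h2
  have hQ : ∀ q ∈ W', SmoothMatAt E' Q q := fun q hq ↦ (hW's hq).1.1.conj
  let χ : Fin n ⊕ Fin (n' - n) → OneForm E' M' ℂ := fun k q ↦ ∑ i, (Q q)⁻¹ k i • ψ i q
  have hχ : IsAdmissibleCoframe S' W' θ' χ := (hψ.mono fun q hq ↦ (hW's hq).2).change hW'o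
    (C := fun q ↦ (Q q)⁻¹) (D := Q)
    (fun k i q hq ↦ ((hQ q hq).inv ((Matrix.isUnit_iff_isUnit_det _).2 (hdet q hq))) k i)
    (fun q hq ↦ Matrix.nonsing_inv_mul _ (hdet q hq))
    (fun q hq ↦ Matrix.mul_nonsing_inv _ (hdet q hq))
  have hχe : (Sum.elim (fun α ↦ χ (Sum.inl α)) fun a ↦ χ (Sum.inr a)) = χ :=
    Sum.elim_comp_inl_inr χ
  have hpull : ∀ x ∈ W₀ ∩ f ⁻¹' W', ∀ k, pullAt (E := E) f (χ k) x =
      ∑ α : Fin n, (1 : Matrix (Fin n ⊕ Fin (n' - n)) (Fin n ⊕ Fin (n' - n)) ℂ) k (Sum.inl α) •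
        θα α x := by
    intro x hx k
    obtain ⟨h2, h3⟩ := hPf (f x) (hblock x hx.1)
    have h1 : (Q (f x))⁻¹ * Q (f x) = 1 := Matrix.nonsing_inv_mul _ (hdet _ hx.2)
    refine (pullAt_sum_smul f (fun q i ↦ (Q q)⁻¹ k i) ψ x).trans ?_
    rw [Fintype.sum_sum_type, ← h1]
    simp only [hpb.pull_tangential x hx.1, hpb.pull_normal x hx.1, smul_zero, Finset.sum_const_zero,
      add_zero]
    refine Finset.sum_congr rfl fun α _ ↦ congrArg (· • θα α x) ?_
    rw [Matrix.mul_apply, Fintype.sum_sum_type]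
    have h4 : ∀ i, Q (f x) (Sum.inl i) (Sum.inl α) = if i = α then 1 else 0 := fun i ↦ by
      have : P (f x) (Sum.inl i) (Sum.inl α) = (1 : Matrix (Fin n) (Fin n) ℂ) i α :=
        congrFun (congrFun h2 i) α
      simp only [Q, Matrix.map_apply, this, Matrix.one_apply]
      split_ifs <;> simp
    have h5 : ∀ i, Q (f x) (Sum.inr i) (Sum.inl α) = 0 := fun i ↦ by
      have : P (f x) (Sum.inr i) (Sum.inl α) = 0 := congrFun (congrFun h3 i) α
      simp only [Q, Matrix.map_apply, this, map_zero]
    simp [h4, h5]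
  refine ⟨j, hj, W₀ ∩ f ⁻¹' W', W', θ', fun α ↦ χ (Sum.inl α), fun a ↦ χ (Sum.inr a),
    ⟨hpW₀, hpW'⟩, fun x hx ↦ hW₀U hx.1,
    ⟨hpb.isOpen_source.inter (hW'o.preimage hf.smooth.continuous), hW'o, fun x hx ↦ hx.2, ?_,
      fun x hx ↦ hpb.pull_contact x hx.1, fun x hx α ↦ ?_, fun x hx a ↦ ?_⟩, fun q hq ↦ ?_⟩
  · rw [hχe]
    exact hχ
  · rw [hpull x hx]
    simp [Matrix.one_apply]
  · rw [hpull x hx]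
    simp
  · rw [hχe, Nat.add_sub_cancel_left, ← Matrix.fromBlocks_diagonal, ← (hW's hq).1.2]
    have h1 := (hG q (hW's hq).2).2.change (C := fun q ↦ (Q q)⁻¹) (D := Q q)
      (Matrix.nonsing_inv_mul _ (hdet q hq))
    have h2 : (Q q).map (starRingEnd ℂ) = P q := by
      ext i j
      simp [Q]
    rw [h2] at h1
    exact h1

section
variable {m l k : ℕ} {U W : Set M} {W' : Set M'} {θ : OneForm E M ℝ} {θα : Fin n → OneForm E M ℂ}
  {θ' : OneForm E' M' ℝ} {θ'α : Fin n → OneForm E' M' ℂ} {θ'a : Fin m → OneForm E' M' ℂ}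

theorem IsAdapted.index_eq (h : IsAdapted S' f l k W W' θ θα θ' θ'α θ'a) {p : M} (hp : p ∈ W) :
    S'.negIndex θ' (f p) = min l n + min (k - l) m ∧
      S'.posIndex θ' (f p) = (n - l) + (m - (k - l)) :=
  h.admissible.index_signs_sum (h.mapsTo hp) (h.levi _ (h.mapsTo hp))

/-- Contact forms with the same nonzero pullback at `p` agree at `f p`, and there the Levi form
depends only on that value; so one adapted coframe computes the index for all of them. -/
theorem IsAdapted.isNegIndexAlong (h : IsAdapted S' f l k W W' θ θα θ' θ'α θ'a)
    (hθ : IsContactForm S U θ) (hWU : W ⊆ U) {p : M} (hp : p ∈ W) {d : ℕ}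
    (hd : S'.negIndex θ' (f p) = d) : IsNegIndexAlong S' f θ p d := by
  intro U'' θ'' hU'' hp'' hθ'' hpull
  rw [← hd]
  exact h.admissible.contact.negIndex_eq h.isOpen_target hθ'' hU'' (h.mapsTo hp) hp''
    (h.admissible.contact.eq_of_pullAt_eq hθ'' (h.mapsTo hp) hp'' (hθ.ne_zero p (hWU hp))
      (h.pull_contact p hp) hpull)

/-- Adapted coframes are unique along the source up to pseudo-unitary transformations. -/
theorem IsAdapted.exists_unitary {θα₁ θα₂ : Fin n → OneForm E M ℂ} {W'₁ W'₂ : Set M'}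
    {θ'₁ θ'₂ : OneForm E' M' ℝ} {θ'α₁ θ'α₂ : Fin n → OneForm E' M' ℂ}
    {θ'a₁ θ'a₂ : Fin m → OneForm E' M' ℂ} (hS : S.LeviNondegenerate) (hS' : S'.LeviNondegenerate)
    (hθ₁ : IsAdmissibleCoframe S W θ θα₁) (hθ₂ : IsAdmissibleCoframe S W θ θα₂)
    (h₁ : IsAdapted S' f l k W W'₁ θ θα₁ θ'₁ θ'α₁ θ'a₁)
    (h₂ : IsAdapted S' f l k W W'₂ θ θα₂ θ'₂ θ'α₂ θ'a₂) {p : M} (hp : p ∈ W) :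
    θ'₂ (f p) = θ'₁ (f p) ∧
      ∃ u ∈ indefUnitary n l, ∃ v ∈ indefUnitary m (k - l),
        (∀ α, θ'α₂ α (f p) = ∑ β, u α β • θ'α₁ β (f p)) ∧
        (∀ a, θ'a₂ a (f p) = ∑ b, v a b • θ'a₁ b (f p)) := by
  have hq₁ := h₁.mapsTo hp
  have hq₂ := h₂.mapsTo hp
  have hc := h₁.admissible.contact.eq_of_pullAt_eq h₂.admissible.contact hq₁ hq₂
    (hθ₁.contact.ne_zero p hp) (h₁.pull_contact p hp) (h₂.pull_contact p hp)
  refine ⟨hc, ?_⟩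
  obtain ⟨T, hT⟩ := hθ₁.contact.exists_isReebAt h₁.isOpen_source hS hp
  have hT₁ := h₁.isReebAt hS' hθ₁ subset_rfl hp hT
  have hT₂ := h₂.isReebAt hS' hθ₂ subset_rfl hp hT
  obtain ⟨L₁, a0, a1, a2, a3⟩ := h₁.levi _ hq₁
  obtain ⟨L₂, b0, b1, b2, b3⟩ := h₂.levi _ hq₂
  have hL₁ : ∀ i, S'.IsHol (f p) (L₁ i) := fun i ↦ h₁.admissible.isHol_of_dual hq₁ (a0 i) (a2 i)
  have hL₂ : ∀ i, S'.IsHol (f p) (L₂ i) := fun i ↦ h₂.admissible.isHol_of_dual hq₂ (b0 i) (b2 i)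
  let ψ₁ : Fin n ⊕ Fin m → OneForm E' M' ℂ := Sum.elim θ'α₁ θ'a₁
  let ψ₂ : Fin n ⊕ Fin m → OneForm E' M' ℂ := Sum.elim θ'α₂ θ'a₂
  -- The transition matrix has no contact component, since both families kill the common
  -- characteristic vector `df(T)`.
  let C : Matrix (Fin n ⊕ Fin m) (Fin n ⊕ Fin m) ℂ := fun i j ↦ evalC (f p) (ψ₂ i (f p)) (L₁ j)
  have hC : ∀ i, ψ₂ i (f p) = ∑ j, C i j • ψ₁ j (f p) := by
    intro i
    refine h₁.admissible.contact.holCotangent_ext hq₁ hT₁.1 (h₂.admissible.mem_holCotangent hq₂ i)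
      (Submodule.sum_mem _ fun j _ ↦ Submodule.smul_mem _ _
        (h₁.admissible.mem_holCotangent hq₁ j)) ?_ fun Z hZ ↦ ?_
    · have e1 : ∀ j, ψ₁ j (f p) (mfderiv 𝓘(ℝ, E) 𝓘(ℝ, E') f p T) = 0 :=
        h₁.admissible.reeb _ hq₁ _ hT₁
      have e2 : ψ₂ i (f p) (mfderiv 𝓘(ℝ, E) 𝓘(ℝ, E') f p T) = 0 :=
        h₂.admissible.reeb _ hq₂ _ hT₂ i
      rw [e2]
      simp [e1]
    · conv_rhs => rw [h₁.admissible.eq_sum hq₁ hL₁ a1 hZ]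
      rw [evalC_sum, map_sum]
      refine Finset.sum_congr rfl fun j _ ↦ ?_
      rw [map_smul, smul_eq_mul, mul_comm]
  -- Pulling the normal forms of the second coframe back gives zero on one side and a combination of
  -- the independent `θα₁` on the other.
  have hC0 : ∀ a β, C (Sum.inr a) (Sum.inl β) = 0 := by
    intro a
    have e1 : ∑ β, C (Sum.inr a) (Sum.inl β) • θα₁ β p = 0 := by
      rw [← h₂.pull_normal p hp a]
      have e2 : pullAt (E := E) f (θ'a₂ a) p =
          pullAt (E := E) f (fun q ↦ ∑ j, C (Sum.inr a) j • ψ₁ j q) p := by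
        ext v
        exact DFunLike.congr_fun (hC (Sum.inr a)) _
      rw [e2, pullAt_sum_smul f (fun _ j ↦ C (Sum.inr a) j) ψ₁ p, Fintype.sum_sum_type]
      have e3 : ∀ β, pullAt (E := E) f (ψ₁ (Sum.inl β)) p = θα₁ β p := h₁.pull_tangential p hp
      have e4 : ∀ b, pullAt (E := E) f (ψ₁ (Sum.inr b)) p = 0 := h₁.pull_normal p hp
      simp only [e3, e4, smul_zero, Finset.sum_const_zero, add_zero]
    have hli : LinearIndependent ℂ fun β ↦ θα₁ β p :=
      (hθ₁.linearIndependent p hp).comp some (Option.some_injective _)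
    exact Fintype.linearIndependent_iff.1 hli _ e1
  let D : Matrix (Fin n ⊕ Fin m) (Fin n ⊕ Fin m) ℂ :=
    Matrix.diagonal (Sum.elim (signs n l) (signs m (k - l)))
  -- The contact forms need not agree away from the image, but equal values at `f p` give equal Levi
  -- forms on `T^{1,0}` there. The columns of `C` are the components of `L₁` in the frame `L₂`.
  have hCD : Cᴴ * D * C = D := by
    ext i j
    have e1 : leviForm θ'₂ (f p) (L₁ j) (L₁ i) = D j i := by
      rw [h₁.admissible.contact.leviForm_eq h₁.isOpen_target h₂.admissible.contact
        h₂.isOpen_target hq₁ hq₂ hc (hL₁ j) (hL₁ i)]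
      exact a3 j i
    have e2 : D j i = D i j := by
      simp only [D]
      conv_lhs => rw [← Matrix.diagonal_transpose, Matrix.transpose_apply]
    rw [← e2, ← e1, h₂.admissible.eq_sum hq₂ hL₂ b1 (hL₁ j),
      h₂.admissible.eq_sum hq₂ hL₂ b1 (hL₁ i), leviForm_sum_left]
    simp only [leviForm_sum_right, b3, Matrix.mul_apply, Matrix.diagonal_apply, mul_ite, mul_zero,
      Finset.sum_ite_eq, Finset.sum_ite_eq', Finset.mem_univ, if_true, Matrix.conjTranspose_apply, D]
    refine Finset.sum_congr rfl fun x _ ↦ ?_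
    change starRingEnd ℂ (C x i) * _ * C x j = C x j * (starRingEnd ℂ (C x i) * _)
    ring
  have hCb : C = Matrix.fromBlocks C.toBlocks₁₁ C.toBlocks₁₂ 0 C.toBlocks₂₂ := by
    conv_lhs => rw [← Matrix.fromBlocks_toBlocks C]
    congr 1
    ext a β
    exact hC0 a β
  rw [hCb] at hCD
  simp only [D, ← Matrix.fromBlocks_diagonal] at hCD
  obtain ⟨hu, h0, hv⟩ := blocks_of_isometry (isUnit_signs n l) hCD
  refine ⟨C.toBlocks₁₁, hu, C.toBlocks₂₂, hv, fun α ↦ ?_, fun a ↦ ?_⟩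
  · refine (hC (Sum.inl α)).trans ?_
    rw [Fintype.sum_sum_type]
    have e1 : ∀ b, C (Sum.inl α) (Sum.inr b) = 0 := fun b ↦ congrFun (congrFun h0 α) b
    simp only [e1, zero_smul, Finset.sum_const_zero, add_zero]
    rfl
  · refine (hC (Sum.inr a)).trans ?_
    rw [Fintype.sum_sum_type]
    simp only [hC0, zero_smul, Finset.sum_const_zero, zero_add]
    rfl

/-- An explicit inverse, polynomial in the entries of the matrix and their conjugates. -/
theorem indefUnitary.inverse {u : Matrix (Fin m) (Fin m) ℂ} (hu : u ∈ indefUnitary m l) :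
    Matrix.diagonal (signs m l) * uᴴ * Matrix.diagonal (signs m l) * u = 1 := by
  have h : uᴴ * Matrix.diagonal (signs m l) * u = Matrix.diagonal (signs m l) := hu
  calc _ = Matrix.diagonal (signs m l) * (uᴴ * Matrix.diagonal (signs m l) * u) := by
        simp only [Matrix.mul_assoc]
    _ = 1 := by rw [h, signs_sq]

/-- Pseudo-unitary transformations lead from adapted coframes to adapted coframes. -/
theorem IsAdapted.transform (h : IsAdapted S' f l k W W' θ θα θ' θ'α θ'a)
    {u : M' → Matrix (Fin n) (Fin n) ℂ} {v : M' → Matrix (Fin m) (Fin m) ℂ}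
    (hus : ∀ α β, ContMDiffOn 𝓘(ℝ, E') 𝓘(ℝ, ℂ) ∞ (fun q ↦ u q α β) W')
    (hvs : ∀ a b, ContMDiffOn 𝓘(ℝ, E') 𝓘(ℝ, ℂ) ∞ (fun q ↦ v q a b) W')
    (hu : ∀ q ∈ W', u q ∈ indefUnitary n l) (hv : ∀ q ∈ W', v q ∈ indefUnitary m (k - l)) :
    IsAdapted S' f l k W W' θ (fun α p ↦ ∑ β, u (f p) α β • θα β p)
      θ' (fun α q ↦ ∑ β, u q α β • θ'α β q) (fun a q ↦ ∑ b, v q a b • θ'a b q) := by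
  let D : Matrix (Fin n ⊕ Fin m) (Fin n ⊕ Fin m) ℂ :=
    Matrix.diagonal (Sum.elim (signs n l) (signs m (k - l)))
  have hD : D = Matrix.fromBlocks (Matrix.diagonal (signs n l)) 0 0
    (Matrix.diagonal (signs m (k - l))) := (Matrix.fromBlocks_diagonal _ _).symm
  have hDD : D * D = 1 := by
    rw [hD, Matrix.fromBlocks_multiply]
    simp only [signs_sq, Matrix.mul_zero, Matrix.zero_mul, add_zero, zero_add,
      Matrix.fromBlocks_one]
  have hDt : Dᵀ = D := Matrix.diagonal_transpose _
  let C : M' → Matrix (Fin n ⊕ Fin m) (Fin n ⊕ Fin m) ℂ :=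
    fun q ↦ Matrix.fromBlocks (u q) 0 0 (v q)
  have hinv : ∀ q ∈ W', D * (C q)ᴴ * D * C q = 1 := by
    intro q hq
    simp only [hD, C, Matrix.fromBlocks_conjTranspose, Matrix.fromBlocks_multiply,
      Matrix.conjTranspose_zero, Matrix.mul_zero, Matrix.zero_mul, add_zero, zero_add,
      indefUnitary.inverse (hu q hq), indefUnitary.inverse (hv q hq), Matrix.fromBlocks_one]
  have hinv' : ∀ q ∈ W', C q * (D * (C q)ᴴ * D) = 1 := fun q hq ↦
    mul_eq_one_comm.1 (hinv q hq)
  have hform : (Sum.elim (fun α q ↦ ∑ β, u q α β • θ'α β q) (fun a q ↦ ∑ b, v q a b • θ'a b q) :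
      Fin n ⊕ Fin m → OneForm E' M' ℂ) = fun k q ↦ ∑ i, C q k i • Sum.elim θ'α θ'a i q := by
    funext k q
    rcases k with α | a
    · simp [Fintype.sum_sum_type, C]
    · simp [Fintype.sum_sum_type, C]
  refine ⟨⟨h.isOpen_source, h.isOpen_target, h.mapsTo, ?_, h.pull_contact, fun p hp α ↦ ?_,
    fun p hp a ↦ ?_⟩, fun q hq ↦ ?_⟩
  · rw [hform]
    refine h.admissible.change h.isOpen_target (D := fun q ↦ D * (C q)ᴴ * D) ?_ hinv' hinv
    rintro (α | a) (β | b) q hq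
    · exact (hus α β).contMDiffAt (h.isOpen_target.mem_nhds hq)
    · exact contMDiffAt_const
    · exact contMDiffAt_const
    · exact (hvs a b).contMDiffAt (h.isOpen_target.mem_nhds hq)
  · refine (pullAt_sum_smul f (fun q β ↦ u q α β) θ'α p).trans ?_
    simp only [h.pull_tangential p hp]
  · refine (pullAt_sum_smul f (fun q b ↦ v q a b) θ'a p).trans ?_
    simp only [h.pull_normal p hp, smul_zero, Finset.sum_const_zero]
  · rw [hform]
    have h1 := (h.levi q hq).change (C := C) (D := D * (C q)ᴴ * D) (hinv' q hq)
    have hDc : D.map (starRingEnd ℂ) = D := by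
      have : Dᴴ = D := by
        rw [hD, Matrix.fromBlocks_conjTranspose, signs_conjTranspose, signs_conjTranspose]
        simp
      have e := congrArg Matrix.transpose this
      rw [hDt] at e
      exact e
    -- The inverse of an isometry of `D` is again one, in the transposed convention of the Levi
    -- matrix; the conjugate of `hinv'` is the identity that is used.
    have h2 : (D * (C q)ᴴ * D)ᵀ * D * (D * (C q)ᴴ * D).map (starRingEnd ℂ) = D := by
      have e1 : (D * (C q)ᴴ * D).map (starRingEnd ℂ) = D * (C q)ᵀ * D := by
        rw [Matrix.map_mul, Matrix.map_mul, hDc]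
        congr 2
        ext i j
        simp
      have e2 : (D * (C q)ᴴ * D)ᵀ = D * (C q).map (starRingEnd ℂ) * D := by
        rw [Matrix.transpose_mul, Matrix.transpose_mul, hDt, Matrix.mul_assoc]
        rfl
      have e3 : (C q).map (starRingEnd ℂ) * D * (C q)ᵀ * D = 1 := by
        have := congrArg (fun A ↦ A.map (starRingEnd ℂ)) (hinv' q hq)
        simp only [Matrix.map_mul, hDc] at this
        rw [← Matrix.mul_assoc, ← Matrix.mul_assoc] at this
        refine Eq.trans ?_ (this.trans (by simp))
        congr 2
        ext i j
        simp
      calc _ = D * (C q).map (starRingEnd ℂ) * D * D * (D * (C q)ᵀ * D) := by rw [e1, e2]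
        _ = D * (C q).map (starRingEnd ℂ) * (D * D) * (D * (C q)ᵀ * D) := by
          simp only [Matrix.mul_assoc]
        _ = D * ((C q).map (starRingEnd ℂ) * D * (C q)ᵀ * D) := by
          rw [hDD, Matrix.mul_one]; simp only [Matrix.mul_assoc]
        _ = D := by rw [e3, Matrix.mul_one]
    have h3 : (D * (C q)ᴴ * D)ᵀ * Matrix.diagonal (Sum.elim (signs n l) (signs m (k - l))) *
      (D * (C q)ᴴ * D).map (starRingEnd ℂ) = D := h2
    rw [h3] at h1
    exact h1

end

end Normalization

end CRGeom

end

theorem proposition3p1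
    {E : Type*} [NormedAddCommGroup E] [NormedSpace ℝ E]
    {M : Type*} [TopologicalSpace M] [ChartedSpace E M] [IsManifold 𝓘(ℝ, E) ∞ M]
    {E' : Type*} [NormedAddCommGroup E'] [NormedSpace ℝ E']
    {M' : Type*} [TopologicalSpace M'] [ChartedSpace E' M'] [IsManifold 𝓘(ℝ, E') ∞ M']
    {n n' l l' : ℕ}
    (S : CRGeom.CRStructure E M n) (S' : CRGeom.CRStructure E' M' n')
    (hS : S.LeviNondegenerate) (hS' : S'.LeviNondegenerate)
    (hl : S.HasSignature l) (hl' : S'.HasSignature l')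
    (f : M → M') (hf : CRGeom.IsCRMap S S' f)
    (hft : ∀ p : M, CRGeom.CRTransversalAt (E := E) S' f p)
    (U : Set M) (hU : IsOpen U)
    (θ : CRGeom.OneForm E M ℝ) (θα : Fin n → CRGeom.OneForm E M ℂ)
    (hθ : CRGeom.IsAdmissibleCoframe S U θ θα)
    (p₀ : M) (hp₀ : p₀ ∈ U) :
    n ≤ n' ∧
    -- existence of an admissible coframe near `f p₀` that pulls back to `(θ, θ^α, 0)`
    (∃ (W : Set M) (W' : Set M') (θ' : CRGeom.OneForm E' M' ℝ)
        (θ'α : Fin n → CRGeom.OneForm E' M' ℂ) (θ'a : Fin (n' - n) → CRGeom.OneForm E' M' ℂ),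
      p₀ ∈ W ∧ W ⊆ U ∧ CRGeom.PullsBackTo S' f W W' θ θα θ' θ'α θ'a) ∧
    -- for every such coframe, the characteristic vector field is tangent to the image of `f`
    (∀ (W : Set M) (W' : Set M') (θ' : CRGeom.OneForm E' M' ℝ)
        (θ'α : Fin n → CRGeom.OneForm E' M' ℂ) (θ'a : Fin (n' - n) → CRGeom.OneForm E' M' ℂ),
      W ⊆ U → CRGeom.PullsBackTo S' f W W' θ θα θ' θ'α θ'a →
      ∀ p ∈ W, ∃ T : TangentSpace 𝓘(ℝ, E) p, CRGeom.IsReebAt θ p T ∧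
        CRGeom.IsReebAt θ' (f p) (mfderiv 𝓘(ℝ, E) 𝓘(ℝ, E') f p T)) ∧
    -- normalization of the Levi form, and uniqueness along the image of `f`
    ((∀ p ∈ U, CRGeom.HasLeviMatrixAt θ θα p (Matrix.diagonal (CRGeom.signs n l))) →
      ∃ k : ℕ, (k = l' ∨ k = n' - l') ∧ CRGeom.IsNegIndexAlong S' f θ p₀ k ∧
        l ≤ k ∧ n + k ≤ n' + l ∧
        (∃ (W : Set M) (W' : Set M') (θ' : CRGeom.OneForm E' M' ℝ)
            (θ'α : Fin n → CRGeom.OneForm E' M' ℂ)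
            (θ'a : Fin (n' - n) → CRGeom.OneForm E' M' ℂ),
          p₀ ∈ W ∧ W ⊆ U ∧ CRGeom.IsAdapted S' f l k W W' θ θα θ' θ'α θ'a) ∧
        -- two such coframes, possibly adapted to different `θ^α`, differ along the image of `f`
        -- by an element of `U(n, l) × U(n' - n, k - l)`
        (∀ (W : Set M) (W'₁ W'₂ : Set M') (θα₁ θα₂ : Fin n → CRGeom.OneForm E M ℂ)
            (θ'₁ θ'₂ : CRGeom.OneForm E' M' ℝ)
            (θ'α₁ θ'α₂ : Fin n → CRGeom.OneForm E' M' ℂ)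
            (θ'a₁ θ'a₂ : Fin (n' - n) → CRGeom.OneForm E' M' ℂ),
          W ⊆ U →
          CRGeom.IsAdmissibleCoframe S W θ θα₁ → CRGeom.IsAdmissibleCoframe S W θ θα₂ →
          CRGeom.IsAdapted S' f l k W W'₁ θ θα₁ θ'₁ θ'α₁ θ'a₁ →
          CRGeom.IsAdapted S' f l k W W'₂ θ θα₂ θ'₂ θ'α₂ θ'a₂ →
          ∀ p ∈ W, θ'₂ (f p) = θ'₁ (f p) ∧
            ∃ u ∈ CRGeom.indefUnitary n l, ∃ v ∈ CRGeom.indefUnitary (n' - n) (k - l),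
              (∀ α, θ'α₂ α (f p) = ∑ β, u α β • θ'α₁ β (f p)) ∧
              (∀ a, θ'a₂ a (f p) = ∑ b, v a b • θ'a₁ b (f p))) ∧
        -- conversely, such transformations lead from adapted coframes to adapted coframes
        (∀ (W : Set M) (W' : Set M') (θ' : CRGeom.OneForm E' M' ℝ)
            (θ'α : Fin n → CRGeom.OneForm E' M' ℂ)
            (θ'a : Fin (n' - n) → CRGeom.OneForm E' M' ℂ)
            (u : M' → Matrix (Fin n) (Fin n) ℂ) (v : M' → Matrix (Fin (n' - n)) (Fin (n' - n)) ℂ),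
          W ⊆ U → CRGeom.IsAdapted S' f l k W W' θ θα θ' θ'α θ'a →
          (∀ α β, ContMDiffOn 𝓘(ℝ, E') 𝓘(ℝ, ℂ) ∞ (fun q ↦ u q α β) W') →
          (∀ a b, ContMDiffOn 𝓘(ℝ, E') 𝓘(ℝ, ℂ) ∞ (fun q ↦ v q a b) W') →
          (∀ q ∈ W', u q ∈ CRGeom.indefUnitary n l) →
          (∀ q ∈ W', v q ∈ CRGeom.indefUnitary (n' - n) (k - l)) →
          CRGeom.IsAdapted S' f l k W W' θ (fun α p ↦ ∑ β, u (f p) α β • θα β p)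
            θ' (fun α q ↦ ∑ β, u q α β • θ'α β q) (fun a q ↦ ∑ b, v q a b • θ'a b q))) := by
  refine ⟨hf.dim_le hft hS p₀, ?_, fun W W' θ' θ'α θ'a hWU h p hp ↦ ?_, fun hg ↦ ?_⟩
  · obtain ⟨W, W', θ', ψ, G, hp, hWU, h, -⟩ := hf.exists_pullsBackTo hft hS hS' hU hθ hp₀
    exact ⟨W, W', θ', _, _, hp, hWU, h⟩
  · obtain ⟨T, hT⟩ := hθ.contact.exists_isReebAt hU hS (hWU hp)
    exact ⟨T, hT, h.isReebAt hS' hθ hWU hp hT⟩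
  · obtain ⟨j, hj, W, W', θ', θ'α, θ'a, hp, hWU, h⟩ :=
      hf.exists_isAdapted hft hS hS' hU hθ hg hp₀
    have hn := hf.dim_le hft hS p₀
    -- The signature hypotheses, evaluated with the counts of signs, become `min l (n - l) = l` and
    -- `min k (n' - k) = l'` with `k = l + j` and `j ≤ n' - n`. The first gives `l ≤ n`, so the
    -- truncated subtractions are harmless, and all numerical claims follow.
    have h1 := hl p₀ U θ hU hp₀ hθ.contact
    have h2 := hl' (f p₀) W' θ' h.isOpen_target (h.mapsTo hp) h.admissible.contact
    obtain ⟨h3, h4⟩ := hθ.index_signs hp₀ (hg p₀ hp₀)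
    obtain ⟨h5, h6⟩ := h.index_eq hp
    rw [h3, h4] at h1
    rw [h5, h6] at h2
    refine ⟨l + j, by omega, h.isNegIndexAlong hθ.contact hWU hp (by omega), by omega, by omega,
      ⟨W, W', θ', θ'α, θ'a, hp, hWU, h⟩, ?_, ?_⟩
    · intro W W'₁ W'₂ θα₁ θα₂ θ'₁ θ'₂ θ'α₁ θ'α₂ θ'a₁ θ'a₂ _ hθ₁ hθ₂ h₁ h₂ p hp
      exact h₁.exists_unitary hS hS' hθ₁ hθ₂ h₂ hp
    · intro W W' θ' θ'α θ'a u v _ h hus hvs hu hv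
      exact h.transform hus hvs hu hv
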